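/- **Setting.** There are $n$ pages, a cache size $k$ with $1\le k\le n$, a known time horizon $T\ge 1$, and an oblivious request sequence $r_1,\dots,r_T$ of pages, fixed in advance. In each round $t=1,\dots,T$ the (randomized) online algorithm is shown $r_t$ and then selects a cache $A_t$ consisting of exactly $k$ pages. It incurs the loss $\ell_{r_t}(A_t)$, where $\ell_i(C)=0$ if $i\in C$ and $\ell_i(C)=2$ if $i\notin C$, and moving from the cache $A_{t-1}$ to $A_t$ costs $d(A_t,A_{t-1})=|A_t\setminus A_{t-1}|$. **Computational model.** A paging algorithm is one fixed program for a random access machine with arrays of natural numbers and of real numbers; it receives $n,k,T$ as inputs, is run once in each round after $r_t$ has been written to memory, and keeps its memory between rounds. Arithmetic operations, exponentiation, evaluation of the error function, comparisons, memory accesses and sampling uniformly from $[0,1]$ cost one step each; literals are natural numbers. **Corollary.** There are a paging algorithm, an integer $d\ge 0$ and a constant $K$ such that for all $1\le k\le n$ there is a constant $\beta>0$ such that, for all $T\ge 1$ and all $r_1,\dots,r_T$, the random caches $A_1,\dots,A_T$ selected by the algorithm satisfy the following. * (Runtime.) For every outcome of the random samples the algorithm spends at most $d\,(n+\log T)^d$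 steps in each round (any initialization counts as part of the first round); that is, the per-round runtime is $\mathrm{poly}(n,\log T)$. * (The competitive ratio is $2H_k$, where $H_k=\sum_{j=1}^k \frac1j$.) For all caches $C_1,\dots,C_T$ of size $k$, $$\mathbb E\Big[\sum_{t=1}^T \ell_{r_t}(A_t)+\sum_{t=2}^T d(A_t,A_{t-1})\Big]\le 2H_k\Big(\sum_{t=1}^T \ell_{r_t}(C_t)+\sum_{t=2}^T d(C_t,C_{t-1})\Big)+\beta .$$ * (Regret.) For every interval $I=\{a,\dots,b\}\subseteq\{1,\dots,T\}$ and every cache $C$ of size $k$, $$\mathbb E\Big[\sum_{t=a}^b \ell_{r_t}(A_t)+\sum_{t=a+1}^b d(A_t,A_{t-1})\Big]\le \sum_{t=a}^b \ell_{r_t}(C)+K\,k\sqrt{|I|\log(nT)} .$$ -/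

import Mathlib

namespace Paging

/-! ### The computational model

A randomized real random access machine, programmed in a structured language.  The memory consists
of unboundedly many arrays of natural numbers and of real numbers, all initially zero.  One step
is charged for every arithmetic operation, exponentiation, evaluation of the error function,
comparison, memory access, and sample from the uniform distribution on `[0, 1]`.  The only literals
are natural numbers, and there is no rounding of real numbers. -/

/-- The error function `erf x = (2 / √π) ∫₀ˣ exp (-s²) ds`. -/
noncomputable def erf (x : ℝ) : ℝ :=
  2 / Real.sqrt Real.pi * ∫ s in (0 : ℝ)..x, Real.exp (-s ^ 2)

/-- Memory of the machine: arrays of naturals, arrays of reals, and the number of random samples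
that have been drawn so far. -/
structure State where
  nat : ℕ → ℕ → ℕ
  real : ℕ → ℕ → ℝ
  drawn : ℕ

/-- Natural-number expressions; `get a i` reads cell `i` of the natural-number array `a`. -/
inductive NExp where
  | lit (c : ℕ)
  | get (a : ℕ) (i : NExp)
  | add (e f : NExp)
  | sub (e f : NExp)
  | mul (e f : NExp)

/-- Real expressions; `get a i` reads cell `i` of the real array `a`. -/
inductive RExp where
  | ofNat (e : NExp)
  | get (a : ℕ) (i : NExp)
  | add (x y : RExp)
  | sub (x y : RExp)
  | mul (x y : RExp)
  | div (x y : RExp)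
  | exp (x : RExp)
  | pow (x y : RExp)
  | erf (x : RExp)

/-- Tests. -/
inductive BExp where
  | natLt (e f : NExp)
  | realLt (x y : RExp)
  | not (b : BExp)
  | and (b d : BExp)

/-- Programs. `natSet a i e` and `realSet a i x` write into cell `i` of the array `a`;
`sample a i` writes a fresh uniform sample from `[0, 1]` into cell `i` of the real array `a`. -/
inductive Program where
  | skip
  | natSet (a : ℕ) (i e : NExp)
  | realSet (a : ℕ) (i : NExp) (x : RExp)
  | sample (a : ℕ) (i : NExp)
  | seq (p q : Program)
  | cond (b : BExp) (p q : Program)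
  | loop (b : BExp) (p : Program)

/-- Value of a natural-number expression (subtraction is truncated at `0`). -/
def NExp.eval (s : State) : NExp → ℕ
  | lit c => c
  | get a i => s.nat a (i.eval s)
  | add e f => e.eval s + f.eval s
  | sub e f => e.eval s - f.eval s
  | mul e f => e.eval s * f.eval s

/-- Value of a real expression (`x / 0 = 0`, and `x ^ y` is `0` for a base `x ≤ 0`). -/
noncomputable def RExp.eval (s : State) : RExp → ℝ
  | ofNat e => (e.eval s : ℝ)
  | get a i => s.real a (i.eval s)
  | add x y => x.eval s + y.eval s
  | sub x y => x.eval s - y.eval s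
  | mul x y => x.eval s * y.eval s
  | div x y => x.eval s / y.eval s
  | exp x => Real.exp (x.eval s)
  | pow x y => if 0 < x.eval s then x.eval s ^ y.eval s else 0
  | erf x => Paging.erf (x.eval s)

/-- Truth of a test. -/
def BExp.holds (s : State) : BExp → Prop
  | natLt e f => e.eval s < f.eval s
  | realLt x y => x.eval s < y.eval s
  | not b => ¬ b.holds s
  | and b d => b.holds s ∧ d.holds s

/-- Number of steps charged for evaluating a natural-number expression. -/
def NExp.cost : NExp → ℕ
  | lit _ => 1
  | get _ i => i.cost + 1
  | add e f => e.cost + f.cost + 1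
  | sub e f => e.cost + f.cost + 1
  | mul e f => e.cost + f.cost + 1

/-- Number of steps charged for evaluating a real expression. -/
def RExp.cost : RExp → ℕ
  | ofNat e => e.cost + 1
  | get _ i => i.cost + 1
  | add x y => x.cost + y.cost + 1
  | sub x y => x.cost + y.cost + 1
  | mul x y => x.cost + y.cost + 1
  | div x y => x.cost + y.cost + 1
  | exp x => x.cost + 1
  | pow x y => x.cost + y.cost + 1
  | erf x => x.cost + 1

/-- Number of steps charged for evaluating a test. -/
def BExp.cost : BExp → ℕ
  | natLt e f => e.cost + f.cost + 1
  | realLt x y => x.cost + y.cost + 1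
  | not b => b.cost + 1
  | and b d => b.cost + d.cost + 1

/-- Write the natural number `v` into cell `i` of the natural-number array `a`. -/
def State.setNat (s : State) (a i v : ℕ) : State :=
  { s with nat := Function.update s.nat a (Function.update (s.nat a) i v) }

/-- Write the real number `v` into cell `i` of the real array `a`. -/
noncomputable def State.setReal (s : State) (a i : ℕ) (v : ℝ) : State :=
  { s with real := Function.update s.real a (Function.update (s.real a) i v) }

/-- The random source: an infinite sequence of samples from `[0, 1]`. -/
abbrev Coins : Type := ℕ → unitInterval

/-- The samples are independent and uniformly distributed on `[0, 1]`. -/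
noncomputable def coinMeasure : MeasureTheory.Measure Coins :=
  MeasureTheory.Measure.infinitePi fun _ : ℕ => (MeasureTheory.volume : MeasureTheory.Measure unitInterval)

/-- `Exec ω p s τ s'`: with random source `ω`, the program `p` started in the memory `s` halts
after exactly `τ` steps with memory `s'`. -/
inductive Exec (ω : Coins) : Program → State → ℕ → State → Prop
  | skip (s : State) : Exec ω Program.skip s 1 s
  | natSet (s : State) (a : ℕ) (i e : NExp) :
      Exec ω (Program.natSet a i e) s (i.cost + e.cost + 1) (s.setNat a (i.eval s) (e.eval s))
  | realSet (s : State) (a : ℕ) (i : NExp) (x : RExp) :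
      Exec ω (Program.realSet a i x) s (i.cost + x.cost + 1) (s.setReal a (i.eval s) (x.eval s))
  | sample (s : State) (a : ℕ) (i : NExp) :
      Exec ω (Program.sample a i) s (i.cost + 1)
        { s.setReal a (i.eval s) (ω s.drawn : ℝ) with drawn := s.drawn + 1 }
  | seq {p q : Program} {s s₁ s₂ : State} {τ₁ τ₂ : ℕ} :
      Exec ω p s τ₁ s₁ → Exec ω q s₁ τ₂ s₂ → Exec ω (Program.seq p q) s (τ₁ + τ₂) s₂
  | condTrue {b : BExp} {p q : Program} {s s' : State} {τ : ℕ} :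
      b.holds s → Exec ω p s τ s' → Exec ω (Program.cond b p q) s (b.cost + τ + 1) s'
  | condFalse {b : BExp} {p q : Program} {s s' : State} {τ : ℕ} :
      ¬ b.holds s → Exec ω q s τ s' → Exec ω (Program.cond b p q) s (b.cost + τ + 1) s'
  | loopDone {b : BExp} {p : Program} {s : State} :
      ¬ b.holds s → Exec ω (Program.loop b p) s (b.cost + 1) s
  | loopStep {b : BExp} {p : Program} {s s₁ s₂ : State} {τ₁ τ₂ : ℕ} :
      b.holds s → Exec ω p s τ₁ s₁ → Exec ω (Program.loop b p) s₁ τ₂ s₂ →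
      Exec ω (Program.loop b p) s (b.cost + τ₁ + τ₂ + 1) s₂

/-- Executions are deterministic once the random source is fixed. -/
theorem Exec.deterministic {ω : Coins} {p : Program} {s s₁ s₂ : State} {τ₁ τ₂ : ℕ}
    (h₁ : Exec ω p s τ₁ s₁) (h₂ : Exec ω p s τ₂ s₂) : τ₁ = τ₂ ∧ s₁ = s₂ := by
  induction h₁ generalizing τ₂ s₂ with
  | skip | natSet | realSet | sample => cases h₂; exact ⟨rfl, rfl⟩
  | seq _ _ ih₁ ih₂ =>
    cases h₂ with
    | seq g₁ g₂ =>
      obtain ⟨rfl, rfl⟩ := ih₁ g₁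
      obtain ⟨rfl, rfl⟩ := ih₂ g₂
      exact ⟨rfl, rfl⟩
  | condTrue hb _ ih =>
    cases h₂ with
    | condTrue _ g => obtain ⟨rfl, rfl⟩ := ih g; exact ⟨rfl, rfl⟩
    | condFalse hn _ => exact absurd hb hn
  | condFalse hb _ ih =>
    cases h₂ with
    | condTrue hn _ => exact absurd hn hb
    | condFalse _ g => obtain ⟨rfl, rfl⟩ := ih g; exact ⟨rfl, rfl⟩
  | loopDone hb =>
    cases h₂ with
    | loopDone _ => exact ⟨rfl, rfl⟩
    | loopStep hn _ _ => exact absurd hn hb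
  | loopStep hb _ _ ih₁ ih₂ =>
    cases h₂ with
    | loopDone hn => exact absurd hb hn
    | loopStep _ g₁ g₂ =>
      obtain ⟨rfl, rfl⟩ := ih₁ g₁
      obtain ⟨rfl, rfl⟩ := ih₂ g₂
      exact ⟨rfl, rfl⟩

/-! ### Paging -/

/-- Loss of the cache `C` on a request for page `i`: nothing if `i` is in the cache, and otherwise
two, for fetching `i` and then fetching back the page that was evicted. -/
def missLoss {n : ℕ} (i : Fin n) (C : Finset (Fin n)) : ℝ :=
  if i ∈ C then 0 else 2

/-- Cost of moving between two caches of equal size: the number `|C \ C'|` of fetched pages. -/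
def moveCost {n : ℕ} (C C' : Finset (Fin n)) : ℝ :=
  ((C \ C').card : ℝ)

/-- Cost in the rounds `a, …, b` of using the caches `A a, …, A b` on the requests `r a, …, r b`:
the losses in all these rounds and the movement costs in all but the first of them. -/
def intervalCost {n : ℕ} (r : ℕ → Fin n) (A : ℕ → Finset (Fin n)) (a b : ℕ) : ℝ :=
  ∑ t ∈ Finset.Icc a b, missLoss (r t) (A t) +
    ∑ t ∈ Finset.Icc (a + 1) b, moveCost (A t) (A (t - 1))

/-- The memory before the first round: cells `0, 1, 2` of the natural-number array `0` hold
the number of pages, the cache size and the time horizon; everything else is zero. -/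
def initialState (n k T : ℕ) : State where
  nat a i := if a = 0 then (if i = 0 then n else if i = 1 then k else if i = 2 then T else 0) else 0
  real _ _ := 0
  drawn := 0

/-- At the beginning of a round the index of the requested page (one of `0, …, n - 1`) is put into
cell `3` of the natural-number array `0`. -/
def State.withRequest {n : ℕ} (s : State) (i : Fin n) : State :=
  s.setNat 0 3 (i : ℕ)

/-- The cache that is selected at the end of a round: the page with index `i` is in it if
and only if cell `i` of the natural-number array `1` is nonzero. -/
def State.cache (s : State) (n : ℕ) : Finset (Fin n) :=
  Finset.univ.filter fun i => s.nat 1 (i : ℕ) ≠ 0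

/-- With the random source `ω`, the program `P` run on `n` pages, cache size `k`, time horizon `T`
and the requests `r 1, …, r T` selects the caches `A 1, …, A T`, each of size `k`, spending at
most `B` steps in each round.  The request `r t` is revealed at the beginning of round `t`, the
cache `A t` is read off at the end of round `t`, and the memory is kept between rounds. -/
def Selects (P : Program) (n k T : ℕ) (r : ℕ → Fin n) (ω : Coins) (B : ℝ)
    (A : ℕ → Finset (Fin n)) : Prop :=
  ∃ S : ℕ → State, S 0 = initialState n k T ∧
    ∀ t ∈ Finset.Icc 1 T,
      (∃ τ : ℕ, (τ : ℝ) ≤ B ∧ Exec ω P ((S (t - 1)).withRequest (r t)) τ (S t)) ∧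
      A t = (S t).cache n ∧ (A t).card = k

end Paging

/-! Every cache in play consists of the `k` pages of highest score under one ranking perturbed by
uniform noise that is drawn once.  Row `0` is the marking algorithm in this form: marked pages rank
above those marked in the previous phase, and the noise orders the latter, so that a phase with `q`
new pages costs at most `q H_k` in expectation, whereas an offline algorithm pays at least `q` in
this phase and the previous one together.  Row `m ≥ 1` follows the perturbed leader: it counts the
requests since its last restart, restarts after every `l 4 ^ (l - m)` rounds, and uses noise of size
`2 ^ (l - m)`, where `l` is about `log (n T)`.  The noise makes a change of the cache unlikely, so
that against a fixed cache the row loses `O(k l 2 ^ (l - m))` in a block.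

The rows are combined one after another: row `m + 1` is preferred to the combination of the rows
`0, …, m` with a probability that is learnt from the costs of the two.  Whether it is preferred is
decided by comparing that probability with a threshold drawn once, hence the expected movement due
to a change of the choice is at most `k` times the change of the probability, and a small charge on
row `m + 1` pays for it.  The probabilities start at a tiny value and the learning rate of row `m`
is of order `2 ^ (m - l) / k`; therefore the whole combination loses only `O(k)` against row `0`
over all rounds, and only `O(k l 2 ^ (l - m))` against row `m` on each of its blocks.  An interval
is covered by blocks whose length is a constant fraction of its own, up to an end part that is
treated in the same way with smaller blocks. -/

namespace Paging

open Finset MeasureTheory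

/-! ### Ranking by score -/

section Ranking

variable {ι α : Type*}

/-- The key by which the ranking under the score `f` sorts: higher scores come first, and ties are
broken by the index. -/
def rankKey (f : ι → α) (i : ι) : αᵒᵈ ×ₗ ι := toLex (OrderDual.toDual (f i), i)

theorem rankKey_injective (f : ι → α) : Function.Injective (rankKey f) := fun _ _ h =>
  congrArg (fun p => (ofLex p).2) h

variable [LinearOrder ι] [LinearOrder α]

theorem rankKey_lt_rankKey {f : ι → α} {i j : ι} :
    rankKey f j < rankKey f i ↔ f i < f j ∨ ¬ f j < f i ∧ j < i := by
  simp only [rankKey, Prod.Lex.toLex_lt_toLex, OrderDual.toDual_lt_toDual,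
    OrderDual.toDual_inj, not_lt]
  constructor
  · rintro (h | ⟨h, hji⟩)
    exacts [Or.inl h, Or.inr ⟨h.ge, hji⟩]
  · rintro (h | ⟨h, hji⟩)
    · exact Or.inl h
    · exact h.lt_or_eq.imp id fun e => ⟨e.symm, hji⟩

variable [Fintype ι]

/-- The position of `i` in the ranking by the score `f`, counted from `0`. -/
def rank (f : ι → α) (i : ι) : ℕ := #{j | rankKey f j < rankKey f i}

/-- The `k` indices of highest score. -/
def top (k : ℕ) (f : ι → α) : Finset ι := {i | rank f i < k}

variable {k : ℕ} {f g : ι → α} {i j : ι}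

theorem mem_top : i ∈ top k f ↔ rank f i < k := mem_filter_univ i

theorem rank_lt_rank (h : rankKey f i < rankKey f j) : rank f i < rank f j :=
  card_lt_card <| (ssubset_iff_of_subset fun a ha => by
    simpa using ((mem_filter_univ a).1 ha).trans h).2 ⟨i, by simpa using h, by simp⟩

theorem rank_injective (f : ι → α) : Function.Injective (rank f) := by
  intro i j h
  by_contra hne
  rcases lt_or_gt_of_ne ((rankKey_injective f).ne hne) with hlt | hlt
  exacts [(rank_lt_rank hlt).ne h, (rank_lt_rank hlt).ne' h]

theorem rank_lt_card (f : ι → α) (i : ι) : rank f i < Fintype.card ι :=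
  card_lt_univ_of_notMem (x := i) (by simp)

theorem image_rank (f : ι → α) : univ.image (rank f) = range (Fintype.card ι) :=
  eq_of_subset_of_card_le (by simpa [subset_iff] using rank_lt_card f)
    (by simp [card_image_of_injective _ (rank_injective f)])

theorem card_top (hk : k ≤ Fintype.card ι) (f : ι → α) : #(top k f) = k := by
  rw [← card_image_of_injective _ (rank_injective f)]
  have : (top k f).image (rank f) = range k := by
    ext x
    simp only [mem_image, mem_top, mem_range]
    refine ⟨fun ⟨_, hi, hx⟩ => hx ▸ hi, fun hx => ?_⟩
    obtain ⟨i, -, rfl⟩ := mem_image.1 ((image_rank f).symm ▸ mem_range.2 (hx.trans_le hk))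
    exact ⟨i, hx, rfl⟩
  rw [this, card_range]

theorem mem_top_of_card_le (h : #{j | f i ≤ f j} ≤ k) : i ∈ top k f := by
  refine mem_top.2 (lt_of_lt_of_le (card_lt_card ?_) h)
  refine (ssubset_iff_of_subset fun j hj => ?_).2 ⟨i, by simp, by simp⟩
  simp only [mem_filter_univ, rankKey_lt_rankKey, not_lt] at hj ⊢
  exact hj.elim le_of_lt And.left

theorem mem_top_of_le (h : i ∈ top k g) (hi : g i ≤ f i) (hle : ∀ j ≠ i, f j ≤ g j) :
    i ∈ top k f := by
  refine mem_top.2 ((card_le_card fun j hj => ?_).trans_lt (mem_top.1 h))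
  simp only [mem_filter_univ, rankKey_lt_rankKey, not_lt] at hj ⊢
  have hji : j ≠ i := fun e => by simp [e] at hj
  exact hj.imp (fun h => (hi.trans_lt h).trans_le (hle j hji))
    (And.imp_left fun h => hi.trans (h.trans (hle j hji)))

theorem score_le_of_mem_top (hi : i ∈ top k f) (hj : j ∉ top k f) : f j ≤ f i := by
  rw [mem_top] at hi hj
  have hkey : rankKey f i < rankKey f j := lt_of_not_ge fun h =>
    h.lt_or_eq.elim (fun h => by have := rank_lt_rank h; omega)
      fun h => by rw [rankKey_injective f h] at hj; exact hj hi
  exact (rankKey_lt_rankKey.1 hkey).elim le_of_lt fun h => not_lt.1 h.1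

theorem sum_le_sum_top {α : Type*} [LinearOrder α] [AddCommMonoid α] [IsOrderedAddMonoid α]
    (f : ι → α) {C : Finset ι} (hC : #C = #(top k f)) : ∑ i ∈ C, f i ≤ ∑ i ∈ top k f, f i := by
  have hcard : #(C \ top k f) = #(top k f \ C) := card_sdiff_comm hC
  rw [← sum_inter_add_sum_sdiff C (top k f), ← sum_inter_add_sum_sdiff (top k f) C,
    inter_comm (top k f) C]
  gcongr _ + ?_
  rcases (C \ top k f).eq_empty_or_nonempty with h0 | hne
  · have : top k f \ C = ∅ := by rw [← card_eq_zero, ← hcard, h0, card_empty]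
    rw [h0, this]
  · obtain ⟨a, ha, hmax⟩ := exists_max_image (C \ top k f) f hne
    calc ∑ i ∈ C \ top k f, f i ≤ #(C \ top k f) • f a := sum_le_card_nsmul _ _ _ hmax
      _ = #(top k f \ C) • f a := by rw [hcard]
      _ ≤ ∑ i ∈ top k f \ C, f i := card_nsmul_le_sum _ _ _ fun i hi =>
          score_le_of_mem_top (mem_sdiff.1 hi).1 (mem_sdiff.1 ha).2

theorem rank_comp_perm (hf : Function.Injective f) (σ : Equiv.Perm ι) (i : ι) :
    rank (f ∘ σ) i = rank f (σ i) := by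
  have hkey {h : ι → α} (hh : Function.Injective h) (a b : ι) :
      rankKey h a < rankKey h b ↔ h b < h a := by
    simp only [rankKey, Prod.Lex.toLex_lt_toLex, OrderDual.toDual_lt_toDual, OrderDual.toDual_inj,
      or_iff_left_iff_imp, and_imp]
    intro e hab
    exact absurd (hh e) hab.ne
  simp only [rank, hkey hf, hkey (hf.comp σ.injective)]
  exact card_equiv σ (by simp)

end Ranking

/-! ### Costs of caches -/

section Costs

variable {n : ℕ} {i : Fin n} {C D : Finset (Fin n)}

theorem missLoss_nonneg (i : Fin n) (C : Finset (Fin n)) : 0 ≤ missLoss i C := by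
  unfold missLoss; split_ifs <;> norm_num

theorem moveCost_nonneg (C D : Finset (Fin n)) : 0 ≤ moveCost C D := Nat.cast_nonneg _

/-- The cost of a round in which `i` is requested and the cache is changed from `D` to `C`; unlike
in `intervalCost`, every round is charged for its movement. -/
def roundCost (i : Fin n) (C D : Finset (Fin n)) : ℝ :=
  missLoss i C + moveCost C D

theorem roundCost_nonneg (i : Fin n) (C D : Finset (Fin n)) : 0 ≤ roundCost i C D :=
  add_nonneg (missLoss_nonneg i C) (moveCost_nonneg C D)

theorem roundCost_le (i : Fin n) (C D : Finset (Fin n)) : roundCost i C D ≤ #C + 2 := by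
  have hmove : moveCost C D ≤ #C := Nat.cast_le.2 (card_le_card sdiff_subset)
  unfold roundCost missLoss
  split_ifs <;> linarith

theorem intervalCost_le_sum_roundCost (r : ℕ → Fin n) (A : ℕ → Finset (Fin n)) (a b : ℕ) :
    intervalCost r A a b ≤ ∑ t ∈ Icc a b, roundCost (r t) (A t) (A (t - 1)) := by
  simp only [intervalCost, roundCost, sum_add_distrib]
  gcongr
  · exact fun _ _ _ => moveCost_nonneg _ _
  · exact Nat.le_succ a

theorem moveCost_le_one (h : ∀ j ∈ C, j ≠ i → j ∈ D) :
    moveCost C D ≤ if i ∈ D then 0 else 1 := by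
  have hsub : C \ D ⊆ if i ∈ D then ∅ else {i} := by
    intro j hj
    rw [mem_sdiff] at hj
    obtain rfl : j = i := by_contra fun hne => hj.2 (h j hj.1 hne)
    simp [hj.2]
  have hcard := card_le_card hsub
  rw [apply_ite card, card_empty, card_singleton] at hcard
  unfold moveCost
  exact_mod_cast hcard

theorem mem_of_swap (h : ∀ j ∈ C, j ≠ i → j ∈ D) (hc : #C = #D) (hi : i ∈ D) : i ∈ C := by
  have hsub : C ⊆ D := fun j hj => (eq_or_ne j i).elim (fun e => e ▸ hi) (h j hj)
  rwa [eq_of_subset_of_card_le hsub hc.ge]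

theorem roundCost_swap (h : ∀ j ∈ C, j ≠ i → j ∈ D) (hc : #C = #D) :
    roundCost i C D ≤ if i ∈ D then 0 else 2 := by
  have hmove := moveCost_le_one h
  unfold roundCost missLoss
  by_cases hiD : i ∈ D
  · simp only [hiD, mem_of_swap h hc hiD, if_true] at *
    linarith
  by_cases hiC : i ∈ C
  · simp only [hiD, hiC, if_true, if_false] at *
    linarith
  · have hsub : C ⊆ D := fun j hj => h j hj fun e => hiC (e ▸ hj)
    simp [hiD, hiC, moveCost, sdiff_eq_empty_iff_subset.2 hsub]

theorem intervalCost_eq_zero_of_univ {r : ℕ → Fin n} {A : ℕ → Finset (Fin n)} {a b : ℕ}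
    (h : ∀ t ∈ Icc a b, A t = univ) : intervalCost r A a b = 0 := by
  unfold intervalCost
  rw [sum_eq_zero fun t ht => by simp [h t ht, missLoss], zero_add]
  refine sum_eq_zero fun t ht => ?_
  rw [h (t - 1) (by rw [mem_Icc] at ht ⊢; omega)]
  simp [moveCost]

end Costs

/-! ### Learning a mixture of two strategies -/

section Weights

/-- One update of the probability `x` of following the second of two strategies, after it has gained
`g` over the first: a multiplicative update at rate `γ`, clipped to `[ε, 1]`. -/
noncomputable def weightStep (γ ε x g : ℝ) : ℝ := max ε (min 1 (x / (1 - γ * g)))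

/-- The probability of following the second of two strategies after `t` updates by its gains
`g 1, …, g t` over the first. -/
noncomputable def weight (γ ε : ℝ) (g : ℕ → ℝ) : ℕ → ℝ
  | 0 => ε
  | t + 1 => weightStep γ ε (weight γ ε g t) (g (t + 1))

variable {γ ε : ℝ}

theorem weight_mem_Icc (hε : ε ≤ 1) (g : ℕ → ℝ) (t : ℕ) : weight γ ε g t ∈ Set.Icc ε 1 := by
  cases t with
  | zero => exact ⟨le_rfl, hε⟩
  | succ t => exact ⟨le_max_left _ _, max_le hε (min_le_left _ _)⟩

section Step

variable {x g : ℝ}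

theorem weightStep_cases (hε1 : ε ≤ 1) (hg : γ * g < 1) :
    weightStep γ ε x g = ε ∧ x ≤ ε * (1 - γ * g) ∨ weightStep γ ε x g = 1 ∧ 1 - γ * g ≤ x ∨
      weightStep γ ε x g * (1 - γ * g) = x := by
  have hden : 0 < 1 - γ * g := by linarith
  unfold weightStep
  rcases le_total (x / (1 - γ * g)) ε with h | h
  · exact .inl ⟨max_eq_left ((min_le_right _ _).trans h), (div_le_iff₀ hden).1 h⟩
  rcases le_total 1 (x / (1 - γ * g)) with h' | h'
  · exact .inr <| .inl ⟨by rw [min_eq_left h', max_eq_right hε1], (one_le_div hden).1 h'⟩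
  · exact .inr <| .inr <| by rw [min_eq_right h', max_eq_right h, div_mul_cancel₀ _ hden.ne']

theorem abs_weightStep_sub_le (hγ : 0 < γ) (hε : 0 < ε) (hx : x ∈ Set.Icc ε 1) (hg : γ * g < 1) :
    |weightStep γ ε x g - x| ≤ γ * weightStep γ ε x g * |g| := by
  obtain ⟨hεx, hx1⟩ := hx
  have hγg : -(γ * |g|) ≤ γ * g ∧ γ * g ≤ γ * |g| := by
    constructor <;> nlinarith [neg_abs_le g, le_abs_self g]
  rcases weightStep_cases (hεx.trans hx1) hg with ⟨h, h'⟩ | ⟨h, h'⟩ | h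
  · rw [h, abs_le]
    constructor <;> nlinarith [mul_nonneg hε.le (mul_nonneg hγ.le (abs_nonneg g))]
  · rw [h, abs_le]
    constructor <;> linarith [mul_nonneg hγ.le (abs_nonneg g)]
  · have hy : 0 ≤ weightStep γ ε x g := hε.le.trans (le_max_left _ _)
    have hsub : weightStep γ ε x g - x = γ * weightStep γ ε x g * g := by linarith
    rw [hsub, abs_mul, abs_of_nonneg (by positivity)]

theorem weightStep_sub_le (hγ : 0 < γ) (hε : 0 < ε) (hx : x ∈ Set.Icc ε 1) (hg : γ * g < 1) :
    (weightStep γ ε x g - x) / γ ≤ weightStep γ ε x g * g + ε * |g| := by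
  obtain ⟨hεx, hx1⟩ := hx
  have habs := mul_nonneg hε.le (abs_nonneg g)
  rw [div_le_iff₀ hγ]
  rcases weightStep_cases (hεx.trans hx1) hg with ⟨h, -⟩ | ⟨h, h'⟩ | h
  · rw [h]; nlinarith [neg_abs_le g, mul_pos hγ hε]
  · rw [h]; nlinarith [h', habs]
  · nlinarith

/-- The bound is by the increase of the concave function `fun x => log x - x` over the step. -/
theorem one_sub_weightStep_mul_le (hγ : 0 < γ) (hε : 0 < ε) (hx : x ∈ Set.Icc ε 1)
    (hg : γ * g < 1) :
    (1 - weightStep γ ε x g) * g ≤ ((Real.log (weightStep γ ε x g) - weightStep γ ε x g) -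
      (Real.log x - x)) / γ := by
  obtain ⟨hεx, hx1⟩ := hx
  have hx0 : 0 < x := hε.trans_le hεx
  have hε1 := hεx.trans hx1
  have hy0 : 0 < weightStep γ ε x g := hε.trans_le (le_max_left _ _)
  have hy1 : weightStep γ ε x g ≤ 1 := max_le hε1 (min_le_left _ _)
  have hcases := weightStep_cases (x := x) hε1 hg
  generalize weightStep γ ε x g = y at *
  have hlog := Real.log_le_sub_one_of_pos (div_pos hx0 hy0)
  rw [Real.log_div hx0.ne' hy0.ne'] at hlog
  have hstep : (1 - y) * (γ * g) ≤ (1 - y) * (1 - x / y) := by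
    rcases hcases with ⟨rfl, h⟩ | ⟨rfl, -⟩ | rfl
    · refine mul_le_mul_of_nonneg_left ?_ (sub_nonneg.2 hy1)
      have : x / y ≤ 1 - γ * g := (div_le_iff₀' hy0).2 h
      linarith
    · simp
    · rw [mul_div_cancel_left₀ _ hy0.ne']; simp
  have hxy : (1 - y) * (1 - x / y) = 1 - x / y - y + x := by field_simp; ring
  rw [le_div_iff₀ hγ]
  linarith

end Step

section Sum

variable {g G : ℕ → ℝ} {a b : ℕ}

theorem sum_Ioc_le_sub (hab : a ≤ b) {f F : ℕ → ℝ}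
    (h : ∀ t, a ≤ t → t < b → f (t + 1) ≤ F (t + 1) - F t) : ∑ t ∈ Ioc a b, f t ≤ F b - F a := by
  induction b, hab using Nat.le_induction with
  | base => simp
  | succ b hab ih =>
    rw [sum_Ioc_succ_top hab]
    linarith [ih fun t hat htb => h t hat (by omega), h b hab b.lt_succ_self]

theorem neg_sum_weight_mul_le (hab : a ≤ b) (hγ : 0 < γ) (hε : 0 < ε) (hε1 : ε ≤ 1)
    (hg : ∀ t ∈ Ioc a b, γ * g t < 1) :
    -∑ t ∈ Ioc a b, weight γ ε g t * g t ≤ weight γ ε g a / γ + ε * ∑ t ∈ Ioc a b, |g t| := by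
  have hsum := sum_Ioc_le_sub hab (f := fun t => -(weight γ ε g t * g t) - ε * |g t|)
    (F := fun t => -weight γ ε g t / γ) fun t hat htb => by
      have hstep : (weight γ ε g (t + 1) - weight γ ε g t) / γ ≤
          weight γ ε g (t + 1) * g (t + 1) + ε * |g (t + 1)| :=
        weightStep_sub_le hγ hε (weight_mem_Icc hε1 g t) (hg (t + 1) (mem_Ioc.2 (by omega)))
      rw [sub_div] at hstep
      rw [neg_div, neg_div]
      linarith
  have hb : 0 ≤ weight γ ε g b / γ := div_nonneg (hε.le.trans (weight_mem_Icc hε1 g b).1) hγ.le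
  rw [sum_sub_distrib, sum_neg_distrib, ← mul_sum, neg_div, neg_div] at hsum
  linarith

theorem log_sub_self_mono {x y : ℝ} (hx : 0 < x) (hxy : x ≤ y) (hy : y ≤ 1) :
    Real.log x - x ≤ Real.log y - y := by
  have hy0 : 0 < y := hx.trans_le hxy
  have hlog := Real.log_le_sub_one_of_pos (div_pos hx hy0)
  rw [Real.log_div hx.ne' hy0.ne'] at hlog
  have : x / y - 1 ≤ x - y := by
    rw [div_sub_one hy0.ne', div_le_iff₀ hy0]; nlinarith
  linarith

theorem sum_one_sub_weight_mul_le (hab : a ≤ b) (hγ : 0 < γ) (hε : 0 < ε) (hε1 : ε ≤ 1)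
    (hg : ∀ t ∈ Ioc a b, γ * g t < 1) :
    ∑ t ∈ Ioc a b, (1 - weight γ ε g t) * g t ≤ Real.log (1 / ε) / γ := by
  have hsum := sum_Ioc_le_sub hab (f := fun t => (1 - weight γ ε g t) * g t)
    (F := fun t => (Real.log (weight γ ε g t) - weight γ ε g t) / γ) fun t hat htb => by
      have := one_sub_weightStep_mul_le hγ hε (weight_mem_Icc (γ := γ) hε1 g t)
        (hg (t + 1) (mem_Ioc.2 (by omega)))
      rw [sub_div] at this
      exact this
  rw [← sub_div] at hsum
  refine hsum.trans (div_le_div_of_nonneg_right ?_ hγ.le)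
  obtain ⟨haε, ha1⟩ := weight_mem_Icc (γ := γ) hε1 g a
  obtain ⟨hbε, hb1⟩ := weight_mem_Icc (γ := γ) hε1 g b
  have hlow := log_sub_self_mono hε haε ha1
  have hupp := log_sub_self_mono (hε.trans_le hbε) hb1 le_rfl
  rw [Real.log_one] at hupp
  rw [one_div, Real.log_inv]
  linarith

end Sum

end Weights

/-! ### The algorithm as a random process -/

section Model

variable {n : ℕ}

/-- Scores from integer counts and from noise of size `h`. -/
def score (c : Fin n → ℕ) (h : ℕ) (u : Fin n → ℝ) (i : Fin n) : ℝ :=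
  c i + h * u i

/-- One round of the marking algorithm, in terms of page classes: `4` for the pages marked in the
current phase, `2` for the other pages that were marked in the previous phase, `0` for the rest.
If the request is unmarked and `k` pages are marked already, a new phase starts. -/
def markStep (k : ℕ) (i : Fin n) (c : Fin n → ℕ) : Fin n → ℕ :=
  if c i = 4 then c
  else if #{j | c j = 4} < k then Function.update c i 4
  else Function.update (fun j => c j - 2) i 4

/-- The page classes of the marking algorithm after `t` rounds. -/
def markClass (k : ℕ) (r : ℕ → Fin n) : ℕ → Fin n → ℕ
  | 0 => fun _ => 0
  | t + 1 => markStep k (r (t + 1)) (markClass k r t)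

/-- Numbers of requests since the start of the current block, for blocks of length `len`.  The
request in the first round of a block is not counted. -/
def counts (len : ℕ) (r : ℕ → Fin n) : ℕ → Fin n → ℕ
  | 0 => fun _ => 0
  | t + 1 => if t % len = 0 then fun _ => 0
      else Function.update (counts len r t) (r (t + 1)) (counts len r t (r (t + 1)) + 1)

/-- Length of the blocks after which row `m` is restarted. -/
def blockLength (l m : ℕ) : ℕ := l * 4 ^ (l - m)

/-- Size of the noise of row `m`. -/
def rowScale (l m : ℕ) : ℕ := if m = 0 then 1 else 2 ^ (l - m)

/-- The counts whose perturbed leaders form row `m`: page classes in row `0`, numbers of requests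
in the current block in the other rows. -/
def rowCounts (k l : ℕ) (r : ℕ → Fin n) (m : ℕ) : ℕ → Fin n → ℕ :=
  if m = 0 then markClass k r else counts (blockLength l m) r

/-- The cache of row `m` after round `t`. -/
noncomputable def rowCache (k l : ℕ) (r : ℕ → Fin n) (u : Fin n → ℝ) (m t : ℕ) : Finset (Fin n) :=
  top k (score (rowCounts k l r m t) (rowScale l m) u)

/-- The cost with which row `m` is charged in round `t`.  It depends only on the cache before the
round, and a restart is charged with the price of a whole new cache. -/
noncomputable def rowCost (k l : ℕ) (r : ℕ → Fin n) (u : Fin n → ℝ) (m t : ℕ) : ℝ :=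
  if m ≠ 0 ∧ (t - 1) % blockLength l m = 0 then k + 2
  else if r t ∈ rowCache k l r u m (t - 1) then 0 else if m = 0 then 1 else 2

/-- A bound for the costs of the rows `0, …, m` in round `t`. -/
def costBound (k l m t : ℕ) : ℝ :=
  if m ≠ 0 ∧ (t - 1) % blockLength l m = 0 then 5 * k else 3

/-- The learning rate for the weight of row `m`. -/
noncomputable def rate (k l m : ℕ) : ℝ := 1 / (10 * k * rowScale l m)

/-- The price, relative to `costBound`, that pays for the changes of the weight of row `m`. -/
noncomputable def moveRate (l m : ℕ) : ℝ := 1 / (10 * rowScale l m)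

/-- The least weight of a row. -/
noncomputable def minWeight (l : ℕ) : ℝ := 1 / (2 ^ l * 2 ^ l)

/-- The cost of row `m` together with the charge for changes of its weight. -/
noncomputable def chargedCost (k l : ℕ) (r : ℕ → Fin n) (u : Fin n → ℝ) (m t : ℕ) : ℝ :=
  rowCost k l r u m t + moveRate l m * costBound k l m t

/-- The expected cost of the combination of the rows `0, …, m`, which prefers row `m` to the
combination of the lower rows with a probability that is learnt online. -/
noncomputable def levelCost (k l : ℕ) (r : ℕ → Fin n) (u : Fin n → ℝ) : ℕ → ℕ → ℝ
  | 0, t => rowCost k l r u 0 t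
  | m + 1, t =>
    let w := weight (rate k l (m + 1)) (minWeight l)
      (fun s => levelCost k l r u m s - chargedCost k l r u (m + 1) s) t
    (1 - w) * levelCost k l r u m t + w * chargedCost k l r u (m + 1) t

/-- The advantage of row `m ≥ 1` over the combination of the rows `0, …, m - 1`. -/
noncomputable def rowGain (k l : ℕ) (r : ℕ → Fin n) (u : Fin n → ℝ) (m t : ℕ) : ℝ :=
  levelCost k l r u (m - 1) t - chargedCost k l r u m t

/-- The probability with which row `m ≥ 1` is preferred to the combination of the rows
`0, …, m - 1`. -/
noncomputable def rowWeight (k l : ℕ) (r : ℕ → Fin n) (u : Fin n → ℝ) (m : ℕ) : ℕ → ℝ :=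
  weight (rate k l m) (minWeight l) (rowGain k l r u m)

/-- The noise given by the first `n` samples. -/
def noise (n : ℕ) (ω : Coins) (i : Fin n) : ℝ := ω i

open Classical in
/-- The row that is selected among the rows `0, …, m` in round `t`. -/
noncomputable def selected (k l : ℕ) (r : ℕ → Fin n) (ω : Coins) : ℕ → ℕ → ℕ
  | 0, _ => 0
  | m + 1, t => if (ω (n + (m + 1)) : ℝ) < rowWeight k l r (noise n ω) (m + 1) t then m + 1
      else selected k l r ω m t

/-- The cache of the combination of the rows `0, …, m`. -/
noncomputable def levelCache (k l : ℕ) (r : ℕ → Fin n) (ω : Coins) (m t : ℕ) : Finset (Fin n) :=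
  rowCache k l r (noise n ω) (selected k l r ω m t) t

variable {k l : ℕ} {r : ℕ → Fin n} {u : Fin n → ℝ}

/-! ### The parameters of the rows -/

theorem rowScale_pos (l m : ℕ) : 0 < rowScale l m := by
  unfold rowScale; split_ifs <;> positivity

theorem one_le_rowScale (l m : ℕ) : (1 : ℝ) ≤ rowScale l m :=
  mod_cast rowScale_pos l m

theorem minWeight_pos (l : ℕ) : 0 < minWeight l := by unfold minWeight; positivity

theorem minWeight_le_one (l : ℕ) : minWeight l ≤ 1 := by
  have : (1 : ℝ) ≤ 2 ^ l := one_le_pow₀ one_le_two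
  rw [minWeight, div_le_one (by positivity)]
  nlinarith

theorem rate_pos (hk : 1 ≤ k) (l m : ℕ) : 0 < rate k l m := by
  have := rowScale_pos l m
  unfold rate; positivity

theorem moveRate_eq (hk : 1 ≤ k) (l m : ℕ) : moveRate l m = k * rate k l m := by
  have := rowScale_pos l m
  unfold rate moveRate; field_simp

theorem moveRate_nonneg (l m : ℕ) : 0 ≤ moveRate l m := by unfold moveRate; positivity

theorem moveRate_le (l m : ℕ) : moveRate l m ≤ 1 / 10 := by
  unfold moveRate
  gcongr
  linarith [one_le_rowScale l m]

theorem costBound_nonneg (k l m t : ℕ) : 0 ≤ costBound k l m t := by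
  unfold costBound; split_ifs <;> positivity

theorem costBound_le (hk : 1 ≤ k) (l m t : ℕ) : costBound k l m t ≤ 5 * k := by
  have : (1 : ℝ) ≤ k := mod_cast hk
  unfold costBound; split_ifs <;> linarith

theorem three_le_costBound (hk : 1 ≤ k) (l m t : ℕ) : 3 ≤ costBound k l m t := by
  have : (1 : ℝ) ≤ k := mod_cast hk
  unfold costBound; split_ifs <;> linarith

theorem rate_mul_costBound_le (hk : 1 ≤ k) (l m t : ℕ) :
    rate k l m * costBound k l m t ≤ 1 / 2 := by
  have h := mul_le_mul_of_nonneg_left (costBound_le hk l m t) (rate_pos hk l m).le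
  linarith [moveRate_eq hk l m ▸ moveRate_le l m]

theorem costBound_mono (hk : 1 ≤ k) (l m t : ℕ) : costBound k l m t ≤ costBound k l (m + 1) t := by
  by_cases h : m ≠ 0 ∧ (t - 1) % blockLength l m = 0
  · have h' : m + 1 ≠ 0 ∧ (t - 1) % blockLength l (m + 1) = 0 := by
      refine ⟨by lia, Nat.mod_eq_zero_of_dvd (dvd_trans ?_ (Nat.dvd_of_mod_eq_zero h.2))⟩
      exact mul_dvd_mul_left _ (pow_dvd_pow _ (by lia))
    rw [costBound, costBound, if_pos h, if_pos h']
  · rw [costBound, if_neg h]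
    exact three_le_costBound hk ..

/-! ### Costs and weights -/

variable (k l r u) in
theorem rowCost_nonneg (m t : ℕ) : 0 ≤ rowCost k l r u m t := by
  unfold rowCost; split_ifs <;> positivity

theorem rowCost_zero_le (t : ℕ) : rowCost k l r u 0 t ≤ 1 := by
  unfold rowCost; split_ifs <;> simp_all

variable (k l r u) in
theorem chargedCost_nonneg (m t : ℕ) : 0 ≤ chargedCost k l r u m t :=
  add_nonneg (rowCost_nonneg ..) (mul_nonneg (moveRate_nonneg ..) (costBound_nonneg ..))

variable (l r u) in
theorem chargedCost_le (hk : 1 ≤ k) (m t : ℕ) : chargedCost k l r u m t ≤ costBound k l m t := by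
  have hk' : (1 : ℝ) ≤ k := mod_cast hk
  have hcost : rowCost k l r u m t ≤ 9 / 10 * costBound k l m t := by
    unfold rowCost costBound; split_ifs <;> linarith
  have hcharge := mul_le_mul_of_nonneg_right (moveRate_le l m) (costBound_nonneg k l m t)
  unfold chargedCost
  linarith

theorem levelCost_succ (m t : ℕ) :
    levelCost k l r u (m + 1) t = (1 - rowWeight k l r u (m + 1) t) * levelCost k l r u m t +
      rowWeight k l r u (m + 1) t * chargedCost k l r u (m + 1) t := rfl

variable (k l r u) in
theorem rowWeight_mem_Icc (m t : ℕ) : rowWeight k l r u m t ∈ Set.Icc (minWeight l) 1 :=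
  weight_mem_Icc (minWeight_le_one l) _ t

variable (k l r u) in
theorem rowWeight_nonneg (m t : ℕ) : 0 ≤ rowWeight k l r u m t :=
  (minWeight_pos l).le.trans (rowWeight_mem_Icc k l r u m t).1

variable (l r u) in
theorem levelCost_mem_Icc (hk : 1 ≤ k) (m t : ℕ) :
    levelCost k l r u m t ∈ Set.Icc 0 (costBound k l m t) := by
  induction m with
  | zero =>
    refine ⟨rowCost_nonneg .., (rowCost_zero_le t).trans ?_⟩
    linarith [three_le_costBound hk l 0 t]
  | succ m ih =>
    have hw := rowWeight_mem_Icc k l r u (m + 1) t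
    exact convex_Icc _ _ (Set.Icc_subset_Icc_right (costBound_mono hk l m t) ih)
      ⟨chargedCost_nonneg .., chargedCost_le l r u hk (m + 1) t⟩ (sub_nonneg.2 hw.2)
      (rowWeight_nonneg ..) (sub_add_cancel ..)

variable (l r u) in
theorem abs_rowGain_le (hk : 1 ≤ k) (m t : ℕ) :
    |rowGain k l r u (m + 1) t| ≤ costBound k l (m + 1) t := by
  obtain ⟨h0, h1⟩ := levelCost_mem_Icc l r u hk m t
  have hcharged := chargedCost_le l r u hk (m + 1) t
  have hcharged0 := chargedCost_nonneg k l r u (m + 1) t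
  have hmono := costBound_mono hk l m t
  rw [rowGain, Nat.add_sub_cancel, abs_le]
  constructor <;> linarith

theorem rate_mul_rowGain_lt_one (hk : 1 ≤ k) (m t : ℕ) :
    rate k l (m + 1) * rowGain k l r u (m + 1) t < 1 := by
  have h := mul_le_mul_of_nonneg_left ((le_abs_self _).trans (abs_rowGain_le l r u hk m t))
    (rate_pos hk l (m + 1)).le
  linarith [rate_mul_costBound_le hk l (m + 1) t]

theorem mul_abs_rowWeight_sub_le (hk : 1 ≤ k) (m t : ℕ) :
    k * |rowWeight k l r u (m + 1) (t + 1) - rowWeight k l r u (m + 1) t| ≤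
      rowWeight k l r u (m + 1) (t + 1) *
        (moveRate l (m + 1) * costBound k l (m + 1) (t + 1)) := by
  have hrate := rate_pos hk l (m + 1)
  have hw := rowWeight_nonneg k l r u (m + 1) (t + 1)
  rw [moveRate_eq hk]
  calc k * |rowWeight k l r u (m + 1) (t + 1) - rowWeight k l r u (m + 1) t|
      ≤ k * (rate k l (m + 1) * rowWeight k l r u (m + 1) (t + 1) *
          |rowGain k l r u (m + 1) (t + 1)|) := by
        gcongr
        exact abs_weightStep_sub_le hrate (minWeight_pos l) (rowWeight_mem_Icc ..)
          (rate_mul_rowGain_lt_one hk m (t + 1))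
    _ ≤ k * (rate k l (m + 1) * rowWeight k l r u (m + 1) (t + 1) *
          costBound k l (m + 1) (t + 1)) := by
        gcongr
        exact abs_rowGain_le l r u hk m (t + 1)
    _ = _ := by ring

theorem card_rowCache (hkn : k ≤ n) (m t : ℕ) : #(rowCache k l r u m t) = k :=
  card_top (by simpa using hkn) _

/-! ### One round of a row -/

theorem markStep_self (k : ℕ) (i : Fin n) (c : Fin n → ℕ) : markStep k i c i = 4 := by
  unfold markStep
  split_ifs with h
  · exact h
  · simp
  · simp

theorem markStep_cases (k : ℕ) (i : Fin n) {c : Fin n → ℕ} (hc : ∀ j, c j = 0 ∨ c j = 2 ∨ c j = 4)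
    (j : Fin n) : markStep k i c j = 0 ∨ markStep k i c j = 2 ∨ markStep k i c j = 4 := by
  rcases eq_or_ne j i with rfl | hj
  · exact .inr (.inr (markStep_self ..))
  · have := hc j
    unfold markStep
    split_ifs
    · exact this
    all_goals rw [Function.update_of_ne hj]; lia

theorem markClass_cases (k : ℕ) (r : ℕ → Fin n) (t : ℕ) (j : Fin n) :
    markClass k r t j = 0 ∨ markClass k r t j = 2 ∨ markClass k r t j = 4 := by
  induction t generalizing j with
  | zero => simp [markClass]
  | succ t ih => exact markStep_cases k _ ih j

theorem markClass_le_four (k : ℕ) (r : ℕ → Fin n) (t : ℕ) (j : Fin n) : markClass k r t j ≤ 4 := by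
  have := markClass_cases k r t j
  lia

theorem card_markStep_le (hk : 1 ≤ k) (i : Fin n) {c : Fin n → ℕ} (hc : ∀ j, c j ≤ 4)
    (hcard : #{j | c j = 4} ≤ k) : #{j | markStep k i c j = 4} ≤ k := by
  unfold markStep
  split_ifs with _ h
  · exact hcard
  · calc #{j | Function.update c i 4 j = 4} ≤ #(insert i ({j | c j = 4} : Finset _)) := by
          refine card_le_card fun j hj => ?_
          rcases eq_or_ne j i with rfl | hji <;> simp_all
      _ ≤ k := (card_insert_le ..).trans h
  · calc #{j | Function.update (fun j => c j - 2) i 4 j = 4} ≤ #{i} := by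
          refine card_le_card fun j hj => ?_
          by_contra hji
          rw [mem_singleton] at hji
          have := hc j
          rw [mem_filter_univ, Function.update_of_ne hji] at hj
          lia
      _ ≤ k := by simpa using hk

theorem card_marked_le (hk : 1 ≤ k) (r : ℕ → Fin n) (t : ℕ) :
    #{j | markClass k r t j = 4} ≤ k := by
  induction t with
  | zero => simp [markClass]
  | succ t ih =>
    exact card_markStep_le hk _ (markClass_le_four k r t) ih

theorem score_lt_score_of_add_two_le {c : Fin n → ℕ} (hu : ∀ i, u i ∈ Set.Icc (0 : ℝ) 1)
    {i j : Fin n} (h : c i + 2 ≤ c j) : score c 1 u i < score c 1 u j := by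
  have : (c i : ℝ) + 2 ≤ c j := mod_cast h
  simp only [score, Nat.cast_one]
  linarith [(hu i).2, (hu j).1]

theorem mem_top_of_card_class_le {c : Fin n → ℕ} (hu : ∀ i, u i ∈ Set.Icc (0 : ℝ) 1)
    (hc : ∀ j, c j = 0 ∨ c j = 2 ∨ c j = 4) {i : Fin n} (h : #{j | c i ≤ c j} ≤ k) :
    i ∈ top k (score c 1 u) := by
  refine mem_top_of_card_le ((card_le_card fun j hj => ?_).trans h)
  simp only [mem_filter_univ] at hj ⊢
  by_contra hlt
  have := hc i
  have := hc j
  exact hj.not_gt (score_lt_score_of_add_two_le hu (by lia))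

theorem mem_rowCache_zero_of_marked (hk : 1 ≤ k) (hu : ∀ i, u i ∈ Set.Icc (0 : ℝ) 1) {t : ℕ}
    {i : Fin n} (h : markClass k r t i = 4) : i ∈ rowCache k l r u 0 t := by
  refine mem_top_of_card_class_le hu (markClass_cases k r t)
    ((card_le_card fun j hj => ?_).trans (card_marked_le hk r t))
  have := markClass_cases k r t j
  rw [mem_filter_univ] at hj ⊢
  change markClass k r t i ≤ markClass k r t j at hj
  lia

theorem marked_of_mem_rowCache_zero_succ (hu : ∀ i, u i ∈ Set.Icc (0 : ℝ) 1) {t : ℕ} {i : Fin n}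
    (hr : markClass k r t (r (t + 1)) ≠ 4) (hcard : k ≤ #{j | markClass k r t j = 4})
    (hi : i ∈ rowCache k l r u 0 (t + 1)) (hir : i ≠ r (t + 1)) : markClass k r t i = 4 := by
  by_contra hne
  refine (mem_top.1 hi).not_ge (hcard.trans (card_le_card fun j hj => ?_))
  simp only [mem_filter_univ] at hj ⊢
  have hjr : j ≠ r (t + 1) := fun e => hr (e ▸ hj)
  have := markClass_cases k r t i
  refine rankKey_lt_rankKey.2 (.inl (score_lt_score_of_add_two_le hu ?_))
  simp only [rowCounts, if_true, markClass, markStep, if_neg hr, if_neg hcard.not_gt,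
    Function.update_of_ne hjr, Function.update_of_ne hir, hj]
  lia

theorem mem_rowCache_zero_succ (hk : 1 ≤ k) (hu : ∀ i, u i ∈ Set.Icc (0 : ℝ) 1) (t : ℕ) :
    ∀ i ∈ rowCache k l r u 0 (t + 1), i ≠ r (t + 1) → i ∈ rowCache k l r u 0 t := by
  intro i hi hir
  by_cases hr : markClass k r t (r (t + 1)) = 4
  · simpa [rowCache, rowCounts, markClass, markStep, hr] using hi
  by_cases hcard : #{j | markClass k r t j = 4} < k
  · have hclass : markClass k r (t + 1) = Function.update (markClass k r t) (r (t + 1)) 4 := by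
      rw [markClass, markStep, if_neg hr, if_pos hcard]
    refine mem_top_of_le hi ?_ fun j _ => ?_
    all_goals simp only [score, rowCounts, if_true, hclass]
    · rw [Function.update_of_ne hir]
    · rcases eq_or_ne j (r (t + 1)) with rfl | hj
      · have := markClass_cases k r t (r (t + 1))
        rw [Function.update_self]
        gcongr
        lia
      · rw [Function.update_of_ne hj]
  · exact mem_rowCache_zero_of_marked hk hu
      (marked_of_mem_rowCache_zero_succ hu hr (not_lt.1 hcard) hi hir)

theorem counts_succ_of_mod {len t : ℕ} (h : ¬ t % len = 0) :
    counts len r (t + 1) = Function.update (counts len r t) (r (t + 1))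
      (counts len r t (r (t + 1)) + 1) :=
  if_neg h

theorem score_counts_succ_self {len t h : ℕ} (ht : ¬ t % len = 0) :
    score (counts len r (t + 1)) h u (r (t + 1)) = score (counts len r t) h u (r (t + 1)) + 1 := by
  simp only [counts_succ_of_mod ht, score, Function.update_self]
  push_cast
  ring

theorem score_counts_succ_of_ne {len t h : ℕ} (ht : ¬ t % len = 0) {j : Fin n}
    (hj : j ≠ r (t + 1)) :
    score (counts len r (t + 1)) h u j = score (counts len r t) h u j := by
  simp only [counts_succ_of_mod ht, score, Function.update_of_ne hj]

theorem score_counts_le_succ {len t h : ℕ} (ht : ¬ t % len = 0) (j : Fin n) :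
    score (counts len r t) h u j ≤ score (counts len r (t + 1)) h u j := by
  rcases eq_or_ne j (r (t + 1)) with rfl | hj
  · linarith [score_counts_succ_self (r := r) (u := u) (h := h) ht]
  · exact (score_counts_succ_of_ne ht hj).ge

theorem mem_rowCache_succ {m t : ℕ} (hm : m ≠ 0) (ht : ¬ t % blockLength l m = 0) :
    ∀ i ∈ rowCache k l r u m (t + 1), i ≠ r (t + 1) → i ∈ rowCache k l r u m t := by
  intro i hi hir
  simp only [rowCache, rowCounts, hm, if_false] at hi ⊢
  exact mem_top_of_le hi (score_counts_succ_of_ne ht hir).le fun j _ => score_counts_le_succ ht j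

theorem roundCost_rowCache_le (hk : 1 ≤ k) (hkn : k ≤ n) (hu : ∀ i, u i ∈ Set.Icc (0 : ℝ) 1)
    (m t : ℕ) :
    roundCost (r (t + 1)) (rowCache k l r u m (t + 1)) (rowCache k l r u m t) ≤
      rowCost k l r u m (t + 1) := by
  rcases eq_or_ne m 0 with rfl | hm
  · have hmem : r (t + 1) ∈ rowCache k l r u 0 (t + 1) :=
      mem_rowCache_zero_of_marked hk hu (markStep_self ..)
    simpa [rowCost, roundCost, missLoss, hmem] using
      moveCost_le_one (mem_rowCache_zero_succ (l := l) (r := r) hk hu t)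
  by_cases ht : t % blockLength l m = 0
  · simpa [rowCost, hm, ht, card_rowCache hkn] using
      roundCost_le (r (t + 1)) (rowCache k l r u m (t + 1)) (rowCache k l r u m t)
  · simpa [rowCost, hm, ht] using roundCost_swap (mem_rowCache_succ (k := k) (u := u) hm ht)
      (by rw [card_rowCache hkn, card_rowCache hkn])

end Model

/-! ### Integration over the samples -/

section InfinitePi

variable {ι : Type*} {X : ι → Type*}

theorem preimage_update_pi [DecidableEq ι] (i : ι) (s : Finset ι) (A : ∀ j, Set (X j)) :
    (fun p : (∀ j, X j) × X i => Function.update p.1 i p.2) ⁻¹' Set.pi s A =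
      Set.pi (s.erase i : Finset ι) A ×ˢ (if i ∈ s then A i else Set.univ) := by
  ext ⟨ω, v⟩
  simp only [Set.mem_preimage, Set.mem_pi, mem_coe, Set.mem_prod, mem_erase]
  constructor
  · intro h
    refine ⟨fun j hj => by simpa [Function.update_of_ne hj.1] using h j hj.2, ?_⟩
    split_ifs with hi
    · simpa using h i hi
    · trivial
  · rintro ⟨hω, hv⟩ j hj
    rcases eq_or_ne j i with rfl | hji
    · simpa [hj] using hv
    · simpa [Function.update_of_ne hji] using hω j ⟨hji, hj⟩

variable [∀ i, MeasurableSpace (X i)] (μ : ∀ i, Measure (X i)) [∀ i, IsProbabilityMeasure (μ i)]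

theorem measurePreserving_update [DecidableEq ι] (i : ι) :
    MeasurePreserving (fun p : (∀ j, X j) × X i => Function.update p.1 i p.2)
      ((Measure.infinitePi μ).prod (μ i)) (Measure.infinitePi μ) := by
  refine ⟨measurable_update', Measure.eq_infinitePi _ fun s A hA => ?_⟩
  rw [Measure.map_apply measurable_update' (.pi s.countable_toSet fun j _ => hA j),
    preimage_update_pi, Measure.prod_prod, Measure.infinitePi_pi _ fun j _ => hA j]
  split_ifs with hi
  · exact prod_erase_mul s _ hi
  · rw [erase_eq_of_notMem hi, measure_univ, mul_one]

theorem integral_update [DecidableEq ι] {E : Type*} [NormedAddCommGroup E] [NormedSpace ℝ E]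
    {f : (∀ j, X j) → E} (hf : Integrable f (Measure.infinitePi μ)) (i : ι) :
    ∫ ω, f ω ∂Measure.infinitePi μ =
      ∫ ω, ∫ v, f (Function.update ω i v) ∂μ i ∂Measure.infinitePi μ := by
  have h := measurePreserving_update μ i
  conv_lhs => rw [← h.map_eq]
  rw [integral_map h.measurable.aemeasurable (by rw [h.map_eq]; exact hf.aestronglyMeasurable)]
  exact integral_prod _ (h.integrable_comp_of_integrable hf)

theorem integral_le_of_integral_update_le [DecidableEq ι] {f g : (∀ j, X j) → ℝ}
    (hf : Integrable f (Measure.infinitePi μ)) (hg : Integrable g (Measure.infinitePi μ)) (i : ι)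
    (h : ∀ ω, ∫ v, f (Function.update ω i v) ∂μ i ≤ g ω) :
    ∫ ω, f ω ∂Measure.infinitePi μ ≤ ∫ ω, g ω ∂Measure.infinitePi μ := by
  rw [integral_update μ hf i]
  exact integral_mono ((measurePreserving_update μ i).integrable_comp_of_integrable
    hf).integral_prod_left hg h

theorem measureReal_le_of_update [DecidableEq ι] {E : Set (∀ j, X j)} (hE : MeasurableSet E)
    (i : ι) {c : ℝ} (h : ∀ ω, (μ i).real {v | Function.update ω i v ∈ E} ≤ c) :
    (Measure.infinitePi μ).real E ≤ c := by
  have hle := integral_le_of_integral_update_le μ (f := E.indicator 1)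
    ((integrable_const 1).indicator hE) (integrable_const c) i fun ω =>
      (integral_indicator_one (measurable_update ω hE)).trans_le (h ω)
  rwa [integral_indicator_one hE, integral_const, probReal_univ, one_smul] at hle

end InfinitePi

instance : IsProbabilityMeasure coinMeasure := by
  unfold coinMeasure; infer_instance

theorem integral_comp_perm {f : Coins → ℝ} (hf : Integrable f coinMeasure) (σ : Equiv.Perm ℕ) :
    ∫ ω, f (fun i => ω (σ i)) ∂coinMeasure = ∫ ω, f ω ∂coinMeasure := by
  have h : coinMeasure.map (fun ω i => ω (σ i)) = coinMeasure :=
    Measure.map_infinitePi_infinitePi_of_inj σ.injective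
  conv_rhs => rw [← h]
  have hmeas : Measurable fun (ω : Coins) i => ω (σ i) := by fun_prop
  rw [integral_map hmeas.aemeasurable (h.symm ▸ hf.aestronglyMeasurable)]

theorem ae_ne_of_ne {i j : ℕ} (hij : i ≠ j) : ∀ᵐ ω ∂coinMeasure, ω i ≠ ω j := by
  have h : coinMeasure.map (fun ω => (ω i, ω j)) = volume.prod volume :=
    Measure.infinitePi_map_eval_prod hij
  have hdiag : ∀ᵐ p : unitInterval × unitInterval ∂volume.prod volume, p.1 ≠ p.2 := by
    refine (Measure.ae_prod_iff_ae_ae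
      (measurableSet_eq_fun measurable_fst measurable_snd).compl).2 ?_
    exact ae_of_all _ fun x => by simp [ae_iff]
  rw [← h] at hdiag
  exact ae_of_ae_map (f := fun ω : Coins => (ω i, ω j)) (by fun_prop) hdiag

theorem integral_indicator_lt {x : ℝ} (hx : x ∈ Set.Icc 0 1) :
    ∫ v : unitInterval, (if (v : ℝ) < x then (1 : ℝ) else 0) = x := by
  have : (fun v : unitInterval => if (v : ℝ) < x then (1 : ℝ) else 0) =
      (Set.Iio (⟨x, hx⟩ : unitInterval)).indicator 1 := by
    ext v
    simp only [Set.indicator, Set.mem_Iio, Pi.one_apply]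
    congr 1
  rw [this, integral_indicator_one measurableSet_Iio, Measure.real, unitInterval.volume_Iio,
    ENNReal.toReal_ofReal hx.1]

theorem integrable_indicator_lt (x : ℝ) :
    Integrable fun v : unitInterval => if (v : ℝ) < x then (1 : ℝ) else 0 := by
  refine Integrable.of_bound (Measurable.ite (measurableSet_lt measurable_subtype_coe
    measurable_const) measurable_const measurable_const).aestronglyMeasurable 1
    (ae_of_all _ fun v => ?_)
  split_ifs <;> norm_num

/-! ### Measurability of the algorithm -/

section Measurability

theorem measurable_top {Ω ι α : Type*} [MeasurableSpace Ω] [LinearOrder ι] [Fintype ι]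
    [LinearOrder α] [TopologicalSpace α] [OrderClosedTopology α] [SecondCountableTopology α]
    [MeasurableSpace α] [OpensMeasurableSpace α] {f : Ω → ι → α}
    (hf : ∀ i, Measurable fun ω => f ω i) (k : ℕ) : Measurable fun ω => top k (f ω) := by
  have hrank : ∀ i, Measurable fun ω => rank (f ω) i := fun i => by
    simp only [rank, card_filter, rankKey_lt_rankKey]
    refine Finset.measurable_sum _ fun j _ => Measurable.ite ?_ measurable_const measurable_const
    exact (measurableSet_lt (hf i) (hf j)).union
      ((measurableSet_lt (hf j) (hf i)).compl.inter (.const _))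
  refine measurable_finset_iff.2 fun i => measurableSet_setOfPred.1 ?_
  simp only [mem_top]
  exact measurableSet_lt (hrank i) measurable_const

theorem measurable_weight {Ω : Type*} [MeasurableSpace Ω] {g : Ω → ℕ → ℝ}
    (hg : ∀ t, Measurable fun ω => g ω t) (γ ε : ℝ) (t : ℕ) :
    Measurable fun ω => weight γ ε (g ω) t := by
  induction t with
  | zero => exact measurable_const
  | succ t ih => exact measurable_const.max (measurable_const.min
      (ih.div (measurable_const.sub (measurable_const.mul (hg _)))))

variable {n k l : ℕ} {r : ℕ → Fin n}

theorem measurable_rowCache (m t : ℕ) :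
    Measurable fun ω : Coins => rowCache k l r (noise n ω) m t := by
  refine measurable_top (fun i => ?_) k
  simp only [score, noise]
  fun_prop

theorem measurable_rowCost (m t : ℕ) :
    Measurable fun ω : Coins => rowCost k l r (noise n ω) m t :=
  .ite (.const _) measurable_const <| .ite
    (measurable_rowCache _ _ (measurableSet_mem_finset _)) measurable_const measurable_const

theorem measurable_chargedCost (m t : ℕ) :
    Measurable fun ω : Coins => chargedCost k l r (noise n ω) m t :=
  (measurable_rowCost m t).add_const _

theorem measurable_levelCost (m t : ℕ) :
    Measurable fun ω : Coins => levelCost k l r (noise n ω) m t := by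
  induction m generalizing t with
  | zero => exact measurable_rowCost 0 t
  | succ m ih =>
    have hw : Measurable fun ω : Coins => rowWeight k l r (noise n ω) (m + 1) t :=
      measurable_weight (fun s => (ih s).sub (measurable_chargedCost ..)) _ _ t
    exact ((measurable_const.sub hw).mul (ih t)).add (hw.mul (measurable_chargedCost ..))

theorem measurable_rowWeight (m t : ℕ) :
    Measurable fun ω : Coins => rowWeight k l r (noise n ω) m t :=
  measurable_weight (fun s => (measurable_levelCost _ s).sub (measurable_chargedCost ..)) _ _ t

theorem levelCache_zero (ω : Coins) (t : ℕ) :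
    levelCache k l r ω 0 t = rowCache k l r (noise n ω) 0 t := rfl

open Classical in
theorem levelCache_succ (ω : Coins) (m t : ℕ) :
    levelCache k l r ω (m + 1) t =
      if (ω (n + (m + 1)) : ℝ) < rowWeight k l r (noise n ω) (m + 1) t then
        rowCache k l r (noise n ω) (m + 1) t else levelCache k l r ω m t := by
  unfold levelCache
  rw [selected]
  split_ifs <;> rfl

theorem measurable_levelCache (m t : ℕ) : Measurable fun ω : Coins => levelCache k l r ω m t := by
  induction m with
  | zero => exact measurable_rowCache 0 t
  | succ m ih =>
    simp only [levelCache_succ]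
    exact .ite (measurableSet_lt (by fun_prop) (measurable_rowWeight ..))
      (measurable_rowCache ..) ih

theorem card_levelCache (hkn : k ≤ n) (ω : Coins) (m t : ℕ) : #(levelCache k l r ω m t) = k :=
  card_rowCache hkn ..

theorem memLp_roundCost {C D : Coins → Finset (Fin n)} (hC : Measurable C) (hD : Measurable D)
    (i : Fin n) : MemLp (fun ω => roundCost i (C ω) (D ω)) ⊤ coinMeasure := by
  have hmeas : Measurable fun p : Finset (Fin n) × Finset (Fin n) => roundCost i p.1 p.2 :=
    .of_discrete
  refine memLp_of_bounded (a := 0) (b := n + 2) (ae_of_all _ fun ω => ⟨roundCost_nonneg .., ?_⟩)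
    (hmeas.comp (hC.prodMk hD)).aestronglyMeasurable _
  have hcard : (#(C ω) : ℝ) ≤ n := mod_cast card_finset_fin_le (C ω)
  exact (roundCost_le ..).trans (by gcongr)

theorem memLp_rowCost (m t : ℕ) :
    MemLp (fun ω : Coins => rowCost k l r (noise n ω) m t) ⊤ coinMeasure :=
  memLp_of_bounded (a := 0) (b := k + 2)
    (ae_of_all _ fun ω => ⟨rowCost_nonneg .., by unfold rowCost; split_ifs <;> linarith⟩)
    (measurable_rowCost m t).aestronglyMeasurable _

theorem memLp_chargedCost (m t : ℕ) :
    MemLp (fun ω : Coins => chargedCost k l r (noise n ω) m t) ⊤ coinMeasure :=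
  (memLp_rowCost m t).add (memLp_const _)

theorem memLp_levelCost (hk : 1 ≤ k) (m t : ℕ) :
    MemLp (fun ω : Coins => levelCost k l r (noise n ω) m t) ⊤ coinMeasure :=
  memLp_of_bounded (ae_of_all _ fun _ => levelCost_mem_Icc _ _ _ hk m t)
    (measurable_levelCost m t).aestronglyMeasurable _

theorem memLp_rowWeight (m t : ℕ) :
    MemLp (fun ω : Coins => rowWeight k l r (noise n ω) m t) ⊤ coinMeasure :=
  memLp_of_bounded (ae_of_all _ fun _ => rowWeight_mem_Icc _ _ _ _ m t)
    (measurable_rowWeight m t).aestronglyMeasurable _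

end Measurability

/-! ### The selected cache has at most the charged cost -/

section Selection

variable {n k l : ℕ} {r : ℕ → Fin n}

theorem noise_mem_Icc (ω : Coins) (i : Fin n) : noise n ω i ∈ Set.Icc (0 : ℝ) 1 := (ω i).2

theorem noise_update_of_le (ω : Coins) {i : ℕ} (hi : n ≤ i) (v : unitInterval) :
    noise n (Function.update ω i v) = noise n ω := by
  ext j
  unfold noise
  rw [Function.update_of_ne (j.2.trans_le hi).ne]

theorem levelCache_update_of_lt (ω : Coins) {m j : ℕ} (hj : m < j) (v : unitInterval) (t : ℕ) :
    levelCache k l r (Function.update ω (n + j) v) m t = levelCache k l r ω m t := by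
  induction m with
  | zero => rw [levelCache_zero, levelCache_zero, noise_update_of_le _ (by lia)]
  | succ m ih =>
    rw [levelCache_succ, levelCache_succ, ih (by lia), noise_update_of_le _ (by lia),
      Function.update_of_ne (by lia)]

theorem roundCost_le_roundCost_add_card (i : Fin n) (C D E : Finset (Fin n)) :
    roundCost i C D ≤ roundCost i C E + #C := by
  have hmove : moveCost C D ≤ #C := Nat.cast_le.2 (card_le_card sdiff_subset)
  have := moveCost_nonneg C E
  unfold roundCost
  linarith

open Classical in
theorem roundCost_threshold_le (i : Fin n) {B D : Finset (Fin n)} (hB : #B = k) (hD : #D = k)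
    (B' D' : Finset (Fin n)) (v x y : ℝ) :
    roundCost i (if v < x then B else D) (if v < y then B' else D') ≤
      roundCost i D D' + (if v < x then 1 else 0) * (roundCost i B B' - roundCost i D D') +
        k * ((if v < max x y then 1 else 0) - (if v < min x y then 1 else 0)) := by
  have hBD := roundCost_le_roundCost_add_card i B D' B'
  have hDB := roundCost_le_roundCost_add_card i D B' D'
  rw [hB] at hBD
  rw [hD] at hDB
  by_cases hvx : v < x <;> by_cases hvy : v < y <;>
    simp only [hvx, hvy, lt_max_iff, lt_min_iff, or_self, or_true, true_or, and_self, and_true,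
      true_and, if_true, if_false] <;> linarith

-- The two thresholds disagree exactly for samples between `x` and `y`.
open Classical in
theorem integral_roundCost_threshold_le (i : Fin n) {B D : Finset (Fin n)} (hB : #B = k)
    (hD : #D = k) (B' D' : Finset (Fin n)) {x y : ℝ} (hx : x ∈ Set.Icc 0 1)
    (hy : y ∈ Set.Icc 0 1) :
    ∫ v : unitInterval,
        roundCost i (if (v : ℝ) < x then B else D) (if (v : ℝ) < y then B' else D') ≤
      (1 - x) * roundCost i D D' + x * roundCost i B B' + k * |x - y| := by
  have hmax : max x y ∈ Set.Icc 0 1 := ⟨hx.1.trans (le_max_left ..), max_le hx.2 hy.2⟩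
  have hmin : min x y ∈ Set.Icc 0 1 := ⟨le_min hx.1 hy.1, (min_le_left ..).trans hx.2⟩
  have hswitch := (integrable_indicator_lt x).mul_const (roundCost i B B' - roundCost i D D')
  have hkeep := (integrable_const (roundCost i D D')).add hswitch
  have hgap := (integrable_indicator_lt (max x y)).sub (integrable_indicator_lt (min x y))
  refine (integral_mono_of_nonneg (ae_of_all _ fun v => roundCost_nonneg ..)
    (hkeep.add (hgap.const_mul (k : ℝ)))
    (ae_of_all _ fun v => roundCost_threshold_le i hB hD B' D' v x y)).trans_eq ?_
  rw [integral_add' hkeep (hgap.const_mul _), integral_add' (integrable_const _) hswitch,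
    integral_const_mul, integral_sub' (integrable_indicator_lt _) (integrable_indicator_lt _),
    integral_mul_const, integral_indicator_lt hx, integral_indicator_lt hmax,
    integral_indicator_lt hmin, max_sub_min_eq_abs', integral_const, probReal_univ, one_smul]
  ring

theorem integral_update_roundCost_levelCache_le (hk : 1 ≤ k) (hkn : k ≤ n) (ω : Coins) (m t : ℕ) :
    ∫ v, roundCost (r (t + 1))
        (levelCache k l r (Function.update ω (n + (m + 1)) v) (m + 1) (t + 1))
        (levelCache k l r (Function.update ω (n + (m + 1)) v) (m + 1) t) ≤
      (1 - rowWeight k l r (noise n ω) (m + 1) (t + 1)) *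
          roundCost (r (t + 1)) (levelCache k l r ω m (t + 1)) (levelCache k l r ω m t) +
        rowWeight k l r (noise n ω) (m + 1) (t + 1) *
          chargedCost k l r (noise n ω) (m + 1) (t + 1) := by
  simp only [levelCache_succ, levelCache_update_of_lt ω (Nat.lt_succ_self m),
    noise_update_of_le ω (Nat.le_add_right n (m + 1)), Function.update_self]
  have hweight (s : ℕ) : rowWeight k l r (noise n ω) (m + 1) s ∈ Set.Icc 0 1 :=
    ⟨rowWeight_nonneg .., (rowWeight_mem_Icc ..).2⟩
  have hthreshold := integral_roundCost_threshold_le (r (t + 1))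
    (card_rowCache (l := l) (r := r) (u := noise n ω) hkn (m + 1) (t + 1))
    (card_levelCache (l := l) (r := r) hkn ω m (t + 1)) (rowCache k l r (noise n ω) (m + 1) t)
    (levelCache k l r ω m t) (hweight (t + 1)) (hweight t)
  have hmove := mul_abs_rowWeight_sub_le (l := l) (r := r) (u := noise n ω) hk m t
  have hrow := mul_le_mul_of_nonneg_left (roundCost_rowCache_le (l := l) (r := r) hk hkn
    (noise_mem_Icc ω) (m + 1) t) (hweight (t + 1)).1
  simp only [chargedCost, mul_add]
  linarith

-- The weight `w` is what makes the induction go through: it accumulates the probabilities that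
-- the higher rows are not selected.
theorem integral_mul_roundCost_levelCache_le (hk : 1 ≤ k) (hkn : k ≤ n) (m t : ℕ) {w : Coins → ℝ}
    (hw : MemLp w ⊤ coinMeasure) (hw0 : ∀ ω, 0 ≤ w ω)
    (hwu : ∀ ω j v, w (Function.update ω (n + j) v) = w ω) :
    ∫ ω, w ω * roundCost (r (t + 1)) (levelCache k l r ω m (t + 1)) (levelCache k l r ω m t)
        ∂coinMeasure ≤
      ∫ ω, w ω * levelCost k l r (noise n ω) m (t + 1) ∂coinMeasure := by
  have hlev (m : ℕ) : MemLp (fun ω : Coins => roundCost (r (t + 1))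
      (levelCache k l r ω m (t + 1)) (levelCache k l r ω m t)) ⊤ coinMeasure :=
    memLp_roundCost (measurable_levelCache ..) (measurable_levelCache ..) _
  induction m generalizing w with
  | zero =>
    refine integral_mono ((hlev 0).mul' hw |>.integrable le_top)
      ((memLp_levelCost hk 0 _).mul' hw |>.integrable le_top)
      fun ω => mul_le_mul_of_nonneg_left ?_ (hw0 ω)
    exact roundCost_rowCache_le hk hkn (noise_mem_Icc ω) 0 t
  | succ m ih =>
    set x : Coins → ℝ := fun ω => rowWeight k l r (noise n ω) (m + 1) (t + 1)
    set c : Coins → ℝ := fun ω => chargedCost k l r (noise n ω) (m + 1) (t + 1)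
    have hx : MemLp x ⊤ coinMeasure := memLp_rowWeight ..
    have hskip : MemLp (fun ω => w ω * (1 - x ω)) ⊤ coinMeasure :=
      ((memLp_const 1).sub hx).mul' hw
    have hcharge : MemLp (fun ω => w ω * (x ω * c ω)) ⊤ coinMeasure :=
      ((memLp_chargedCost ..).mul' hx (r := ⊤)).mul' hw
    have hsplit (f : Coins → ℝ) : (fun ω => w ω * ((1 - x ω) * f ω + x ω * c ω)) =
        fun ω => w ω * (1 - x ω) * f ω + w ω * (x ω * c ω) := by
      simp only [mul_add, mul_assoc]
    have hint {f : Coins → ℝ} (hf : MemLp f ⊤ coinMeasure) :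
        Integrable (fun ω => w ω * ((1 - x ω) * f ω + x ω * c ω)) coinMeasure := by
      rw [hsplit]
      exact ((hf.mul' hskip).add hcharge).integrable le_top
    calc _ ≤ ∫ ω, w ω * ((1 - x ω) * roundCost (r (t + 1)) (levelCache k l r ω m (t + 1))
          (levelCache k l r ω m t) + x ω * c ω) ∂coinMeasure := by
          refine integral_le_of_integral_update_le _ ((hlev (m + 1)).mul' hw |>.integrable le_top)
            (hint (hlev m)) (n + (m + 1)) fun ω => ?_
          simp only [hwu, integral_const_mul]
          exact mul_le_mul_of_nonneg_left
            (integral_update_roundCost_levelCache_le hk hkn ω m t) (hw0 ω)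
      _ ≤ ∫ ω, w ω * ((1 - x ω) * levelCost k l r (noise n ω) m (t + 1) + x ω * c ω)
            ∂coinMeasure := by
          rw [hsplit, hsplit, integral_add (hlev m |>.mul' hskip |>.integrable le_top)
            (hcharge.integrable le_top), integral_add
            (memLp_levelCost hk m _ |>.mul' hskip |>.integrable le_top) (hcharge.integrable le_top)]
          refine add_le_add_left (ih hskip (fun ω => mul_nonneg (hw0 ω)
            (sub_nonneg.2 (rowWeight_mem_Icc ..).2)) fun ω j v => ?_) _
          simp only [hwu, x, noise_update_of_le ω (Nat.le_add_right n j)]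

theorem integral_intervalCost_le (hk : 1 ≤ k) (hkn : k ≤ n) {a b : ℕ} (ha : 1 ≤ a) :
    ∫ ω, intervalCost r (levelCache k l r ω l) a b ∂coinMeasure ≤
      ∫ ω, ∑ t ∈ Icc a b, levelCost k l r (noise n ω) l t ∂coinMeasure := by
  have hint (t : ℕ) : Integrable (fun ω : Coins => roundCost (r t)
      (levelCache k l r ω l t) (levelCache k l r ω l (t - 1))) coinMeasure :=
    (memLp_roundCost (measurable_levelCache ..) (measurable_levelCache ..) _).integrable le_top
  calc _ ≤ ∫ ω, ∑ t ∈ Icc a b, roundCost (r t) (levelCache k l r ω l t)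
        (levelCache k l r ω l (t - 1)) ∂coinMeasure := by
        exact integral_mono_of_nonneg (ae_of_all _ fun ω => add_nonneg
          (sum_nonneg fun _ _ => missLoss_nonneg ..) (sum_nonneg fun _ _ => moveCost_nonneg ..))
          (integrable_finsetSum _ fun t _ => hint t)
          (ae_of_all _ fun ω => intervalCost_le_sum_roundCost ..)
    _ ≤ _ := by
        rw [integral_finsetSum _ fun t _ => hint t,
          integral_finsetSum _ fun t _ => (memLp_levelCost hk l t).integrable le_top]
        refine sum_le_sum fun t ht => ?_
        obtain ⟨s, rfl⟩ : ∃ s, t = s + 1 := ⟨t - 1, by have := (mem_Icc.1 ht).1; lia⟩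
        simpa only [one_mul, Nat.add_sub_cancel] using
          integral_mul_roundCost_levelCache_le (l := l) (r := r) hk hkn l s (memLp_const 1)
            (fun _ => zero_le_one) (fun _ _ _ => rfl)

end Selection

/-! ### Following the perturbed leader -/

section Leader

variable {n k l : ℕ} {r : ℕ → Fin n}

theorem mod_ne_zero_of_block {len s t : ℕ} (hs : s % len = 0) (hst : s < t) (hts : t < s + len) :
    ¬ t % len = 0 := by
  intro ht
  have hdvd : len ∣ t - s := Nat.dvd_sub (Nat.dvd_of_mod_eq_zero ht) (Nat.dvd_of_mod_eq_zero hs)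
  have := Nat.le_of_dvd (by lia) hdvd
  lia

theorem missLoss_le_two (i : Fin n) (C : Finset (Fin n)) : missLoss i C ≤ 2 := by
  unfold missLoss; split_ifs <;> norm_num

theorem sum_score_counts_succ {len t : ℕ} (ht : ¬ t % len = 0) (h : ℕ) (u : Fin n → ℝ)
    (C : Finset (Fin n)) :
    ∑ i ∈ C, score (counts len r (t + 1)) h u i =
      ∑ i ∈ C, score (counts len r t) h u i + (1 - missLoss (r (t + 1)) C / 2) := by
  have hmem : 1 - missLoss (r (t + 1)) C / 2 = ∑ i ∈ C, if i = r (t + 1) then (1 : ℝ) else 0 := by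
    rw [sum_ite_eq', missLoss]
    split_ifs <;> norm_num
  rw [hmem, ← sum_add_distrib]
  refine sum_congr rfl fun i _ => ?_
  split_ifs with hi
  · exact hi ▸ score_counts_succ_self ht
  · rw [score_counts_succ_of_ne ht hi, add_zero]

variable {len h s e : ℕ} {u : Fin n → ℝ}

theorem score_counts_restart (hs : s % len = 0) (i : Fin n) :
    score (counts len r (s + 1)) h u i = h * u i := by
  rw [counts, if_pos hs, score, Nat.cast_zero, zero_add]

theorem sum_one_sub_missLoss_le_sum_score (hu : ∀ i, u i ∈ Set.Icc (0 : ℝ) 1) (hs : s % len = 0)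
    (C : Finset (Fin n)) (hse : s + 1 ≤ e) (hes : e ≤ s + len) :
    ∑ t ∈ Ioc (s + 1) e, (1 - missLoss (r t) C / 2) ≤ ∑ i ∈ C, score (counts len r e) h u i := by
  induction e, hse using Nat.le_induction with
  | base =>
    rw [Ioc_self, sum_empty]
    refine sum_nonneg fun i _ => ?_
    rw [score_counts_restart hs]
    exact mul_nonneg h.cast_nonneg (hu i).1
  | succ e hse ih =>
    rw [sum_Ioc_succ_top hse,
      sum_score_counts_succ (mod_ne_zero_of_block hs (by lia) (by lia))]
    gcongr
    exact ih (by lia)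

-- The leader with hindsight of one round gains at least as much as its score increases.
theorem sum_score_leader_le (hkn : k ≤ n) (hu : ∀ i, u i ∈ Set.Icc (0 : ℝ) 1) (hs : s % len = 0)
    (hse : s + 1 ≤ e) (hes : e ≤ s + len) :
    ∑ i ∈ top k (score (counts len r e) h u), score (counts len r e) h u i ≤
      k * h + ∑ t ∈ Ioc (s + 1) e,
        (1 - missLoss (r t) (top k (score (counts len r t) h u)) / 2) := by
  have hcard (t : ℕ) : #(top k (score (counts len r t) h u)) = k := card_top (by simpa using hkn) _
  induction e, hse using Nat.le_induction with
  | base =>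
    rw [Ioc_self, sum_empty, add_zero]
    refine (sum_le_card_nsmul _ _ (h : ℝ) fun i _ => ?_).trans_eq (by rw [hcard, nsmul_eq_mul])
    rw [score_counts_restart hs]
    exact mul_le_of_le_one_right h.cast_nonneg (hu i).2
  | succ e hse ih =>
    rw [sum_Ioc_succ_top hse,
      sum_score_counts_succ (mod_ne_zero_of_block hs (by lia) (by lia)), ← add_assoc]
    gcongr
    exact (sum_le_sum_top _ (by rw [hcard, hcard])).trans (ih (by lia))

theorem sum_missLoss_leader_le (hkn : k ≤ n) (hu : ∀ i, u i ∈ Set.Icc (0 : ℝ) 1)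
    (hs : s % len = 0) (hse : s + 1 ≤ e) (hes : e ≤ s + len) {C : Finset (Fin n)} (hC : #C = k) :
    ∑ t ∈ Ioc (s + 1) e, missLoss (r t) (top k (score (counts len r t) h u)) ≤
      ∑ t ∈ Ioc (s + 1) e, missLoss (r t) C + 2 * (k * h) := by
  have hle := (sum_one_sub_missLoss_le_sum_score (h := h) (r := r) hu hs C hse hes).trans <|
    (sum_le_sum_top (k := k) _ (by rw [card_top (by simpa using hkn), hC])).trans
      (sum_score_leader_le hkn hu hs hse hes)
  simp only [sum_sub_distrib, ← sum_div] at hle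
  linarith

theorem noise_update (ω : Coins) (i : Fin n) (v : unitInterval) :
    noise n (Function.update ω i v) = Function.update (noise n ω) i v := by
  ext j
  unfold noise
  rcases eq_or_ne j i with rfl | hj
  · simp only [Function.update_self]
  · rw [Function.update_of_ne hj, Function.update_of_ne (Fin.val_injective.ne hj)]

theorem volumeReal_le_of_forall_le_add {S : Set unitInterval} {δ : ℝ} (hδ : 0 ≤ δ)
    (h : ∀ v ∈ S, ∀ w ∈ S, (w : ℝ) ≤ v + δ) : volume.real S ≤ δ := by
  refine ENNReal.toReal_le_of_le_ofReal hδ ?_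
  rw [unitInterval.volume_apply]
  refine (Real.volume_le_diam _).trans (Metric.ediam_le ?_)
  rintro _ ⟨v, hv, rfl⟩ _ ⟨w, hw, rfl⟩
  rw [edist_dist, Real.dist_eq]
  refine ENNReal.ofReal_le_ofReal (abs_le.2 ⟨?_, ?_⟩)
  · linarith [h v hv w hw]
  · linarith [h w hw v hv]

-- With the noise of the other pages fixed, the requested page becomes a leader in this round only
-- if its own noise lies in an interval of length `1 / rowScale l m`.
theorem measureReal_mem_rowCache_succ_sdiff_le {m t : ℕ} (hm : m ≠ 0)
    (ht : ¬ t % blockLength l m = 0) :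
    coinMeasure.real {ω | r (t + 1) ∈ rowCache k l r (noise n ω) m (t + 1) ∧
      r (t + 1) ∉ rowCache k l r (noise n ω) m t} ≤ 1 / rowScale l m := by
  have hscale := one_le_rowScale l m
  refine measureReal_le_of_update _ ((measurable_rowCache _ _ (measurableSet_mem_finset _)).inter
    (measurable_rowCache _ _ (measurableSet_mem_finset _)).compl) (r (t + 1)) fun ω =>
    volumeReal_le_of_forall_le_add (by positivity) fun v hv w hw => ?_
  by_contra! hlt
  refine hw.2 (show r (t + 1) ∈ rowCache k l r (noise n _) m t from ?_)
  have hmem : r (t + 1) ∈ rowCache k l r (noise n _) m (t + 1) := hv.1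
  simp only [rowCache, rowCounts, hm, if_false] at hmem ⊢
  refine mem_top_of_le hmem ?_ fun j hj => ?_
  · have hgap : (rowScale l m : ℝ) * (v + 1 / rowScale l m) ≤ rowScale l m * w := by gcongr
    rw [mul_add, mul_one_div_cancel (by positivity)] at hgap
    rw [score_counts_succ_self ht]
    simp only [score, noise_update, Function.update_self]
    linarith
  · rw [score_counts_succ_of_ne ht hj]
    simp only [score, noise_update, Function.update_of_ne hj, le_refl]

theorem integrable_missLoss_rowCache (i : Fin n) (m t : ℕ) :
    Integrable (fun ω => missLoss i (rowCache k l r (noise n ω) m t)) coinMeasure :=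
  .of_mem_Icc 0 2 (Measurable.ite (measurable_rowCache _ _ (measurableSet_mem_finset _))
    measurable_const measurable_const).aemeasurable
    (ae_of_all _ fun _ => ⟨missLoss_nonneg .., missLoss_le_two ..⟩)

theorem integral_missLoss_rowCache_le_succ {m t : ℕ} (hm : m ≠ 0)
    (ht : ¬ t % blockLength l m = 0) :
    ∫ ω, missLoss (r (t + 1)) (rowCache k l r (noise n ω) m t) ∂coinMeasure ≤
      ∫ ω, missLoss (r (t + 1)) (rowCache k l r (noise n ω) m (t + 1)) ∂coinMeasure +
        2 / rowScale l m := by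
  set E : Set Coins := {ω | r (t + 1) ∈ rowCache k l r (noise n ω) m (t + 1) ∧
    r (t + 1) ∉ rowCache k l r (noise n ω) m t}
  have hE : MeasurableSet E := (measurable_rowCache _ _ (measurableSet_mem_finset _)).inter
    (measurable_rowCache _ _ (measurableSet_mem_finset _)).compl
  have hindicator : Integrable (E.indicator fun _ => (2 : ℝ)) coinMeasure :=
    (integrable_const 2).indicator hE
  calc _ ≤ ∫ ω, (missLoss (r (t + 1)) (rowCache k l r (noise n ω) m (t + 1)) +
        E.indicator (fun _ => 2) ω) ∂coinMeasure := by
        refine integral_mono (integrable_missLoss_rowCache ..)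
          ((integrable_missLoss_rowCache ..).add hindicator) fun ω => ?_
        by_cases hω : ω ∈ E
        · simp only [Set.indicator_of_mem hω, missLoss, hω.1, hω.2, if_true, if_false, zero_add,
            le_refl]
        · simp only [Set.indicator_of_notMem hω, missLoss]
          split_ifs with hold hnew hnew
          exacts [by norm_num, by norm_num, absurd ⟨hnew, hold⟩ hω, by norm_num]
    _ = ∫ ω, missLoss (r (t + 1)) (rowCache k l r (noise n ω) m (t + 1)) ∂coinMeasure +
        coinMeasure.real E * 2 := by
        rw [integral_add (integrable_missLoss_rowCache ..) hindicator,
          integral_indicator_const _ hE, smul_eq_mul]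
    _ ≤ _ := by
        have := measureReal_mem_rowCache_succ_sdiff_le (k := k) (r := r) hm ht
        rw [div_eq_mul_one_div, mul_comm 2]
        gcongr

theorem rowCost_succ_eq_missLoss {m t : ℕ} (hm : m ≠ 0) (ht : ¬ t % blockLength l m = 0)
    (u : Fin n → ℝ) :
    rowCost k l r u m (t + 1) = missLoss (r (t + 1)) (rowCache k l r u m t) := by
  simp only [rowCost, missLoss, Nat.add_sub_cancel, hm, ht, and_false, if_false]

theorem integral_sum_missLoss_rowCache_le (hkn : k ≤ n) {m s e : ℕ} (hm : m ≠ 0)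
    (hs : s % blockLength l m = 0) (hse : s + 1 ≤ e) (hes : e ≤ s + blockLength l m)
    {C : Finset (Fin n)} (hC : #C = k) :
    ∑ t ∈ Ioc (s + 1) e, ∫ ω, missLoss (r t) (rowCache k l r (noise n ω) m t) ∂coinMeasure ≤
      ∑ t ∈ Ioc (s + 1) e, missLoss (r t) C + 2 * (k * rowScale l m) := by
  rw [← integral_finsetSum _ fun t _ => integrable_missLoss_rowCache ..]
  refine (integral_mono (integrable_finsetSum _ fun t _ => integrable_missLoss_rowCache ..)
    (integrable_const _) fun ω => ?_).trans_eq (by rw [integral_const, probReal_univ, one_smul])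
  simpa only [rowCache, rowCounts, hm, if_false] using
    sum_missLoss_leader_le hkn (noise_mem_Icc ω) hs hse hes hC

theorem integral_sum_rowCost_le (hkn : k ≤ n) {m s e : ℕ} (hm : m ≠ 0)
    (hs : s % blockLength l m = 0) (hse : s + 1 ≤ e) (hes : e ≤ s + blockLength l m)
    {C : Finset (Fin n)} (hC : #C = k) :
    ∫ ω, ∑ t ∈ Ioc s e, rowCost k l r (noise n ω) m t ∂coinMeasure ≤
      ∑ t ∈ Ioc s e, missLoss (r t) C + (k + 2 + 2 * (k * rowScale l m) +
        2 * ((e - s) / rowScale l m)) := by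
  have hsplit (f : ℕ → ℝ) : ∑ t ∈ Ioc s e, f t = f (s + 1) + ∑ t ∈ Ioc (s + 1) e, f t := by
    rw [← insert_Ioc_add_one_left_eq_Ioc (Nat.lt_of_succ_le hse), sum_insert left_notMem_Ioc]
  have hrestart (ω : Coins) : rowCost k l r (noise n ω) m (s + 1) = k + 2 := by
    rw [rowCost, Nat.add_sub_cancel, if_pos ⟨hm, hs⟩]
  have hround : ∀ t ∈ Ioc (s + 1) e, ∫ ω, rowCost k l r (noise n ω) m t ∂coinMeasure ≤
      ∫ ω, missLoss (r t) (rowCache k l r (noise n ω) m t) ∂coinMeasure + 2 / rowScale l m := by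
    intro t ht
    obtain ⟨hst, hte⟩ := mem_Ioc.1 ht
    obtain ⟨t, rfl⟩ : ∃ t', t = t' + 1 := ⟨t - 1, by lia⟩
    have hmod := mod_ne_zero_of_block hs (t := t) (by lia) (by lia)
    simp only [rowCost_succ_eq_missLoss hm hmod]
    exact integral_missLoss_rowCache_le_succ hm hmod
  have hlength : ((#(Ioc (s + 1) e) : ℕ) : ℝ) * (2 / rowScale l m) ≤
      2 * ((e - s) / rowScale l m) := by
    rw [Nat.card_Ioc, Nat.cast_sub hse, mul_div_left_comm, Nat.cast_succ]
    gcongr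
    linarith
  have hleader := integral_sum_missLoss_rowCache_le (r := r) hkn hm hs hse hes hC
  have hsum := sum_le_sum hround
  rw [sum_add_distrib, sum_const, nsmul_eq_mul] at hsum
  rw [integral_finsetSum _ fun t _ => (memLp_rowCost m t).integrable le_top, hsplit, hsplit]
  simp only [hrestart, integral_const, probReal_univ, one_smul]
  linarith [missLoss_nonneg (r (s + 1)) C]

end Leader

/-! ### Regret of the combination on intervals -/

section Regret

variable {n k l : ℕ} {r : ℕ → Fin n} {u : Fin n → ℝ}

theorem sum_levelCost_succ_le (hk : 1 ≤ k) {a b : ℕ} (hab : a ≤ b) (m : ℕ) :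
    ∑ t ∈ Ioc a b, levelCost k l r u (m + 1) t ≤ ∑ t ∈ Ioc a b, levelCost k l r u m t +
      (rowWeight k l r u (m + 1) a / rate k l (m + 1) + minWeight l * (5 * k * (b - a))) := by
  have hsum : ∑ t ∈ Ioc a b, levelCost k l r u (m + 1) t = ∑ t ∈ Ioc a b, levelCost k l r u m t -
      ∑ t ∈ Ioc a b, rowWeight k l r u (m + 1) t * rowGain k l r u (m + 1) t := by
    rw [← sum_sub_distrib]
    refine sum_congr rfl fun t _ => ?_
    rw [levelCost_succ, rowGain, Nat.add_sub_cancel]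
    ring
  have hgain : ∑ t ∈ Ioc a b, |rowGain k l r u (m + 1) t| ≤ 5 * k * (b - a) := by
    refine (sum_le_card_nsmul _ _ _ fun t _ =>
      (abs_rowGain_le l r u hk m t).trans (costBound_le hk ..)).trans_eq ?_
    rw [Nat.card_Ioc, nsmul_eq_mul, Nat.cast_sub hab, mul_comm]
  have hweight := neg_sum_weight_mul_le hab (rate_pos hk l (m + 1)) (minWeight_pos l)
    (minWeight_le_one l) fun t _ => rate_mul_rowGain_lt_one (r := r) (u := u) hk m t
  have := mul_le_mul_of_nonneg_left hgain (minWeight_pos l).le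
  rw [hsum]
  unfold rowWeight
  linarith

theorem sum_levelCost_succ_le_sum_chargedCost (hk : 1 ≤ k) {a b : ℕ} (hab : a ≤ b) (m : ℕ) :
    ∑ t ∈ Ioc a b, levelCost k l r u (m + 1) t ≤
      ∑ t ∈ Ioc a b, chargedCost k l r u (m + 1) t +
        Real.log (1 / minWeight l) / rate k l (m + 1) := by
  have hsum : ∑ t ∈ Ioc a b, levelCost k l r u (m + 1) t =
      ∑ t ∈ Ioc a b, chargedCost k l r u (m + 1) t +
        ∑ t ∈ Ioc a b, (1 - rowWeight k l r u (m + 1) t) * rowGain k l r u (m + 1) t := by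
    rw [← sum_add_distrib]
    refine sum_congr rfl fun t _ => ?_
    rw [levelCost_succ, rowGain, Nat.add_sub_cancel]
    ring
  rw [hsum]
  exact add_le_add_right (sum_one_sub_weight_mul_le hab (rate_pos hk l (m + 1)) (minWeight_pos l)
    (minWeight_le_one l) fun t _ => rate_mul_rowGain_lt_one hk m t) _

theorem sum_levelCost_le_of_le (hk : 1 ≤ k) {m a b : ℕ} (hab : a ≤ b) {j : ℕ} (hmj : m ≤ j) :
    ∑ t ∈ Ioc a b, levelCost k l r u j t ≤ ∑ t ∈ Ioc a b, levelCost k l r u m t +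
      ∑ i ∈ Ioc m j, (rowWeight k l r u i a / rate k l i + minWeight l * (5 * k * (b - a))) := by
  induction j, hmj using Nat.le_induction with
  | base => simp
  | succ j hmj ih =>
    rw [sum_Ioc_succ_top hmj]
    linarith [sum_levelCost_succ_le (l := l) (r := r) (u := u) hk hab j]

theorem one_div_rate {i : ℕ} (hi : i ≠ 0) : 1 / rate k l i = 10 * k * 2 ^ (l - i) := by
  simp [rate, rowScale, hi]

theorem sum_one_div_rate_le {m : ℕ} (hm : m ≤ l) :
    ∑ i ∈ Ioc m l, 1 / rate k l i ≤ 10 * k * 2 ^ (l - m) := by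
  have hgeom : ∀ j, m ≤ j → j ≤ l →
      ∑ i ∈ Ioc m j, 1 / rate k l i + 10 * k * 2 ^ (l - j) = 10 * k * 2 ^ (l - m) := by
    intro j hj
    induction j, hj using Nat.le_induction with
    | base => simp
    | succ j hmj ih =>
      intro hj
      have ih := ih (by lia)
      rw [show l - j = l - (j + 1) + 1 by lia, pow_succ] at ih
      rw [sum_Ioc_succ_top hmj, one_div_rate (by lia)]
      linarith
  have : (0 : ℝ) ≤ 10 * k * 2 ^ (l - l) := by positivity
  linarith [hgeom l hm le_rfl]

theorem natCast_mul_minWeight_le {b : ℕ} (hb : b ≤ 2 ^ l) : l * (minWeight l * b) ≤ 1 := by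
  have hb' : (b : ℝ) ≤ 2 ^ l := mod_cast hb
  have hl : (l : ℝ) ≤ 2 ^ l := mod_cast Nat.lt_two_pow_self.le
  calc _ = (l : ℝ) * b / (2 ^ l * 2 ^ l) := by unfold minWeight; ring
    _ ≤ 1 := div_le_one_of_le₀ (by gcongr) (by positivity)

theorem mul_minWeight_mul_le {b : ℕ} (hb : b ≤ 2 ^ l) {a j : ℕ} (hj : j ≤ l) :
    j * (minWeight l * (5 * k * (b - a))) ≤ 5 * k := by
  have hweight := (minWeight_pos l).le
  calc (j : ℝ) * (minWeight l * (5 * k * (b - a)))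
      ≤ j * (minWeight l * (5 * k * b)) := by
        gcongr
        linarith [Nat.cast_nonneg (α := ℝ) a]
    _ ≤ l * (minWeight l * (5 * k * b)) := by gcongr
    _ = 5 * k * (l * (minWeight l * b)) := by ring
    _ ≤ 5 * k := mul_le_of_le_one_right (by positivity) (natCast_mul_minWeight_le hb)

theorem sum_levelCost_le_sum_levelCost_add (hk : 1 ≤ k) {m a b : ℕ} (hab : a ≤ b) (hm : m ≤ l)
    (hb : b ≤ 2 ^ l) :
    ∑ t ∈ Ioc a b, levelCost k l r u l t ≤ ∑ t ∈ Ioc a b, levelCost k l r u m t +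
      (10 * k * 2 ^ (l - m) + 5 * k) := by
  have hsum := sum_levelCost_le_of_le (l := l) (r := r) (u := u) hk hab hm
  have hweights : ∑ i ∈ Ioc m l, rowWeight k l r u i a / rate k l i ≤ 10 * k * 2 ^ (l - m) := by
    refine (sum_le_sum fun i _ => ?_).trans (sum_one_div_rate_le hm)
    exact div_le_div_of_nonneg_right (rowWeight_mem_Icc ..).2 (rate_pos hk l i).le
  have := mul_minWeight_mul_le (k := k) hb (a := a) (Nat.sub_le l m)
  rw [sum_add_distrib, sum_const, Nat.card_Ioc, nsmul_eq_mul] at hsum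
  linarith

-- Initially all weights are minimal, so that from the first round on the loss against row `0`
-- does not depend on `l`.
theorem sum_levelCost_le_sum_rowCost_zero (hk : 1 ≤ k) {b : ℕ} (hb : b ≤ 2 ^ l) :
    ∑ t ∈ Ioc 0 b, levelCost k l r u l t ≤ ∑ t ∈ Ioc 0 b, rowCost k l r u 0 t + 15 * k := by
  have hsum := sum_levelCost_le_of_le (l := l) (r := r) (u := u) hk b.zero_le l.zero_le
  change _ ≤ ∑ t ∈ Ioc 0 b, rowCost k l r u 0 t + _ at hsum
  have hweights : ∑ i ∈ Ioc 0 l, rowWeight k l r u i 0 / rate k l i ≤ 10 * k := by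
    calc _ = minWeight l * ∑ i ∈ Ioc 0 l, 1 / rate k l i := by
          rw [mul_sum]
          exact sum_congr rfl fun i _ => by rw [mul_one_div]; rfl
      _ ≤ minWeight l * (10 * k * 2 ^ l) := mul_le_mul_of_nonneg_left
          (sum_one_div_rate_le l.zero_le) (minWeight_pos l).le
      _ = 10 * k / 2 ^ l := by unfold minWeight; field_simp
      _ ≤ 10 * k := div_le_self (by positivity) (one_le_pow₀ one_le_two)
  have := mul_minWeight_mul_le (k := k) hb (a := 0) (le_refl l)
  rw [sum_add_distrib, sum_const, Nat.card_Ioc, nsmul_eq_mul, Nat.sub_zero] at hsum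
  simp only [Nat.cast_zero, sub_zero] at hsum this
  linarith

theorem log_one_div_minWeight_le (l : ℕ) : Real.log (1 / minWeight l) ≤ 1.4 * l := by
  rw [minWeight, one_div_one_div, Real.log_mul (by positivity) (by positivity), Real.log_pow]
  nlinarith [Real.log_two_lt_d9, Nat.cast_nonneg (α := ℝ) l]

variable {m s e : ℕ}

theorem blockLength_eq (l m : ℕ) : (blockLength l m : ℝ) = l * (2 ^ (l - m) * 2 ^ (l - m)) := by
  rw [blockLength, Nat.cast_mul, Nat.cast_pow, ← mul_pow]
  norm_num

theorem sum_costBound_le (hk : 1 ≤ k) (hs : s % blockLength l m = 0) (hse : s + 1 ≤ e)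
    (hes : e ≤ s + blockLength l m) :
    ∑ t ∈ Ioc s e, costBound k l m t ≤ 5 * k + 3 * (e - s) := by
  have hrest : ∀ t ∈ Ioc (s + 1) e, costBound k l m t = 3 := fun t ht => by
    rw [mem_Ioc] at ht
    exact if_neg fun h => mod_ne_zero_of_block hs (t := t - 1) (by lia) (by lia) h.2
  rw [← insert_Ioc_add_one_left_eq_Ioc (Nat.lt_of_succ_le hse), sum_insert left_notMem_Ioc,
    sum_congr rfl hrest, sum_const, Nat.card_Ioc, nsmul_eq_mul, Nat.cast_sub hse, Nat.cast_succ]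
  linarith [costBound_le hk l m (s + 1)]

theorem moveRate_mul_sum_costBound_le (hk : 1 ≤ k) (hm : m ≠ 0) (hs : s % blockLength l m = 0)
    (hse : s + 1 ≤ e) (hes : e ≤ s + blockLength l m) :
    moveRate l m * ∑ t ∈ Ioc s e, costBound k l m t ≤ k + l * 2 ^ (l - m) := by
  have hrate : moveRate l m = 1 / (10 * 2 ^ (l - m)) := by simp [moveRate, rowScale, hm]
  have hlength : (e : ℝ) - s ≤ l * (2 ^ (l - m) * 2 ^ (l - m)) := by
    rw [← blockLength_eq, sub_le_iff_le_add']
    exact mod_cast hes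
  have hpow : (1 : ℝ) ≤ 2 ^ (l - m) := one_le_pow₀ one_le_two
  have hkpow : (k : ℝ) ≤ k * 2 ^ (l - m) := le_mul_of_one_le_right k.cast_nonneg hpow
  have : (0 : ℝ) ≤ l * (2 ^ (l - m) * 2 ^ (l - m)) := by positivity
  rw [hrate, one_div, inv_mul_le_iff₀ (by positivity)]
  linarith [sum_costBound_le hk hs hse hes]

theorem mul_two_pow_le_mul_mul (k : ℕ) (hl : 1 ≤ l) (i : ℕ) :
    (k : ℝ) * 2 ^ i ≤ k * l * 2 ^ i := by
  gcongr
  exact le_mul_of_one_le_right k.cast_nonneg (mod_cast hl)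

theorem mul_two_pow_le_mul_mul' (hk : 1 ≤ k) (l i : ℕ) :
    (l : ℝ) * 2 ^ i ≤ k * l * 2 ^ i := by
  gcongr
  exact le_mul_of_one_le_left l.cast_nonneg (mod_cast hk)

theorem sum_levelCost_le_sum_rowCost (hk : 1 ≤ k) (hm : 1 ≤ m) (hml : m ≤ l)
    (hs : s % blockLength l m = 0) (hse : s + 1 ≤ e) (hes : e ≤ s + blockLength l m)
    (he : e ≤ 2 ^ l) :
    ∑ t ∈ Ioc s e, levelCost k l r u l t ≤
      ∑ t ∈ Ioc s e, rowCost k l r u m t + 31 * (k * l * 2 ^ (l - m)) := by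
  have hupper := sum_levelCost_le_sum_levelCost_add (r := r) (u := u) hk (by lia : s ≤ e) hml he
  have hmove := moveRate_mul_sum_costBound_le hk (by lia) hs hse hes
  have hlog : Real.log (1 / minWeight l) / rate k l m ≤ 14 * (k * l * 2 ^ (l - m)) := by
    rw [div_eq_mul_one_div, one_div_rate (by lia)]
    calc _ ≤ 1.4 * (l : ℝ) * (10 * k * 2 ^ (l - m)) := by
          gcongr
          exact log_one_div_minWeight_le l
      _ = _ := by ring
  obtain ⟨m, rfl⟩ : ∃ m', m = m' + 1 := ⟨m - 1, by lia⟩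
  have hrow := sum_levelCost_succ_le_sum_chargedCost (l := l) (r := r) (u := u) hk
    (by lia : s ≤ e) m
  simp only [chargedCost, sum_add_distrib, ← mul_sum] at hrow
  have hkpow := mul_two_pow_le_mul_mul k (hm.trans hml) (l - (m + 1))
  have hlpow := mul_two_pow_le_mul_mul' hk l (l - (m + 1))
  have hkk : (k : ℝ) ≤ k * 2 ^ (l - (m + 1)) :=
    le_mul_of_one_le_right k.cast_nonneg (one_le_pow₀ one_le_two)
  linarith

theorem integrable_sum_levelCost (hk : 1 ≤ k) (m a b : ℕ) :
    Integrable (fun ω : Coins => ∑ t ∈ Ioc a b, levelCost k l r (noise n ω) m t) coinMeasure :=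
  integrable_finsetSum _ fun t _ => (memLp_levelCost hk m t).integrable le_top

theorem integral_sum_levelCost_block_le (hk : 1 ≤ k) (hkn : k ≤ n) (hm : 1 ≤ m) (hml : m ≤ l)
    (hs : s % blockLength l m = 0) (hse : s + 1 ≤ e) (hes : e ≤ s + blockLength l m)
    (he : e ≤ 2 ^ l) {C : Finset (Fin n)} (hC : #C = k) :
    ∫ ω, ∑ t ∈ Ioc s e, levelCost k l r (noise n ω) l t ∂coinMeasure ≤
      ∑ t ∈ Ioc s e, missLoss (r t) C + 40 * (k * l * 2 ^ (l - m)) := by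
  have hint : Integrable (fun ω : Coins => ∑ t ∈ Ioc s e, rowCost k l r (noise n ω) m t)
      coinMeasure := integrable_finsetSum _ fun t _ => (memLp_rowCost m t).integrable le_top
  have hlevel := integral_mono (integrable_sum_levelCost hk l s e)
    (hint.add (integrable_const _)) fun ω =>
      sum_levelCost_le_sum_rowCost (r := r) (u := noise n ω) hk hm hml hs hse hes he
  rw [integral_add' hint (integrable_const _), integral_const, probReal_univ, one_smul] at hlevel
  have hrow := integral_sum_rowCost_le (r := r) hkn (by lia : m ≠ 0) hs hse hes hC
  have hscale : (rowScale l m : ℝ) = 2 ^ (l - m) := by simp [rowScale, (by lia : m ≠ 0)]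
  have hlength : ((e : ℝ) - s) / rowScale l m ≤ l * 2 ^ (l - m) := by
    rw [hscale, div_le_iff₀ (by positivity), mul_assoc, ← blockLength_eq, sub_le_iff_le_add']
    exact mod_cast hes
  rw [hscale] at hrow hlength
  have hk1 : (1 : ℝ) ≤ k := mod_cast hk
  have hkpow := mul_two_pow_le_mul_mul k (hm.trans hml) (l - m)
  have hlpow := mul_two_pow_le_mul_mul' hk l (l - m)
  have hkk : (k : ℝ) ≤ k * 2 ^ (l - m) :=
    le_mul_of_one_le_right k.cast_nonneg (one_le_pow₀ one_le_two)
  linarith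

theorem integral_sum_levelCost_split (hk : 1 ≤ k) {a c b : ℕ} (hac : a ≤ c) (hcb : c ≤ b) :
    ∫ ω, ∑ t ∈ Ioc a b, levelCost k l r (noise n ω) l t ∂coinMeasure =
      ∫ ω, ∑ t ∈ Ioc a c, levelCost k l r (noise n ω) l t ∂coinMeasure +
        ∫ ω, ∑ t ∈ Ioc c b, levelCost k l r (noise n ω) l t ∂coinMeasure := by
  rw [← integral_add (integrable_sum_levelCost hk ..) (integrable_sum_levelCost hk ..)]
  simp only [sum_Ioc_consecutive _ hac hcb]

theorem integral_sum_levelCost_blocks_le (hk : 1 ≤ k) (hkn : k ≤ n) (hm : 1 ≤ m) (hml : m ≤ l)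
    (he : e ≤ 2 ^ l) {C : Finset (Fin n)} (hC : #C = k) (q : ℕ)
    (hs : s % blockLength l m = 0) (hse : s ≤ e) (hes : e ≤ s + q * blockLength l m) :
    ∫ ω, ∑ t ∈ Ioc s e, levelCost k l r (noise n ω) l t ∂coinMeasure ≤
      ∑ t ∈ Ioc s e, missLoss (r t) C + q * (40 * (k * l * 2 ^ (l - m))) := by
  induction q generalizing s with
  | zero =>
    obtain rfl : s = e := by lia
    simp
  | succ q ih =>
    have hnonneg : (0 : ℝ) ≤ q * (40 * (k * l * 2 ^ (l - m))) := by positivity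
    rw [Nat.cast_succ, add_mul, one_mul]
    rcases hse.eq_or_lt with rfl | hlt
    · simp only [Ioc_self, sum_empty, integral_zero, zero_add]
      positivity
    rcases le_or_gt e (s + blockLength l m) with hle | hgt
    · linarith [integral_sum_levelCost_block_le (r := r) hk hkn hm hml hs hlt hle he hC]
    · have hlen : 0 < blockLength l m := Nat.mul_pos (by lia) (by positivity)
      have hfirst := integral_sum_levelCost_block_le (r := r) hk hkn hm hml hs (by lia) le_rfl
        (by lia) hC
      have hrest := ih (s := s + blockLength l m) (by simpa using hs) hgt.le
        (by rw [add_mul, one_mul] at hes; lia)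
      rw [integral_sum_levelCost_split hk (Nat.le_add_right ..) hgt.le,
        ← sum_Ioc_consecutive _ (Nat.le_add_right ..) hgt.le]
      linarith

theorem card_block_start_le_one {len a b : ℕ} (hb : b ≤ a + len) :
    #{t ∈ Ioc a b | (t - 1) % len = 0} ≤ 1 := by
  refine card_le_one.2 fun x hx y hy => ?_
  rw [mem_filter, mem_Ioc] at hx hy
  rcases lt_trichotomy x y with hlt | heq | hlt
  · exact absurd hy.2 (mod_ne_zero_of_block hx.2 (by lia) (by lia))
  · exact heq
  · exact absurd hx.2 (mod_ne_zero_of_block hy.2 (by lia) (by lia))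

theorem sum_levelCost_le_of_le_add (hk : 1 ≤ k) {a b : ℕ} (hab : a ≤ b) (hb : b ≤ a + l) :
    ∑ t ∈ Ioc a b, levelCost k l r u l t ≤ 3 * (b - a) + 5 * k := by
  have hround : ∀ t ∈ Ioc a b, levelCost k l r u l t ≤
      3 + 5 * k * (if (t - 1) % l = 0 then (1 : ℝ) else 0) := by
    intro t _
    refine (levelCost_mem_Icc l r u hk l t).2.trans ?_
    rw [costBound, blockLength, Nat.sub_self, pow_zero, mul_one]
    split_ifs with hstart hmod hmod
    · linarith
    · exact absurd hstart.2 hmod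
    · linarith [Nat.cast_nonneg (α := ℝ) k]
    · linarith
  refine (sum_le_sum hround).trans ?_
  rw [sum_add_distrib, sum_const, Nat.card_Ioc, nsmul_eq_mul, Nat.cast_sub hab, ← mul_sum,
    sum_boole]
  have hstart : (#{t ∈ Ioc a b | (t - 1) % l = 0} : ℝ) ≤ 1 := mod_cast card_block_start_le_one hb
  linarith [mul_le_of_le_one_right (by positivity : (0 : ℝ) ≤ 5 * k) hstart]

theorem sum_levelCost_le_of_le_add_mul (hk : 1 ≤ k) (q : ℕ) {a b : ℕ} (hab : a ≤ b)
    (hb : b ≤ a + q * l) :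
    ∑ t ∈ Ioc a b, levelCost k l r u l t ≤ 3 * (b - a) + 5 * k * q := by
  induction q generalizing a with
  | zero =>
    obtain rfl : a = b := by lia
    simp
  | succ q ih =>
    rw [Nat.cast_succ, mul_add, mul_one]
    rcases le_or_gt b (a + l) with hle | hgt
    · have : (0 : ℝ) ≤ 5 * k * q := by positivity
      linarith [sum_levelCost_le_of_le_add (r := r) (u := u) hk hab hle]
    · have hrest := ih hgt.le (by rw [add_mul, one_mul] at hb; lia)
      have hfirst := sum_levelCost_le_of_le_add (l := l) (r := r) (u := u) hk
        (Nat.le_add_right a l) le_rfl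
      rw [← sum_Ioc_consecutive _ (Nat.le_add_right a l) hgt.le]
      push_cast at hrest hfirst
      linarith

theorem exists_blockLength_mul_le {a b : ℕ} (hl : 1 ≤ l) (hba : 4 * l ≤ b - a) (hb : b ≤ 2 ^ l) :
    ∃ m, 1 ≤ m ∧ m ≤ l ∧ 4 * blockLength l m ≤ b - a ∧ b - a < 16 * blockLength l m := by
  set j := Nat.log 4 ((b - a) / l)
  have hquot : 4 ≤ (b - a) / l := (Nat.le_div_iff_mul_le hl).2 hba
  have hj1 : 1 ≤ j := Nat.log_pos (by norm_num) hquot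
  have hlow : 4 ^ j * l ≤ b - a :=
    (Nat.le_div_iff_mul_le hl).1 (Nat.pow_log_le_self 4 (by lia))
  have hupp : b - a < 4 ^ (j + 1) * l :=
    (Nat.div_lt_iff_lt_mul hl).1 (Nat.lt_pow_succ_log_self (by norm_num) _)
  have hjl : j ≤ l := by
    have hpow : 2 ^ j ≤ 2 ^ l := calc
      2 ^ j ≤ 4 ^ j := Nat.pow_le_pow_left (by norm_num) j
      _ ≤ 4 ^ j * l := Nat.le_mul_of_pos_right _ hl
      _ ≤ 2 ^ l := by lia
    exact (Nat.pow_le_pow_iff_right (by norm_num)).1 hpow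
  obtain ⟨i, hi⟩ : ∃ i, j = i + 1 := ⟨j - 1, by lia⟩
  refine ⟨l - i, by lia, by lia, ?_, ?_⟩ <;> rw [blockLength, show l - (l - i) = i by lia]
  · calc 4 * (l * 4 ^ i) = 4 ^ (i + 1) * l := by ring
      _ ≤ b - a := hi ▸ hlow
  · calc b - a < 4 ^ (i + 1 + 1) * l := hi ▸ hupp
      _ = 16 * (l * 4 ^ i) := by ring

theorem exists_multiple_mem_Ico {len : ℕ} (hlen : 0 < len) (a : ℕ) :
    ∃ s, s % len = 0 ∧ a ≤ s ∧ s < a + len := by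
  refine ⟨(a + len - 1) / len * len, Nat.mul_mod_left .., ?_, ?_⟩
  · have := Nat.lt_div_mul_add (a := a + len - 1) hlen
    lia
  · have := Nat.div_mul_le_self (a + len - 1) len
    lia

theorem integral_sum_levelCost_short_le (hk : 1 ≤ k) (hl : 1 ≤ l) {C : Finset (Fin n)} {a b : ℕ}
    (hab : a < b) (hb : b - a ≤ 4 * l) :
    ∫ ω, ∑ t ∈ Ioc a b, levelCost k l r (noise n ω) l t ∂coinMeasure ≤
      ∑ t ∈ Ioc a b, missLoss (r t) C + 640 * (k * √(l * (b - a))) := by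
  have hint := integral_mono (integrable_sum_levelCost (l := l) (r := r) hk l a b)
    (integrable_const _) fun ω => sum_levelCost_le_of_le_add_mul hk 4 hab.le (by lia)
  rw [integral_const, probReal_univ, one_smul] at hint
  have hmiss : 0 ≤ ∑ t ∈ Ioc a b, missLoss (r t) C := sum_nonneg fun _ _ => missLoss_nonneg ..
  have hk1 : (1 : ℝ) ≤ k := mod_cast hk
  have hl1 : (1 : ℝ) ≤ l := mod_cast hl
  have hlen1 : (1 : ℝ) ≤ b - a := by
    rw [le_sub_iff_add_le']
    exact mod_cast hab
  have hlen4 : (b : ℝ) - a ≤ 4 * l := by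
    rw [sub_le_iff_le_add']
    exact mod_cast (by lia : b ≤ a + 4 * l)
  have hsqrt : √((l : ℝ) * (b - a)) * √(l * (b - a)) = l * (b - a) :=
    Real.mul_self_sqrt (by positivity)
  have hsqrt1 : 1 ≤ √((l : ℝ) * (b - a)) := Real.one_le_sqrt.2 (by nlinarith)
  have hlen : (b : ℝ) - a ≤ 2 * √(l * (b - a)) := by nlinarith
  have hk_sqrt : (k : ℝ) ≤ k * √(l * (b - a)) := le_mul_of_one_le_right (by positivity) hsqrt1
  have hsqrt_k : √((l : ℝ) * (b - a)) ≤ k * √(l * (b - a)) :=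
    le_mul_of_one_le_left (by positivity) hk1
  push_cast at hint
  linarith

-- Blocks whose length is between a sixteenth and a quarter of `b - a` cover the interval from the
-- first start `s` of a block on; the part before `s` is shorter by a factor `4`, and the bounds
-- of the induction are summed like a geometric series.
theorem integral_sum_levelCost_le (hk : 1 ≤ k) (hkn : k ≤ n) (hl : 1 ≤ l) {C : Finset (Fin n)}
    (hC : #C = k) {a b : ℕ} (hab : a ≤ b) (hb : b ≤ 2 ^ l) :
    ∫ ω, ∑ t ∈ Ioc a b, levelCost k l r (noise n ω) l t ∂coinMeasure ≤
      ∑ t ∈ Ioc a b, missLoss (r t) C + 640 * (k * √(l * (b - a))) := by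
  induction b using Nat.strong_induction_on with
  | _ b ih =>
  rcases hab.eq_or_lt with rfl | hlt
  · simp
  rcases le_or_gt (b - a) (4 * l) with hshort | hlong
  · exact integral_sum_levelCost_short_le hk hl hlt hshort
  obtain ⟨m, hm, hml, hlow, hupp⟩ := exists_blockLength_mul_le hl hlong.le hb
  obtain ⟨s, hs, has, hsa⟩ := exists_multiple_mem_Ico (len := blockLength l m) (by lia) a
  have hprefix := ih s (by lia) has (by lia)
  have hblocks := integral_sum_levelCost_blocks_le (r := r) hk hkn hm hml hb hC 16 hs (by lia)
    (by lia)
  have hlow' : 4 * (blockLength l m : ℝ) ≤ b - a := by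
    rw [← Nat.cast_sub hab]
    exact mod_cast hlow
  have hsa' : (s : ℝ) < a + blockLength l m := mod_cast hsa
  have has' : (a : ℝ) ≤ s := mod_cast has
  have hsq : √((l : ℝ) * (b - a)) ^ 2 = l * (b - a) := Real.sq_sqrt (by
    have : (a : ℝ) ≤ b := mod_cast hab
    nlinarith [Nat.cast_nonneg (α := ℝ) l])
  have hprefix_sqrt : √((l : ℝ) * (s - a)) ≤ √(l * (b - a)) / 2 := by
    rw [Real.sqrt_le_left (by positivity), div_pow, hsq]
    nlinarith [Nat.cast_nonneg (α := ℝ) l]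
  have hblock_sqrt : (l : ℝ) * 2 ^ (l - m) ≤ √(l * (b - a)) / 2 := by
    rw [← sq_le_sq₀ (by positivity) (by positivity), div_pow, hsq]
    rw [blockLength_eq] at hlow'
    nlinarith [Nat.cast_nonneg (α := ℝ) l]
  have hprefix_le := mul_le_mul_of_nonneg_left hprefix_sqrt k.cast_nonneg
  have hblocks_le := mul_le_mul_of_nonneg_left hblock_sqrt k.cast_nonneg
  rw [integral_sum_levelCost_split hk has (by lia : s ≤ b),
    ← sum_Ioc_consecutive _ has (by lia : s ≤ b)]
  push_cast at hblocks
  linarith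

end Regret

/-! ### Competitiveness of the marking algorithm -/

section Marking

variable {n k : ℕ}

/-- The marked pages, in terms of the page classes of `markStep`. -/
def marked (c : Fin n → ℕ) : Finset (Fin n) := {j | c j = 4}

/-- The unmarked pages that were marked at the end of the previous phase, in terms of the page
classes of `markStep`. -/
def stale (c : Fin n → ℕ) : Finset (Fin n) := {j | c j = 2}

variable {c : Fin n → ℕ} {i j : Fin n}

theorem mem_marked : j ∈ marked c ↔ c j = 4 := mem_filter_univ j

theorem mem_stale : j ∈ stale c ↔ c j = 2 := mem_filter_univ j

theorem disjoint_marked_stale (c : Fin n → ℕ) : Disjoint (marked c) (stale c) :=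
  disjoint_left.2 fun j h h' => by
    rw [mem_marked] at h
    rw [mem_stale] at h'
    lia

theorem markStep_of_mem (h : i ∈ marked c) : markStep k i c = c := if_pos (mem_marked.1 h)

theorem markStep_of_lt (h : i ∉ marked c) (hc : #(marked c) < k) :
    markStep k i c = Function.update c i 4 :=
  (if_neg (mem_marked.not.1 h)).trans (if_pos hc)

theorem markStep_of_le (h : i ∉ marked c) (hc : k ≤ #(marked c)) :
    markStep k i c = Function.update (fun j => c j - 2) i 4 :=
  (if_neg (mem_marked.not.1 h)).trans (if_neg hc.not_gt)

theorem marked_markStep_of_lt (h : i ∉ marked c) (hc : #(marked c) < k) :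
    marked (markStep k i c) = insert i (marked c) := by
  ext j
  rw [markStep_of_lt h hc, mem_insert, mem_marked, mem_marked]
  rcases eq_or_ne j i with rfl | hj <;> simp [*]

theorem stale_markStep_of_lt (h : i ∉ marked c) (hc : #(marked c) < k) :
    stale (markStep k i c) = (stale c).erase i := by
  ext j
  rw [markStep_of_lt h hc, mem_erase, mem_stale, mem_stale]
  rcases eq_or_ne j i with rfl | hj <;> simp [*]

theorem marked_markStep_of_le (h : i ∉ marked c) (hc : k ≤ #(marked c)) (hle : ∀ j, c j ≤ 4) :
    marked (markStep k i c) = {i} := by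
  ext j
  rw [markStep_of_le h hc, mem_singleton, mem_marked]
  rcases eq_or_ne j i with rfl | hj
  · simp
  · have := hle j
    simp only [Function.update_of_ne hj, hj, iff_false]
    lia

theorem stale_markStep_of_le (h : i ∉ marked c) (hc : k ≤ #(marked c)) :
    stale (markStep k i c) = marked c := by
  ext j
  rw [markStep_of_le h hc, mem_stale]
  rcases eq_or_ne j i with rfl | hj
  · simp [h]
  · rw [mem_marked, Function.update_of_ne hj]
    lia

variable {r : ℕ → Fin n}

theorem card_stale_le (hk : 1 ≤ k) (r : ℕ → Fin n) (t : ℕ) : #(stale (markClass k r t)) ≤ k := by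
  induction t with
  | zero => simp [stale, markClass]
  | succ t ih =>
    rw [markClass]
    by_cases h : r (t + 1) ∈ marked (markClass k r t)
    · rwa [markStep_of_mem h]
    rcases lt_or_ge #(marked (markClass k r t)) k with hc | hc
    · rw [stale_markStep_of_lt h hc]
      exact (card_erase_le).trans ih
    · rw [stale_markStep_of_le h hc]
      exact card_marked_le hk r t

theorem stale_eq_empty_or_le_card (k : ℕ) (r : ℕ → Fin n) (t : ℕ) :
    stale (markClass k r t) = ∅ ∨
      k ≤ #(marked (markClass k r t)) + #(stale (markClass k r t)) := by
  induction t with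
  | zero => simp [stale, markClass]
  | succ t ih =>
    rw [markClass]
    by_cases h : r (t + 1) ∈ marked (markClass k r t)
    · rwa [markStep_of_mem h]
    rcases lt_or_ge #(marked (markClass k r t)) k with hc | hc
    · rw [stale_markStep_of_lt h hc, marked_markStep_of_lt h hc, card_insert_of_notMem h]
      have := pred_card_le_card_erase (s := stale (markClass k r t)) (a := r (t + 1))
      exact ih.imp (fun h => by rw [h, erase_empty]) fun h => by lia
    · rw [stale_markStep_of_le h hc]
      exact .inr (hc.trans (Nat.le_add_left ..))

/-! ### The probability of a fault -/

variable {u : Fin n → ℝ}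

theorem notMem_top_of_le_card {f : Fin n → ℝ} (h : k ≤ #{j | f i < f j}) : i ∉ top k f := by
  rw [mem_top, not_lt]
  exact h.trans (card_le_card fun j hj => by
    rw [mem_filter_univ] at hj ⊢
    exact rankKey_lt_rankKey.2 (.inl hj))

theorem card_stale_sdiff_top (hkn : k ≤ n) (hu : ∀ i, u i ∈ Set.Icc (0 : ℝ) 1)
    (hc : ∀ j, c j = 0 ∨ c j = 2 ∨ c j = 4) (hmarked : #(marked c) ≤ k)
    (hk : k ≤ #(marked c) + #(stale c)) :
    #(stale c \ top k (score c 1 u)) + k = #(marked c) + #(stale c) := by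
  have hsub : top k (score c 1 u) ⊆ marked c ∪ stale c := by
    intro i hi
    by_contra hne
    rw [mem_union, mem_marked, mem_stale] at hne
    refine notMem_top_of_le_card (hk.trans ?_) hi
    rw [← card_union_of_disjoint (disjoint_marked_stale c)]
    refine card_le_card fun j hj => ?_
    rw [mem_union, mem_marked, mem_stale] at hj
    have := hc i
    exact mem_filter.2 ⟨mem_univ j, score_lt_score_of_add_two_le hu (by lia)⟩
  have hmem : marked c ⊆ top k (score c 1 u) := by
    intro i hi
    refine mem_top_of_card_class_le hu hc ((card_le_card fun j hj => ?_).trans hmarked)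
    have := hc j
    rw [mem_filter_univ] at hj
    rw [mem_marked] at hi ⊢
    lia
  have hsdiff : stale c \ top k (score c 1 u) = (marked c ∪ stale c) \ top k (score c 1 u) := by
    rw [union_sdiff_distrib, sdiff_eq_empty_iff_subset.2 hmem, empty_union]
  have hcard := card_sdiff_add_card_eq_card hsub
  rwa [← hsdiff, card_top (by simpa using hkn),
    card_union_of_disjoint (disjoint_marked_stale c)] at hcard

theorem score_injective (hu : ∀ i, u i ∈ Set.Icc (0 : ℝ) 1)
    (hc : ∀ j, c j = 0 ∨ c j = 2 ∨ c j = 4) (hinj : Function.Injective u) :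
    Function.Injective (score c 1 u) := by
  intro i j h
  have hi := hc i
  have hj := hc j
  rcases lt_trichotomy (c i) (c j) with hlt | heq | hlt
  · exact absurd h (score_lt_score_of_add_two_le hu (by lia)).ne
  · exact hinj (by simpa [score, heq] using h)
  · exact absurd h (score_lt_score_of_add_two_le hu (by lia)).ne'

theorem noise_comp_swap (ω : Coins) (i j a : Fin n) :
    noise n (fun b => ω (Equiv.swap (i : ℕ) j b)) a = noise n ω (Equiv.swap i j a) := by
  simp only [noise, Fin.val_injective.swap_apply]

theorem ae_injective_noise (n : ℕ) : ∀ᵐ ω ∂coinMeasure, Function.Injective (noise n ω) := by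
  have : ∀ᵐ ω ∂coinMeasure, ∀ i j : Fin n, i ≠ j → ω i ≠ ω j := by
    simp only [ae_all_iff]
    exact fun i j hij => ae_ne_of_ne (Fin.val_injective.ne hij)
  filter_upwards [this] with ω hω i j h
  by_contra hij
  exact hω i j hij (Subtype.ext h)

theorem rowCache_zero (k l : ℕ) (r : ℕ → Fin n) (u : Fin n → ℝ) (t : ℕ) :
    rowCache k l r u 0 t = top k (score (markClass k r t) 1 u) := rfl

theorem integral_missLoss_rowCache_zero_eq (l : ℕ) {t : ℕ} (hi : i ∈ stale (markClass k r t))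
    (hj : j ∈ stale (markClass k r t)) :
    ∫ ω, missLoss i (rowCache k l r (noise n ω) 0 t) ∂coinMeasure =
      ∫ ω, missLoss j (rowCache k l r (noise n ω) 0 t) ∂coinMeasure := by
  rw [← integral_comp_perm (integrable_missLoss_rowCache j 0 t) (Equiv.swap (i : ℕ) j)]
  refine integral_congr_ae ?_
  filter_upwards [ae_injective_noise n] with ω hω
  have hclass (a : Fin n) : markClass k r t (Equiv.swap i j a) = markClass k r t a := by
    rw [mem_stale] at hi hj
    rw [Equiv.swap_apply_def]
    split_ifs <;> simp_all
  have hscore : score (markClass k r t) 1 (noise n fun b => ω (Equiv.swap (i : ℕ) j b)) =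
      score (markClass k r t) 1 (noise n ω) ∘ Equiv.swap i j := by
    ext a
    simp only [Function.comp, score, noise_comp_swap, hclass]
  simp only [missLoss, rowCache_zero, hscore, mem_top]
  rw [rank_comp_perm (score_injective (noise_mem_Icc ω) (markClass_cases k r t) hω),
    Equiv.swap_apply_right]

theorem rowCost_zero_succ (k l : ℕ) (r : ℕ → Fin n) (u : Fin n → ℝ) (t : ℕ) :
    rowCost k l r u 0 (t + 1) = missLoss (r (t + 1)) (rowCache k l r u 0 t) / 2 := by
  simp only [rowCost, missLoss, Nat.add_sub_cancel]
  split_ifs <;> simp_all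

-- By symmetry all stale pages are missing with the same probability, and the number of missing
-- stale pages does not depend on the noise.
theorem integral_rowCost_zero_of_stale (hk : 1 ≤ k) (hkn : k ≤ n) (l : ℕ) {t : ℕ}
    (hcard : k ≤ #(marked (markClass k r t)) + #(stale (markClass k r t)))
    (hr : r (t + 1) ∈ stale (markClass k r t)) :
    ∫ ω, rowCost k l r (noise n ω) 0 (t + 1) ∂coinMeasure =
      (#(marked (markClass k r t)) + #(stale (markClass k r t)) - k) /
        #(stale (markClass k r t)) := by
  set c := markClass k r t
  have hmiss (ω : Coins) : ∑ i ∈ stale c, missLoss i (rowCache k l r (noise n ω) 0 t) =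
      2 * (#(marked c) + #(stale c) - k) := by
    have hcount : (#(stale c \ rowCache k l r (noise n ω) 0 t) : ℝ) + k =
        #(marked c) + #(stale c) := mod_cast card_stale_sdiff_top hkn (noise_mem_Icc ω)
          (markClass_cases k r t) (card_marked_le hk r t) hcard
    simp only [missLoss]
    rw [sum_ite, sum_const_zero, zero_add, sum_const, filter_notMem_eq_sdiff, nsmul_eq_mul]
    linarith
  have hsum := integral_finsetSum (stale c) fun i _ =>
    integrable_missLoss_rowCache (k := k) (l := l) (r := r) i 0 t
  simp only [hmiss, integral_const, probReal_univ, one_smul] at hsum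
  rw [sum_congr rfl fun i hi => integral_missLoss_rowCache_zero_eq l hi hr, sum_const,
    nsmul_eq_mul] at hsum
  have hpos : (0 : ℝ) < #(stale c) := mod_cast card_pos.2 ⟨_, hr⟩
  simp only [rowCost_zero_succ, integral_div]
  rw [eq_div_iff hpos.ne']
  linarith

theorem integral_rowCost_zero_le_one (k l : ℕ) (r : ℕ → Fin n) (t : ℕ) :
    ∫ ω, rowCost k l r (noise n ω) 0 t ∂coinMeasure ≤ 1 := by
  simpa using integral_mono ((memLp_rowCost 0 t).integrable le_top) (integrable_const 1)
    fun ω : Coins => rowCost_zero_le t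

theorem integral_rowCost_zero_of_marked (hk : 1 ≤ k) (l : ℕ) {t : ℕ}
    (hr : r (t + 1) ∈ marked (markClass k r t)) :
    ∫ ω, rowCost k l r (noise n ω) 0 (t + 1) ∂coinMeasure = 0 := by
  have hcost (ω : Coins) : rowCost k l r (noise n ω) 0 (t + 1) = 0 := by
    have := mem_rowCache_zero_of_marked (l := l) hk (noise_mem_Icc ω) (mem_marked.1 hr)
    rw [rowCost_zero_succ, missLoss, if_pos this, zero_div]
  simp only [hcost, integral_zero]

/-! ### The potential of a phase -/

theorem harmonic_le_harmonic {a b : ℕ} (h : a ≤ b) : (harmonic a : ℝ) ≤ harmonic b := by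
  have : harmonic a ≤ harmonic b :=
    sum_le_sum_of_subset_of_nonneg (range_subset_range.2 h) fun _ _ _ => by positivity
  exact mod_cast this

theorem one_le_harmonic {a : ℕ} (h : 1 ≤ a) : (1 : ℝ) ≤ harmonic a := by
  simpa [harmonic] using harmonic_le_harmonic h

/-- Potential of the marking algorithm within a phase, with `m` marked and `q` stale pages.  If
`m + q < k`, no phase is completed yet, and `m` bounds the number of faults.  Otherwise it bounds
the expected number of faults since the start of the phase: `m + q - k` pages were marked that
had not been marked in the previous phase, and the `k - q` others were requested when at least
`q + 1, …, k` pages were stale. -/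
noncomputable def phasePotential (k m q : ℕ) : ℝ :=
  if m + q < k then m - harmonic k * k else (m + q - k) * (1 + harmonic k - harmonic q)

theorem phasePotential_add_one_le {m q : ℕ} (hm : m < k) (hqk : q ≤ k) (hq : q = 0 ∨ k ≤ m + q) :
    phasePotential k m q + 1 ≤ phasePotential k (m + 1) q := by
  have hH := one_le_harmonic (by lia : 1 ≤ k)
  have hkH := le_mul_of_one_le_left k.cast_nonneg hH
  have hqH := harmonic_le_harmonic hqk
  unfold phasePotential
  split_ifs with hlt hlt'
  · push_cast
    linarith
  · obtain rfl : q = 0 := by lia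
    obtain rfl : k = m + 1 := by lia
    push_cast at hkH ⊢
    linarith
  · lia
  · push_cast
    linarith

theorem phasePotential_add_div {m q : ℕ} (hq : q ≠ 0) (hk : k ≤ m + q) :
    phasePotential k m q + (m + q - k) / q = phasePotential k (m + 1) (q - 1) := by
  obtain ⟨q, rfl⟩ := Nat.exists_eq_succ_of_ne_zero hq
  rw [phasePotential, if_neg (by lia), phasePotential, if_neg (by lia), Nat.succ_eq_add_one,
    Nat.add_sub_cancel, harmonic_succ]
  push_cast
  ring

theorem phasePotential_le {m q : ℕ} (hm : m ≤ k) (hk : k ≤ m + q) :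
    phasePotential k m q ≤ harmonic k * (m + q - k) := by
  rw [phasePotential, if_neg hk.not_gt, mul_comm]
  rcases Nat.eq_zero_or_pos q with rfl | hq
  · obtain rfl : m = k := by lia
    simp
  · have hmk : (0 : ℝ) ≤ m + q - k := by
      rw [sub_nonneg]
      exact mod_cast hk
    gcongr
    linarith [one_le_harmonic hq]

theorem phasePotential_one_self (k : ℕ) : phasePotential k 1 k = 1 := by
  simp [phasePotential]

theorem integral_rowCost_zero_add_phasePotential_le (hk : 1 ≤ k) (hkn : k ≤ n) (l : ℕ) {t : ℕ}
    (h : r (t + 1) ∈ marked (markClass k r t) ∨ #(marked (markClass k r t)) < k) :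
    ∫ ω, rowCost k l r (noise n ω) 0 (t + 1) ∂coinMeasure +
        phasePotential k #(marked (markClass k r t)) #(stale (markClass k r t)) ≤
      phasePotential k #(marked (markClass k r (t + 1))) #(stale (markClass k r (t + 1))) := by
  rw [markClass]
  by_cases hr : r (t + 1) ∈ marked (markClass k r t)
  · rw [markStep_of_mem hr, integral_rowCost_zero_of_marked hk l hr, zero_add]
  have hlt := h.resolve_left hr
  rw [marked_markStep_of_lt hr hlt, stale_markStep_of_lt hr hlt, card_insert_of_notMem hr]
  by_cases hstale : r (t + 1) ∈ stale (markClass k r t)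
  · have hcard := (stale_eq_empty_or_le_card k r t).resolve_left (ne_empty_of_mem hstale)
    rw [integral_rowCost_zero_of_stale hk hkn l hcard hstale, card_erase_of_mem hstale, add_comm,
      phasePotential_add_div (card_ne_zero_of_mem hstale) hcard]
  · rw [erase_eq_of_notMem hstale]
    have := phasePotential_add_one_le hlt (card_stale_le hk r t)
      ((stale_eq_empty_or_le_card k r t).imp_left card_eq_zero.2)
    linarith [integral_rowCost_zero_le_one k l r (t + 1)]

/-! ### Comparison with an offline algorithm -/

/-- Potential of the marking algorithm with the page classes `c` relative to the cache `C` of its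
opponent. -/
noncomputable def markPotential (k : ℕ) (c : Fin n → ℕ) (C : Finset (Fin n)) : ℝ :=
  harmonic k * (#(marked c ∪ stale c ∪ C) + #(marked c ∪ C) - 3 * k) -
    phasePotential k #(marked c) #(stale c)

theorem card_insert_union_le (i : Fin n) (P C D : Finset (Fin n)) :
    (#(insert i P ∪ C) : ℝ) ≤ #(P ∪ D) + roundCost i C D := by
  have hsub : insert i P ∪ C ⊆ (P ∪ D) ∪ ((C \ D) ∪ ({i} \ C)) := by
    intro j hj
    simp only [mem_union, mem_insert, mem_sdiff, mem_singleton] at *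
    tauto
  have hcard : (#(insert i P ∪ C) : ℝ) ≤ #(P ∪ D) + (#(C \ D) + #({i} \ C)) :=
    mod_cast (card_le_card hsub).trans ((card_union_le _ _).trans
      (Nat.add_le_add_left (card_union_le _ _) _))
  have hmiss : (#({i} \ C) : ℝ) ≤ missLoss i C := by
    unfold missLoss
    split_ifs with h
    · simp [h]
    · rw [sdiff_eq_self_of_disjoint (by simpa using h), card_singleton]
      norm_num
  unfold roundCost moveCost
  linarith

variable {C D : Finset (Fin n)}

theorem markPotential_markStep_le (hC : #C = k) (hmarked : #(marked c) = k) (hi : i ∉ marked c)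
    (hle : ∀ j, c j ≤ 4) :
    1 + markPotential k (markStep k i c) D ≤
      markPotential k c C + 2 * harmonic k * roundCost i D C := by
  rw [markPotential, markPotential, marked_markStep_of_le hi hmarked.ge hle,
    stale_markStep_of_le hi hmarked.ge, card_singleton, hmarked, phasePotential_one_self]
  have hunion : (#(marked c ∪ stale c ∪ C) : ℝ) ≥ k + #(stale c) := by
    rw [ge_iff_le, ← hmarked, ← Nat.cast_add,
      ← card_union_of_disjoint (disjoint_marked_stale c)]
    exact mod_cast card_le_card subset_union_left
  have hphase := phasePotential_le le_rfl (Nat.le_add_right k #(stale c))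
  have hmove := card_insert_union_le i (marked c) D C
  have hmove' := card_insert_union_le i ∅ D C
  rw [insert_empty_eq, empty_union, hC] at hmove'
  have hH : (0 : ℝ) ≤ harmonic k := harmonic_le_harmonic k.zero_le |>.trans' (by simp)
  rw [singleton_union]
  nlinarith [mul_le_mul_of_nonneg_left (add_le_add hmove hmove') hH,
    mul_le_mul_of_nonneg_left hunion hH]

theorem marked_markStep (h : i ∈ marked c ∨ #(marked c) < k) :
    marked (markStep k i c) = insert i (marked c) := by
  by_cases hi : i ∈ marked c
  · rw [markStep_of_mem hi, insert_eq_of_mem hi]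
  · exact marked_markStep_of_lt hi (h.resolve_left hi)

theorem marked_union_stale_markStep (h : i ∈ marked c ∨ #(marked c) < k) :
    marked (markStep k i c) ∪ stale (markStep k i c) = insert i (marked c ∪ stale c) := by
  by_cases hi : i ∈ marked c
  · rw [markStep_of_mem hi, insert_eq_of_mem (mem_union_left _ hi)]
  · rw [marked_markStep h, stale_markStep_of_lt hi (h.resolve_left hi)]
    ext j
    simp only [mem_union, mem_insert, mem_erase]
    tauto

theorem integral_rowCost_zero_add_markPotential_le (hk : 1 ≤ k) (hkn : k ≤ n) (l t : ℕ)
    (hC : #C = k) :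
    ∫ ω, rowCost k l r (noise n ω) 0 (t + 1) ∂coinMeasure +
        markPotential k (markClass k r (t + 1)) D ≤
      markPotential k (markClass k r t) C + 2 * harmonic k * roundCost (r (t + 1)) D C := by
  by_cases hphase : r (t + 1) ∈ marked (markClass k r t) ∨ #(marked (markClass k r t)) < k
  · have hcost := integral_rowCost_zero_add_phasePotential_le hk hkn l hphase
    have hmove := card_insert_union_le (r (t + 1)) (marked (markClass k r t)) D C
    have hmove' := card_insert_union_le (r (t + 1))
      (marked (markClass k r t) ∪ stale (markClass k r t)) D C
    have hH : (0 : ℝ) ≤ harmonic k := zero_le_one.trans (one_le_harmonic hk)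
    rw [markClass, marked_markStep hphase] at hcost
    rw [markPotential, markPotential, markClass, marked_union_stale_markStep hphase,
      marked_markStep hphase]
    linarith [mul_le_mul_of_nonneg_left (add_le_add hmove hmove') hH]
  · obtain ⟨hr, hcard⟩ := not_or.1 hphase
    have hfull : #(marked (markClass k r t)) = k :=
      (card_marked_le hk r t).antisymm (not_lt.1 hcard)
    exact (add_le_add_left (integral_rowCost_zero_le_one k l r (t + 1)) _).trans
      (markPotential_markStep_le hC hfull hr (markClass_le_four k r t))

theorem neg_le_markPotential (hk : 1 ≤ k) (r : ℕ → Fin n) (t : ℕ) (hC : #C = k) :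
    -(harmonic k * k) ≤ markPotential k (markClass k r t) C := by
  have hH := one_le_harmonic hk
  have hcard : #(marked (markClass k r t)) ≤ k := card_marked_le hk r t
  have hmarked : (#(marked (markClass k r t)) : ℝ) ≤ k := mod_cast hcard
  have hC' : (k : ℝ) ≤ #(marked (markClass k r t) ∪ C) :=
    mod_cast hC ▸ card_le_card subset_union_right
  have hC'' : (k : ℝ) ≤ #(marked (markClass k r t) ∪ stale (markClass k r t) ∪ C) :=
    mod_cast hC ▸ card_le_card subset_union_right
  have hunion : (#(marked (markClass k r t)) : ℝ) + #(stale (markClass k r t)) ≤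
      #(marked (markClass k r t) ∪ stale (markClass k r t) ∪ C) := by
    rw [← Nat.cast_add, ← card_union_of_disjoint (disjoint_marked_stale _)]
    exact mod_cast card_le_card subset_union_left
  unfold markPotential
  rcases lt_or_ge (#(marked (markClass k r t)) + #(stale (markClass k r t))) k with hlt | hge
  · rw [phasePotential, if_pos hlt]
    nlinarith
  · have := phasePotential_le hcard hge
    nlinarith

theorem markPotential_zero (hk : 1 ≤ k) (r : ℕ → Fin n) (hC : #C = k) :
    markPotential k (markClass k r 0) C = 0 := by
  have hmarked : marked (markClass k r 0) = ∅ := by simp [marked, markClass]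
  have hstale : stale (markClass k r 0) = ∅ := by simp [stale, markClass]
  simp only [markPotential, phasePotential, hmarked, hstale, empty_union, hC, card_empty,
    if_pos (by lia : 0 + 0 < k), Nat.cast_zero]
  ring

theorem sum_integral_rowCost_zero_le (hk : 1 ≤ k) (hkn : k ≤ n) (l : ℕ) {C : ℕ → Finset (Fin n)}
    {T : ℕ} (hC : ∀ t ≤ T, #(C t) = k) :
    ∑ t ∈ Ioc 0 T, ∫ ω, rowCost k l r (noise n ω) 0 t ∂coinMeasure ≤
      harmonic k * (2 * ∑ t ∈ Ioc 0 T, roundCost (r t) (C t) (C (t - 1)) + k) := by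
  have hpotential : ∑ t ∈ Ioc 0 T, ∫ ω, rowCost k l r (noise n ω) 0 t ∂coinMeasure +
      markPotential k (markClass k r T) (C T) ≤
        2 * harmonic k * ∑ t ∈ Ioc 0 T, roundCost (r t) (C t) (C (t - 1)) := by
    induction T with
    | zero => simp [markPotential_zero hk r (hC 0 le_rfl)]
    | succ t ih =>
      have hround := integral_rowCost_zero_add_markPotential_le (r := r) (D := C (t + 1)) hk hkn l t
        (hC t t.le_succ)
      rw [sum_Ioc_succ_top t.zero_le, sum_Ioc_succ_top t.zero_le, mul_add, Nat.add_sub_cancel]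
      linarith [ih fun s hs => hC s (hs.trans t.le_succ)]
  linarith [neg_le_markPotential hk r T (hC T le_rfl)]

end Marking

/-! ### Reasoning about programs -/

section Memory

variable (s : State)

@[simp] theorem State.nat_setNat (a i v b j : ℕ) :
    (s.setNat a i v).nat b j = if b = a ∧ j = i then v else s.nat b j := by
  rcases eq_or_ne b a with rfl | h
  · simp [State.setNat, Function.update_apply]
  · simp [State.setNat, h]

@[simp] theorem State.real_setNat (a i v : ℕ) : (s.setNat a i v).real = s.real := rfl

@[simp] theorem State.drawn_setNat (a i v : ℕ) : (s.setNat a i v).drawn = s.drawn := rfl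

@[simp] theorem State.real_setReal (a i : ℕ) (v : ℝ) (b j : ℕ) :
    (s.setReal a i v).real b j = if b = a ∧ j = i then v else s.real b j := by
  rcases eq_or_ne b a with rfl | h
  · simp [State.setReal, Function.update_apply]
  · simp [State.setReal, h]

@[simp] theorem State.nat_setReal (a i : ℕ) (v : ℝ) : (s.setReal a i v).nat = s.nat := rfl

@[simp] theorem State.drawn_setReal (a i : ℕ) (v : ℝ) : (s.setReal a i v).drawn = s.drawn := rfl

variable {s} {a b : ℕ}

theorem State.nat_setNat_of_ne (h : b ≠ a) (i v : ℕ) : (s.setNat a i v).nat b = s.nat b :=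
  Function.update_of_ne h ..

theorem State.real_setReal_of_ne (h : b ≠ a) (i : ℕ) (v : ℝ) :
    (s.setReal a i v).real b = s.real b :=
  Function.update_of_ne h ..

end Memory

/-- The arrays of natural numbers into which a program may write. -/
def Program.natWrites : Program → List ℕ
  | skip | realSet .. | sample .. => []
  | natSet a _ _ => [a]
  | seq p q | cond _ p q => p.natWrites ++ q.natWrites
  | loop _ p => p.natWrites

/-- The arrays of real numbers into which a program may write. -/
def Program.realWrites : Program → List ℕ
  | skip | natSet .. => []
  | realSet a _ _ | sample a _ => [a]
  | seq p q | cond _ p q => p.realWrites ++ q.realWrites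
  | loop _ p => p.realWrites

/-- The memories `s` and `s'` agree outside the arrays into which the program `p` may write. -/
structure Frame (p : Program) (s s' : State) : Prop where
  nat_eq : ∀ a ∉ p.natWrites, s'.nat a = s.nat a
  real_eq : ∀ a ∉ p.realWrites, s'.real a = s.real a

section Frame

variable {ω : Coins} {p q : Program} {s s' s'' : State}

theorem Frame.nat (h : Frame p s s') (a : ℕ) (ha : a ∉ p.natWrites := by decide) :
    s'.nat a = s.nat a :=
  h.nat_eq a ha

theorem Frame.real (h : Frame p s s') (a : ℕ) (ha : a ∉ p.realWrites := by decide) :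
    s'.real a = s.real a :=
  h.real_eq a ha

theorem Frame.refl (p : Program) (s : State) : Frame p s s :=
  ⟨fun _ _ => rfl, fun _ _ => rfl⟩

theorem Frame.trans (h : Frame p s s') (h' : Frame p s' s'') : Frame p s s'' :=
  ⟨fun a ha => (h'.nat a ha).trans (h.nat a ha), fun a ha => (h'.real a ha).trans (h.real a ha)⟩

theorem Frame.mono (h : Frame p s s') (hnat : p.natWrites ⊆ q.natWrites)
    (hreal : p.realWrites ⊆ q.realWrites) : Frame q s s' :=
  ⟨fun a ha => h.nat a fun ha' => ha (hnat ha'), fun a ha => h.real a fun ha' => ha (hreal ha')⟩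

theorem frame_setNat {a : ℕ} (ha : a ∈ p.natWrites) (i v : ℕ) : Frame p s (s.setNat a i v) :=
  ⟨fun b hb => s.nat_setNat_of_ne (by rintro rfl; exact hb ha) .., fun _ _ => rfl⟩

theorem Exec.frame {τ : ℕ} (h : Exec ω p s τ s') : Frame p s s' := by
  induction h with
  | skip | loopDone => exact .refl ..
  | natSet s a i e => exact frame_setNat (List.mem_singleton_self a) ..
  | realSet | sample =>
    exact ⟨fun _ _ => rfl, fun b hb => State.real_setReal_of_ne (List.ne_of_not_mem_cons hb) ..⟩
  | seq _ _ ih₁ ih₂ =>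
    exact (ih₁.mono (List.subset_append_left ..) (List.subset_append_left ..)).trans
      (ih₂.mono (List.subset_append_right ..) (List.subset_append_right ..))
  | condTrue _ _ ih => exact ih.mono (List.subset_append_left ..) (List.subset_append_left ..)
  | condFalse _ _ ih => exact ih.mono (List.subset_append_right ..) (List.subset_append_right ..)
  | loopStep _ _ _ ih₁ ih₂ => exact Frame.trans ⟨ih₁.nat_eq, ih₁.real_eq⟩ ih₂

end Frame

/-- The program halts within `B` steps in a memory that satisfies `Q`. -/
def Runs (ω : Coins) (p : Program) (s : State) (B : ℕ) (Q : State → Prop) : Prop :=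
  ∃ τ s', Exec ω p s τ s' ∧ τ ≤ B ∧ Q s'

section Runs

variable {ω : Coins} {p q : Program} {s s' : State} {a B B' : ℕ} {i e : NExp} {x : RExp}
  {b : BExp} {Q R : State → Prop}

theorem Runs.mono (h : Runs ω p s B R) (hB : B ≤ B') (hQ : ∀ s', Frame p s s' → R s' → Q s') :
    Runs ω p s B' Q := by
  obtain ⟨τ, s', hexec, hτ, hR⟩ := h
  exact ⟨τ, s', hexec, hτ.trans hB, hQ s' hexec.frame hR⟩

theorem Runs.le (h : Runs ω p s B Q) (hB : B ≤ B') : Runs ω p s B' Q :=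
  h.mono hB fun _ _ hQ => hQ

theorem Runs.skip (h : Q s) : Runs ω .skip s 1 Q := ⟨1, s, .skip s, le_rfl, h⟩

theorem Runs.natSet (h : Q (s.setNat a (i.eval s) (e.eval s))) :
    Runs ω (.natSet a i e) s (i.cost + e.cost + 1) Q :=
  ⟨_, _, .natSet s a i e, le_rfl, h⟩

theorem Runs.realSet (h : Q (s.setReal a (i.eval s) (x.eval s))) :
    Runs ω (.realSet a i x) s (i.cost + x.cost + 1) Q :=
  ⟨_, _, .realSet s a i x, le_rfl, h⟩

theorem Runs.sample (h : Q { s.setReal a (i.eval s) (ω s.drawn : ℝ) with drawn := s.drawn + 1 }) :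
    Runs ω (.sample a i) s (i.cost + 1) Q :=
  ⟨_, _, .sample s a i, le_rfl, h⟩

theorem Runs.seq (h₁ : Runs ω p s B R)
    (h₂ : ∀ s', Frame p s s' → R s' → Runs ω q s' B' Q) : Runs ω (.seq p q) s (B + B') Q := by
  obtain ⟨τ, s₁, hexec₁, hτ₁, hR⟩ := h₁
  obtain ⟨τ', s₂, hexec₂, hτ₂, hQ⟩ := h₂ s₁ hexec₁.frame hR
  exact ⟨_, s₂, .seq hexec₁ hexec₂, add_le_add hτ₁ hτ₂, hQ⟩

theorem Runs.cond (h₁ : b.holds s → Runs ω p s B Q) (h₂ : ¬ b.holds s → Runs ω q s B' Q) :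
    Runs ω (.cond b p q) s (b.cost + max B B' + 1) Q := by
  by_cases h : b.holds s
  · obtain ⟨τ, s', hexec, hτ, hQ⟩ := h₁ h
    exact ⟨_, s', .condTrue h hexec, by lia, hQ⟩
  · obtain ⟨τ, s', hexec, hτ, hQ⟩ := h₂ h
    exact ⟨_, s', .condFalse h hexec, by lia, hQ⟩

theorem Runs.loop {N : ℕ} (I : ℕ → State → Prop) (h₀ : I 0 s)
    (hb : ∀ j ≤ N, ∀ s, I j s → (b.holds s ↔ j < N))
    (hstep : ∀ j < N, ∀ s, I j s → Runs ω p s B (I (j + 1))) :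
    Runs ω (.loop b p) s (N * (b.cost + B + 1) + (b.cost + 1)) (I N) := by
  suffices h : ∀ d j s, j + d = N → I j s →
      Runs ω (.loop b p) s (d * (b.cost + B + 1) + (b.cost + 1)) (I N) from
    h N 0 s (zero_add N) h₀
  intro d
  induction d with
  | zero =>
    rintro j s rfl hI
    exact ⟨_, s, .loopDone fun h => lt_irrefl _ ((hb j le_rfl s hI).1 h), by lia, hI⟩
  | succ d ih =>
    intro j s hj hI
    obtain ⟨τ, s₁, hexec₁, hτ₁, hI₁⟩ := hstep j (by lia) s hI
    obtain ⟨τ', s₂, hexec₂, hτ₂, hI₂⟩ := ih (j + 1) s₁ (by lia) hI₁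
    exact ⟨_, s₂, .loopStep ((hb j (by lia) s hI).2 (by lia)) hexec₁ hexec₂, by lia, hI₂⟩

end Runs

/-- The number in cell `0` of the array `a`, which serves as a scalar variable. -/
def nvar (a : ℕ) : NExp := .get a (.lit 0)

/-- Assignment to the natural-number variable `a`. -/
def nset (a : ℕ) (e : NExp) : Program := .natSet a (.lit 0) e

/-- The real number in cell `0` of the array `a`, which serves as a scalar variable. -/
def rvar (a : ℕ) : RExp := .get a (.lit 0)

/-- Assignment to the real variable `a`. -/
def rset (a : ℕ) (x : RExp) : Program := .realSet a (.lit 0) x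

/-- Increment of the variable `a`. -/
def incr (a : ℕ) : Program := nset a (.add (nvar a) (.lit 1))

/-- Run `p` with the variable `a` equal to `0`, `1`, …, `e - 1`. -/
def forP (a : ℕ) (e : NExp) (p : Program) : Program :=
  .seq (nset a (.lit 0)) (.loop (.natLt (nvar a) e) (.seq p (incr a)))

section Derived

variable {ω : Coins} {p q : Program} {s : State} {a B : ℕ} {e : NExp} {x : RExp}
  {Q : State → Prop}

theorem Runs.nset (h : Q (s.setNat a 0 (e.eval s))) : Runs ω (nset a e) s (e.cost + 2) Q :=
  (Runs.natSet h).le (by simp only [NExp.cost]; lia)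

theorem Runs.rset (h : Q (s.setReal a 0 (x.eval s))) : Runs ω (rset a x) s (x.cost + 2) Q :=
  (Runs.realSet h).le (by simp only [NExp.cost]; lia)

theorem Runs.natSet_seq {i : NExp} (h : Runs ω q (s.setNat a (i.eval s) (e.eval s)) B Q) :
    Runs ω (.seq (.natSet a i e) q) s (i.cost + e.cost + 1 + B) Q :=
  (Runs.natSet (Q := (· = s.setNat a (i.eval s) (e.eval s))) rfl).seq fun _ _ hs => hs ▸ h

theorem Runs.nset_seq (h : Runs ω q (s.setNat a 0 (e.eval s)) B Q) :
    Runs ω (.seq (Paging.nset a e) q) s (e.cost + 2 + B) Q :=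
  Runs.natSet_seq h |>.le (by simp only [NExp.cost]; lia)

theorem Runs.rset_seq (h : Runs ω q (s.setReal a 0 (x.eval s)) B Q) :
    Runs ω (.seq (Paging.rset a x) q) s (x.cost + 2 + B) Q :=
  (Runs.rset (Q := (· = s.setReal a 0 (x.eval s))) rfl).seq fun _ _ hs => hs ▸ h

theorem Runs.forP {N : ℕ} (I : ℕ → State → Prop) (ha : a ∉ p.natWrites) (h₀ : I 0 s)
    (hI : ∀ i v s', I i s' → I i (s'.setNat a 0 v))
    (hbound : ∀ s', Frame (forP a e p) s s' → e.eval s' = N)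
    (hbody : ∀ i < N, ∀ s', Frame (Paging.forP a e p) s s' → s'.nat a 0 = i → I i s' →
      Runs ω p s' B (I (i + 1))) :
    Runs ω (Paging.forP a e p) s (N * (B + e.cost + 10) + (e.cost + 7)) (I N) := by
  have hwrites : a ∈ (Paging.forP a e p).natWrites := List.mem_cons_self
  have hloop := Runs.loop (ω := ω) (b := .natLt (nvar a) e) (p := .seq p (incr a)) (N := N)
    (B := B + 6) (s := s.setNat a 0 0)
    (fun i s' => Frame (Paging.forP a e p) s s' ∧ s'.nat a 0 = i ∧ I i s')
    ⟨frame_setNat hwrites .., by simp, hI _ _ _ h₀⟩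
    (fun i _ s' ⟨hf, hi, _⟩ => by simp [BExp.holds, nvar, NExp.eval, hi, hbound s' hf])
    (fun i hiN s' ⟨hf, hi, hIi⟩ => (hbody i hiN s' hf hi hIi).seq fun s'' hf' hI' => .nset ?_)
  · exact (hloop.mono le_rfl fun _ _ h => h.2.2).nset_seq.le (by
      simp only [BExp.cost, NExp.cost, nvar]; lia)
  · refine ⟨(hf.trans (hf'.mono ?_ ?_)).trans (frame_setNat hwrites ..), ?_, hI _ _ _ hI'⟩
    · simp [Paging.forP, Program.natWrites]
    · simp [Paging.forP, Program.realWrites]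
    · simp [nvar, NExp.eval, hf'.nat a ha, hi]

end Derived

/-! ### The program -/

/- Natural and real arrays are numbered separately.  Names in `A` stand for arrays that are indexed
by pages or by rows, and names in `V` for arrays of which only cell `0` is used.  The class or count
of page `i` in row `m` is in cell `m * n + i` of `countA`. -/
@[simp] abbrev outputA : ℕ := 1
@[simp] abbrev countA : ℕ := 2
@[simp] abbrev scaleA : ℕ := 3
@[simp] abbrev lengthA : ℕ := 4
@[simp] abbrev ageA : ℕ := 5
@[simp] abbrev rowsV : ℕ := 6
@[simp] abbrev markedV : ℕ := 7
@[simp] abbrev cellV : ℕ := 8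
@[simp] abbrev rankV : ℕ := 9
@[simp] abbrev levelV : ℕ := 10
@[simp] abbrev choiceV : ℕ := 11
@[simp] abbrev rivalV : ℕ := 12
@[simp] abbrev rowV : ℕ := 13
@[simp] abbrev pageV : ℕ := 14
@[simp] abbrev powerV : ℕ := 15
@[simp] abbrev lengthV : ℕ := 16
@[simp] abbrev readyV : ℕ := 17
@[simp] abbrev noiseA : ℕ := 0
@[simp] abbrev thresholdA : ℕ := 1
@[simp] abbrev weightA : ℕ := 2
@[simp] abbrev costV : ℕ := 3
@[simp] abbrev leastV : ℕ := 4
@[simp] abbrev rowCostV : ℕ := 5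
@[simp] abbrev boundV : ℕ := 6
@[simp] abbrev gainV : ℕ := 7
@[simp] abbrev updateV : ℕ := 8

local notation:50 p:51 ";;" q:50 => Program.seq p q

/-- The number of pages. -/
def pagesE : NExp := .get 0 (.lit 0)

/-- The cache size. -/
def sizeE : NExp := .get 0 (.lit 1)

/-- The time horizon. -/
def horizonE : NExp := .get 0 (.lit 2)

/-- The requested page. -/
def requestE : NExp := .get 0 (.lit 3)

/-- The cell of `countA` that belongs to a page in the row `rowV`. -/
def cellE (page : NExp) : NExp := .add (.mul (nvar rowV) pagesE) page

/-- The class or count of a page in the row `rowV`. -/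
def countE (page : NExp) : NExp := .get countA (cellE page)

/-- The score of a page in the row `rowV`. -/
def scoreE (page : NExp) : RExp :=
  .add (.ofNat (countE page)) (.mul (.ofNat (.get scaleA (nvar rowV))) (.get noiseA page))

/-- Disjunction, by De Morgan's law. -/
def orB (b d : BExp) : BExp := .not (.and (.not b) (.not d))

/-- Whether the page `rivalV` comes before the page `pageV` in the ranking of the row `rowV`. -/
def precedesB : BExp :=
  orB (.realLt (scoreE (nvar pageV)) (scoreE (nvar rivalV)))
    (.and (.not (.realLt (scoreE (nvar rivalV)) (scoreE (nvar pageV))))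
      (.natLt (nvar rivalV) (nvar pageV)))

/-- Compute the rank of the page `pageV` in the row `rowV`. -/
def rankP : Program :=
  nset rankV (.lit 0);;
  forP rivalV pagesE (.cond precedesB (incr rankV) .skip)

/-- Compute the rank of the requested page in the row `rowV`. -/
def rankRequestP : Program :=
  nset pageV requestE;;
  rankP

/-- Whether the page of rank `rankV` is in the cache. -/
def cachedB : BExp := .natLt (nvar rankV) sizeE

/-- Assign to the variable `a` the price `c` of a miss, or zero for a hit. -/
def missP (a c : ℕ) : Program :=
  .cond cachedB (rset a (.ofNat (.lit 0))) (rset a (.ofNat (.lit c)))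

/-- Assignment to the class or count of the requested page in the row `rowV`. -/
def setCountP (e : NExp) : Program := .natSet countA (cellE requestE) e

/-- Apply `f` to all classes or counts in the row `rowV`. -/
def mapRowP (f : NExp → NExp) : Program :=
  forP cellV pagesE (.natSet countA (cellE (nvar cellV)) (f (countE (nvar cellV))))

/-- Unless fewer than `k` pages are marked, start a new phase. -/
def phaseP : Program :=
  .cond (.natLt (nvar markedV) sizeE) .skip (mapRowP (.sub · (.lit 2));; nset markedV (.lit 0))

/-- The step of the marking algorithm. -/
def markStepP : Program :=
  .cond (.natLt (countE requestE) (.lit 4)) (phaseP;; setCountP (.lit 4);; incr markedV) .skip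

/-- The round of row `0`. -/
def markP : Program :=
  nset rowV (.lit 0);;
  rankRequestP;;
  missP costV 1;;
  markStepP

/-- The costs and the counts of the row `rowV` at the start of a block. -/
def restartP : Program :=
  rset rowCostV (.ofNat (.add sizeE (.lit 2)));;
  rset boundV (.ofNat (.mul (.lit 5) sizeE));;
  mapRowP fun _ => .lit 0

/-- The costs and the counts of the row `rowV` inside a block. -/
def countRequestP : Program :=
  missP rowCostV 2;;
  rset boundV (.ofNat (.lit 3));;
  setCountP (.add (countE requestE) (.lit 1))

/-- The costs and the counts of the row `rowV`, if `rankV` is the rank of the requested page. -/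
def countP : Program :=
  .cond (.natLt (.get ageA (nvar rowV)) (.lit 1)) restartP countRequestP

/-- The costs and the counts of the row `rowV`. -/
def rankCountP : Program :=
  rankRequestP;;
  countP

/-- One as a real number. -/
def oneE : RExp := .ofNat (.lit 1)

/-- The gain of the row `rowV` over the lower rows. -/
def gainE : RExp :=
  .sub (rvar costV) (.add (rvar rowCostV)
    (.mul (.div oneE (.ofNat (.mul (.lit 10) (.get scaleA (nvar rowV))))) (rvar boundV)))

/-- The updated weight of the row `rowV`, before it is clipped. -/
def updateE : RExp :=
  .div (.get weightA (nvar rowV)) (.sub oneE (.mul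
    (.div oneE (.ofNat (.mul (.mul (.lit 10) sizeE) (.get scaleA (nvar rowV))))) (rvar gainV)))

/-- Clip `updateV` to the interval from `leastV` to `1`. -/
def clipP : Program :=
  .cond (.realLt oneE (rvar updateV)) (rset updateV oneE) .skip;;
  .cond (.realLt (rvar updateV) (rvar leastV)) (rset updateV (rvar leastV)) .skip

/-- Update the weight of the row `rowV` and the cost of the combination of the rows. -/
def weightP : Program :=
  rset gainV gainE;;
  rset updateV updateE;;
  clipP;;
  .realSet weightA (nvar rowV) (rvar updateV);;
  rset costV (.sub (rvar costV) (.mul (rvar updateV) (rvar gainV)))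

/-- Prefer the row `rowV` to the lower rows if its weight exceeds its threshold. -/
def chooseP : Program :=
  .cond (.realLt (.get thresholdA (nvar rowV)) (.get weightA (nvar rowV)))
    (nset choiceV (nvar rowV)) .skip

/-- Advance the position of the row `rowV` in its block. -/
def ageP : Program :=
  .cond (.natLt (.add (.get ageA (nvar rowV)) (.lit 1)) (.get lengthA (nvar rowV)))
    (.natSet ageA (nvar rowV) (.add (.get ageA (nvar rowV)) (.lit 1)))
    (.natSet ageA (nvar rowV) (.lit 0))

/-- The round of the row `rowV`, if it is not row `0`. -/
def rowP : Program :=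
  rankCountP;;
  weightP;;
  chooseP;;
  ageP

/-- The rounds of the rows other than row `0`. -/
def rowsP : Program :=
  nset choiceV (.lit 0);;
  forP levelV (nvar rowsV) (nset rowV (.add (nvar levelV) (.lit 1));; rowP)

/-- Write the cache of the chosen row. -/
def outputP : Program :=
  nset rowV (nvar choiceV);;
  forP pageV pagesE (rankP;;
    .cond cachedB (.natSet outputA (nvar pageV) (.lit 1)) (.natSet outputA (nvar pageV) (.lit 0)))

/-- Compute the number of rows and the least weight. -/
def initSizeP : Program :=
  nset rowsV (.lit 0);;
  nset powerV (.lit 1);;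
  .loop (.natLt (nvar powerV) (.mul pagesE horizonE))
    (nset powerV (.add (nvar powerV) (nvar powerV));; incr rowsV);;
  rset leastV (.div oneE (.ofNat (.mul (nvar powerV) (nvar powerV))))

/-- Draw samples and store them in the first `e` cells of the array `a`. -/
def sampleP (a : ℕ) (e : NExp) : Program := forP cellV e (.sample a (nvar cellV))

/-- Draw the noise and the thresholds, and initialize the weights. -/
def initSampleP : Program :=
  sampleP noiseA pagesE;;
  sampleP thresholdA (.add (nvar rowsV) (.lit 1));;
  forP cellV (.add (nvar rowsV) (.lit 1)) (.realSet weightA (nvar cellV) (rvar leastV))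

/-- Compute the sizes of the noise and the lengths of the blocks. -/
def initScaleP : Program :=
  nset powerV (.lit 1);;
  nset lengthV (nvar rowsV);;
  forP cellV (.add (nvar rowsV) (.lit 1))
    (.natSet scaleA (.sub (nvar rowsV) (nvar cellV)) (nvar powerV);;
      .natSet lengthA (.sub (nvar rowsV) (nvar cellV)) (nvar lengthV);;
      nset powerV (.add (nvar powerV) (nvar powerV));;
      nset lengthV (.mul (nvar lengthV) (.lit 4)));;
  .natSet scaleA (.lit 0) (.lit 1)

/-- The initialization. -/
def initP : Program :=
  initSizeP;;
  initSampleP;;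
  initScaleP;;
  nset readyV (.lit 1)

/-- The paging algorithm: the lower rows are combined with the next row, one row after another. -/
def pagingP : Program :=
  .cond (.natLt (nvar readyV) (.lit 1)) initP .skip;;
  markP;;
  rowsP;;
  outputP

/-! ### Correctness of the parts of a round -/

attribute [local simp] NExp.eval RExp.eval BExp.holds NExp.cost RExp.cost BExp.cost nvar rvar
  pagesE sizeE horizonE requestE oneE

theorem card_filter_val_lt_succ {n i : ℕ} (P : Fin n → Prop) [DecidablePred P] (hi : i < n) :
    #{j : Fin n | j < i + 1 ∧ P j} = #{j : Fin n | j < i ∧ P j} + if P ⟨i, hi⟩ then 1 else 0 := by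
  have hsucc : univ.filter (fun j : Fin n => (j : ℕ) < i + 1) =
      insert ⟨i, hi⟩ (univ.filter fun j : Fin n => (j : ℕ) < i) := by
    ext j; simp [Fin.ext_iff]; lia
  rw [← filter_filter, ← filter_filter, hsucc, filter_insert]
  split_ifs with h
  · exact card_insert_of_notMem (by simp)
  · rfl

/-- The table of classes and counts. -/
def State.table (s : State) (n : ℕ) (m : ℕ) (i : Fin n) : ℕ := s.nat countA (m * n + i)

/-- The scores of the pages in the row in `rowV`. -/
noncomputable def State.scores (s : State) (n : ℕ) : Fin n → ℝ :=
  score (s.table n (s.nat rowV 0)) (s.nat scaleA (s.nat rowV 0)) fun i => s.real noiseA i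

section Parts

variable {n k : ℕ} {ω : Coins} {p : Program} {s s' : State} {e : NExp} {i : Fin n} {a c m : ℕ}

theorem cell_eq_iff {a b : ℕ} {i j : Fin n} : a * n + i = b * n + j ↔ a = b ∧ i = j := by
  refine ⟨fun h => ?_, fun ⟨ha, hi⟩ => by rw [ha, hi]⟩
  have hn : 0 < n := i.pos
  have hquot := congrArg (· / n) h
  have hrem := congrArg (· % n) h
  simp only [mul_comm _ n, Nat.mul_add_div hn, Nat.div_eq_of_lt (Fin.is_lt _), add_zero] at hquot
  simp only [mul_comm _ n, Nat.mul_add_mod, Nat.mod_eq_of_lt (Fin.is_lt _)] at hrem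
  exact ⟨hquot, Fin.ext hrem⟩

theorem State.table_setNat_countA (s : State) (m : ℕ) (i : Fin n) (v : ℕ) :
    (s.setNat countA (m * n + i) v).table n =
      Function.update (s.table n) m (Function.update (s.table n m) i v) := by
  funext b j
  rcases eq_or_ne b m with rfl | hb
  · simp [State.table, Function.update_apply, Fin.ext_iff]
  · simp [State.table, hb, cell_eq_iff]

theorem State.table_setNat_of_ne (s : State) (ha : a ≠ countA) (i v : ℕ) :
    (s.setNat a i v).table n = s.table n := by
  unfold State.table; rw [s.nat_setNat_of_ne ha.symm]

theorem Frame.table (h : Frame p s s') (hp : countA ∉ p.natWrites := by decide) :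
    s'.table n = s.table n := by
  unfold State.table; rw [h.nat _ hp]

theorem Frame.scores (h : Frame p s s') (hcount : countA ∉ p.natWrites := by decide)
    (hrow : rowV ∉ p.natWrites := by decide) (hscale : scaleA ∉ p.natWrites := by decide)
    (hnoise : noiseA ∉ p.realWrites := by decide) : s'.scores n = s.scores n := by
  unfold State.scores
  rw [h.table hcount, h.nat _ hrow, h.nat _ hscale, h.real _ hnoise]

theorem eval_cellE (hn : s.nat 0 0 = n) (hrow : s.nat rowV 0 = m) (he : e.eval s = i) :
    (cellE e).eval s = m * n + i := by
  simp [cellE, hn, hrow, he]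

theorem eval_countE (hn : s.nat 0 0 = n) (hrow : s.nat rowV 0 = m) (he : e.eval s = i) :
    (countE e).eval s = s.table n m i :=
  congrArg _ (eval_cellE hn hrow he)

theorem eval_scoreE (hn : s.nat 0 0 = n) (he : e.eval s = i) :
    (scoreE e).eval s = s.scores n i := by
  simp [scoreE, State.scores, score, eval_countE hn rfl he, he]

theorem holds_orB {b d : BExp} : (orB b d).holds s ↔ b.holds s ∨ d.holds s := by
  simp only [orB, BExp.holds, not_and_or, not_not]

theorem holds_precedesB {j : Fin n} (hn : s.nat 0 0 = n) (hi : s.nat pageV 0 = i)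
    (hj : s.nat rivalV 0 = j) :
    precedesB.holds s ↔ rankKey (s.scores n) j < rankKey (s.scores n) i := by
  rw [rankKey_lt_rankKey]
  have hpage := eval_scoreE (e := nvar pageV) hn hi
  have hrival := eval_scoreE (e := nvar rivalV) hn hj
  simp only [precedesB, holds_orB, BExp.holds, hpage, hrival]
  simp only [nvar, NExp.eval, hi, hj, Fin.val_fin_lt]

theorem runs_rankP (hn : s.nat 0 0 = n) (hi : s.nat pageV 0 = i) :
    Runs ω rankP s (150 * (n + 1)) fun s' => s'.nat rankV 0 = rank (s.scores n) i := by
  let I (b : ℕ) (s' : State) : Prop :=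
    s'.nat rankV 0 = #{j : Fin n | j < b ∧ rankKey (s.scores n) j < rankKey (s.scores n) i}
  refine ((Runs.forP (N := n) (B := 120) I (by decide) (by simp [I]) ?_ ?_ ?_).nset_seq).mono
    ?_ fun s' _ h => ?_
  · simp +contextual [I]
  · intro s' hf
    simpa [hf.nat 0] using hn
  · intro b hb s' hf hrival hI
    have hs : s'.scores n = s.scores n := by
      rw [hf.scores]; simp [State.scores, s.table_setNat_of_ne]
    have hholds := holds_precedesB (s := s') (n := n) (i := i) (j := ⟨b, hb⟩)
      (by rw [hf.nat 0]; simpa using hn) (by rw [hf.nat pageV]; simpa using hi) hrival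
    rw [hs] at hholds
    refine (Runs.cond (fun h => .nset ?_) fun h => .skip ?_).le ?_
    · simp only [I]
      rw [card_filter_val_lt_succ _ hb, if_pos (hholds.1 h), ← hI]
      simp
    · simp only [I]
      rw [card_filter_val_lt_succ _ hb, if_neg (mt hholds.2 h), ← hI, add_zero]
    · simp [precedesB, orB, scoreE, countE, cellE]
  · simp
    lia
  · simpa [I, rank] using h

theorem runs_rankRequestP (hn : s.nat 0 0 = n) (hi : s.nat 0 3 = i) :
    Runs ω rankRequestP s (150 * (n + 1) + 4) fun s' => s'.nat rankV 0 = rank (s.scores n) i := by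
  refine ((runs_rankP (n := n) (i := i) ?_ ?_).nset_seq).mono ?_ fun s' _ h => ?_
  · simpa using hn
  · simpa using hi
  · simp
    lia
  · rwa [show State.scores _ n = s.scores n by simp [State.scores, s.table_setNat_of_ne]] at h

theorem runs_missP (hk : s.nat 0 1 = k) (hrank : s.nat rankV 0 = rank (s.scores n) i) :
    Runs ω (missP a c) s 10 fun s' =>
      s'.real a 0 = if i ∈ top k (s.scores n) then 0 else (c : ℝ) := by
  have hcached : cachedB.holds s ↔ i ∈ top k (s.scores n) := by simp [cachedB, hk, hrank, mem_top]
  refine (Runs.cond (fun h => .rset ?_) fun h => .rset ?_).le ?_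
  · simp [hcached.1 h]
  · simp [mt hcached.2 h]
  · simp [cachedB]

theorem runs_setCountP (hn : s.nat 0 0 = n) (hi : s.nat 0 3 = i) (hrow : s.nat rowV 0 = m) :
    Runs ω (setCountP e) s (e.cost + 20) fun s' => s'.table n =
      Function.update (s.table n) m (Function.update (s.table n m) i (e.eval s)) := by
  refine (Runs.natSet ?_).le ?_
  · rw [eval_cellE hn hrow (by simpa using hi), s.table_setNat_countA]
  · simp [cellE]
    lia

theorem runs_mapRowP {f : NExp → NExp} {g : ℕ → ℕ} {B : ℕ} (hn : s.nat 0 0 = n)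
    (hrow : s.nat rowV 0 = m) (hf : ∀ s e, (f e).eval s = g (e.eval s))
    (hcost : (f (countE (nvar cellV))).cost ≤ B) :
    Runs ω (mapRowP f) s ((n + 1) * (B + 30)) fun s' => s'.table n =
      Function.update (s.table n) m (g ∘ s.table n m) := by
  let I (b : ℕ) (s' : State) : Prop := s'.table n =
    Function.update (s.table n) m fun j => if j < b then g (s.table n m j) else s.table n m j
  have hwrites (a : ℕ) (ha : a ∉ [cellV, countA, cellV]) : a ∉ (mapRowP f).natWrites := ha
  refine (Runs.forP (N := n) (B := B + 12) I ?_ (by simp [I]) ?_ ?_ ?_).mono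
    ?_ fun s' _ h => ?_
  · simp [Program.natWrites]
  · intro b v s' hI
    simpa [I, s'.table_setNat_of_ne] using hI
  · intro s' hs
    simpa [hs.nat 0 (hwrites _ (by decide))] using hn
  · intro b hb s' hs hcell hI
    have hn' : s'.nat 0 0 = n := by rw [hs.nat 0 (hwrites _ (by decide)), hn]
    have hrow' : s'.nat rowV 0 = m := by rw [hs.nat rowV (hwrites _ (by decide)), hrow]
    have hpage : (nvar cellV).eval s' = (⟨b, hb⟩ : Fin n) := by simpa using hcell
    refine (Runs.natSet ?_).le ?_
    · rw [eval_cellE hn' hrow' hpage, hf, eval_countE hn' hrow' hpage]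
      simp only [I] at hI ⊢
      rw [s'.table_setNat_countA m (⟨b, hb⟩ : Fin n), hI]
      funext b' j
      rcases eq_or_ne b' m with rfl | hb'
      · simp [Function.update_apply, Fin.ext_iff]
        grind
      · simp [hb']
    · have hcell : (cellE (nvar cellV)).cost = 8 := rfl
      lia
  · simp only [pagesE, NExp.cost]
    lia
  · simpa [I, Function.comp_def] using h

end Parts

section Rounds

variable {n k len t : ℕ} {ω : Coins} {s : State} {i : Fin n} {r : ℕ → Fin n} {m : ℕ}

theorem runs_phaseP (hn : s.nat 0 0 = n) (hk : s.nat 0 1 = k) (hrow : s.nat rowV 0 = 0)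
    (hmarked : s.nat markedV 0 = #(marked (s.table n 0))) (hle : ∀ j, s.table n 0 j ≤ 4)
    (hi : i ∉ marked (s.table n 0)) :
    Runs ω phaseP s (50 * (n + 1)) fun s' =>
      Function.update (s'.table n) 0 (Function.update (s'.table n 0) i 4) =
        Function.update (s.table n) 0 (markStep k i (s.table n 0)) ∧
      s'.nat markedV 0 + 1 = #(marked (markStep k i (s.table n 0))) := by
  refine (Runs.cond (B' := (n + 1) * 41 + 3) (fun hlt => .skip ?_) fun hge => ?_).le ?_
  · have hlt : #(marked (s.table n 0)) < k := by simpa [hmarked, hk] using hlt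
    rw [marked_markStep_of_lt hi hlt, card_insert_of_notMem hi, markStep_of_lt hi hlt, hmarked]
    exact ⟨rfl, rfl⟩
  · have hge : k ≤ #(marked (s.table n 0)) := by simpa [hmarked, hk] using hge
    refine (runs_mapRowP (g := (· - 2)) (B := 11) hn hrow (fun _ _ => rfl) le_rfl).seq
      fun s₁ _ htable => .nset (e := .lit 0) ?_
    rw [marked_markStep_of_le hi hge hle, markStep_of_le hi hge]
    simp [s₁.table_setNat_of_ne, htable, Function.comp_def]
  · simp
    lia

theorem runs_markStepP (hn : s.nat 0 0 = n) (hk : s.nat 0 1 = k) (hi : s.nat 0 3 = i)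
    (hrow : s.nat rowV 0 = 0) (hmarked : s.nat markedV 0 = #(marked (s.table n 0)))
    (hle : ∀ j, s.table n 0 j ≤ 4) :
    Runs ω markStepP s (100 * (n + 1)) fun s' =>
      s'.table n = Function.update (s.table n) 0 (markStep k i (s.table n 0)) ∧
      s'.nat markedV 0 = #(marked (markStep k i (s.table n 0))) := by
  have htest : (BExp.natLt (countE requestE) (.lit 4)).holds s ↔ i ∉ marked (s.table n 0) := by
    have hcount := eval_countE (e := requestE) hn hrow (by simpa using hi)
    simp only [BExp.holds, hcount, NExp.eval, mem_marked]
    exact (hle i).lt_iff_ne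
  refine (Runs.cond (B := 50 * (n + 1) + (21 + 6)) (fun hlt => ?_) fun hge => .skip ?_).le ?_
  · refine (runs_phaseP hn hk hrow hmarked hle (htest.1 hlt)).seq fun s₁ hs₁ ⟨htable, hcard⟩ =>
      (runs_setCountP (i := i) (m := 0) ?_ ?_ ?_).seq fun s₂ hs₂ htable₂ => .nset ?_
    · rw [hs₁.nat 0, hn]
    · rw [hs₁.nat 0, hi]
    · rw [hs₁.nat rowV, hrow]
    · rw [s₂.table_setNat_of_ne (by decide), htable₂, ← hcard]
      exact ⟨htable, by simp [hs₂.nat markedV]⟩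
  · have hmem : i ∈ marked (s.table n 0) := not_not.1 (mt htest.2 hge)
    simp [markStep_of_mem hmem, hmarked]
  · simp [countE, cellE]
    lia

theorem runs_restartP (hn : s.nat 0 0 = n) (hk : s.nat 0 1 = k) (hrow : s.nat rowV 0 = m) :
    Runs ω restartP s (50 * (n + 1)) fun s' =>
      s'.table n = Function.update (s.table n) m (fun _ => 0) ∧
      s'.real rowCostV 0 = k + 2 ∧ s'.real boundV 0 = 5 * k := by
  refine Runs.le (.rset_seq (.rset_seq ((runs_mapRowP (n := n) (m := m) (g := fun _ => 0) (B := 1)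
    ?_ ?_ (fun _ _ => rfl) le_rfl).mono le_rfl fun s' hs' h => ⟨h, ?_, ?_⟩))) ?_
  · simpa using hn
  · simpa using hrow
  · rw [hs'.real rowCostV]
    simp [hk]
  · rw [hs'.real boundV]
    simp [hk]
  · simp
    lia

theorem runs_countRequestP (hn : s.nat 0 0 = n) (hk : s.nat 0 1 = k) (hi : s.nat 0 3 = i)
    (hrow : s.nat rowV 0 = m) (hrank : s.nat rankV 0 = rank (s.scores n) i) :
    Runs ω countRequestP s 100 fun s' => s'.table n = Function.update (s.table n) m
        (Function.update (s.table n m) i (s.table n m i + 1)) ∧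
      s'.real rowCostV 0 = (if i ∈ top k (s.scores n) then 0 else 2) ∧
      s'.real boundV 0 = 3 := by
  refine ((runs_missP hk hrank).seq fun s₁ hs₁ hmiss => .rset_seq <|
    (runs_setCountP (i := i) (m := m) ?_ ?_ ?_).mono le_rfl fun s' hs' h => ⟨?_, ?_, ?_⟩).le ?_
  · simpa [hs₁.nat 0] using hn
  · simpa [hs₁.nat 0] using hi
  · simpa [hs₁.nat rowV] using hrow
  · simp [countE, cellE]
  · set s₂ := s₁.setReal boundV 0 ((RExp.ofNat (.lit 3)).eval s₁) with hs₂
    have htable : s₂.table n = s.table n := hs₁.table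
    have hcount : (countE requestE).eval s₂ = s.table n m i := by
      rw [← htable]
      refine eval_countE ?_ ?_ ?_
      · simpa [hs₂, hs₁.nat 0] using hn
      · simpa [hs₂, hs₁.nat rowV] using hrow
      · simpa [hs₂, hs₁.nat 0] using hi
    rwa [show NExp.eval _ (.add (countE requestE) (.lit 1)) = s.table n m i + 1 from
      congrArg (· + 1) hcount, htable] at h
  · rw [hs'.real rowCostV]
    simpa using hmiss
  · rw [hs'.real boundV]
    simp

theorem runs_countP (hn : s.nat 0 0 = n) (hk : s.nat 0 1 = k) (hi : s.nat 0 3 = r (t + 1))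
    (hrow : s.nat rowV 0 = m) (hrank : s.nat rankV 0 = rank (s.scores n) (r (t + 1)))
    (hage : s.nat ageA m = t % len) (htable : s.table n m = counts len r t) :
    Runs ω countP s (200 * (n + 1)) fun s' =>
      s'.table n = Function.update (s.table n) m (counts len r (t + 1)) ∧
      s'.real rowCostV 0 = (if t % len = 0 then (k : ℝ) + 2
        else if r (t + 1) ∈ top k (s.scores n) then 0 else 2) ∧
      s'.real boundV 0 = if t % len = 0 then 5 * (k : ℝ) else 3 := by
  have htest : (BExp.natLt (.get ageA (nvar rowV)) (.lit 1)).holds s ↔ t % len = 0 := by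
    simp [hrow, hage]
  refine (Runs.cond (fun h => (runs_restartP hn hk hrow).mono le_rfl fun s' _ h' => ?_) fun h =>
    (runs_countRequestP hn hk hi hrow hrank).mono le_rfl fun s' _ h' => ?_).le ?_
  · simpa only [counts, if_pos (htest.1 h)] using h'
  · simpa only [counts, if_neg (mt htest.2 h), ← htable] using h'
  · simp
    lia

theorem runs_clipP {ε x : ℝ} (hleast : s.real leastV 0 = ε) (hx : s.real updateV 0 = x) :
    Runs ω clipP s 30 fun s' => s'.real updateV 0 = max ε (min 1 x) := by
  refine ((Runs.cond (Q := fun s' => s'.real updateV 0 = min 1 x) (fun h => .rset ?_) fun h =>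
    .skip ?_).seq fun s₁ hs₁ hmin => .cond (fun h => .rset ?_) fun h => .skip ?_).le ?_
  · have h : 1 < x := by simpa [hx] using h
    simp [h.le]
  · have h : x ≤ 1 := by simpa [hx] using h
    simp [hx, h]
  · have h : min 1 x < ε := by simpa [hmin, hs₁.real leastV, hleast] using h
    simp [h.le, hs₁.real leastV, hleast]
  · have h : ε ≤ min 1 x := by
      simpa only [BExp.holds, RExp.eval, rvar, NExp.eval, hmin, hs₁.real leastV, hleast,
        not_lt] using h
    rw [hmin, max_eq_right h]
  · simp

theorem eval_gainE {h : ℕ} {p q G : ℝ} (hrow : s.nat rowV 0 = m) (hscale : s.nat scaleA m = h)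
    (hcost : s.real costV 0 = p) (hrowCost : s.real rowCostV 0 = q)
    (hbound : s.real boundV 0 = G) :
    gainE.eval s = p - (q + 1 / (10 * h) * G) := by
  simp [gainE, hrow, hscale, hcost, hrowCost, hbound]

theorem eval_updateE {h : ℕ} {g : ℝ} (hk : s.nat 0 1 = k) (hrow : s.nat rowV 0 = m)
    (hscale : s.nat scaleA m = h) (hgain : s.real gainV 0 = g) :
    updateE.eval s = s.real weightA m / (1 - 1 / (10 * k * h) * g) := by
  simp [updateE, hk, hrow, hscale, hgain]

theorem runs_weightP {h : ℕ} {ε p q G g w : ℝ} (hk : s.nat 0 1 = k) (hrow : s.nat rowV 0 = m)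
    (hscale : s.nat scaleA m = h) (hleast : s.real leastV 0 = ε) (hcost : s.real costV 0 = p)
    (hrowCost : s.real rowCostV 0 = q) (hbound : s.real boundV 0 = G)
    (hg : g = p - (q + 1 / (10 * h) * G))
    (hw : w = weightStep (1 / (10 * k * h)) ε (s.real weightA m) g) :
    Runs ω weightP s 200 fun s' =>
      s'.real weightA = Function.update (s.real weightA) m w ∧ s'.real costV 0 = p - w * g := by
  have hgain : gainE.eval s = g := hg ▸ eval_gainE hrow hscale hcost hrowCost hbound
  have hupdate := eval_updateE (g := g) (s := s.setReal gainV 0 g) hk hrow hscale (by simp)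
  refine (Runs.rset_seq <| Runs.rset_seq <| (runs_clipP (by simpa using hleast) rfl).seq
    (B' := 20) fun s₁ hs₁ hclip => ?_).le ?_
  · have hclip : s₁.real updateV 0 = w := by
      simpa [hgain, hupdate, hw, weightStep] using hclip
    have hweight : s₁.real weightA = s.real weightA := by rw [hs₁.real weightA]; rfl
    refine ((Runs.realSet (Q := (· = s₁.setReal weightA m w)) ?_).seq
      fun s₂ _ h₂ => .rset ?_).le ?_
    · simp [hs₁.nat rowV, hrow, hclip]
    · subst h₂
      simp [hclip, hs₁.real costV, hs₁.real gainV, hcost, hgain, State.setReal, hweight]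
    · simp
  · simp [gainE, updateE]

theorem runs_chooseP (hrow : s.nat rowV 0 = m) :
    Runs ω chooseP s 15 fun s' => s'.nat choiceV 0 =
      if s.real thresholdA m < s.real weightA m then m else s.nat choiceV 0 := by
  refine (Runs.cond (fun h => .nset ?_) fun h => .skip ?_).le ?_
  · simp only [BExp.holds, RExp.eval, nvar, NExp.eval, hrow] at h
    simp [h, hrow]
  · simp only [BExp.holds, RExp.eval, nvar, NExp.eval, hrow] at h
    simp [h]
  · simp

theorem succ_mod_eq (hlen : 0 < len) (t : ℕ) :
    (t + 1) % len = if t % len + 1 < len then t % len + 1 else 0 := by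
  rw [← Nat.mod_add_mod]
  split_ifs with h
  · exact Nat.mod_eq_of_lt h
  · rw [show t % len + 1 = len from
      le_antisymm (Nat.mod_lt t hlen) (not_lt.1 h), Nat.mod_self]

theorem runs_ageP (hrow : s.nat rowV 0 = m) (hlength : s.nat lengthA m = len) (hlen : 0 < len)
    (hage : s.nat ageA m = t % len) :
    Runs ω ageP s 25 fun s' =>
      s'.nat ageA = Function.update (s.nat ageA) m ((t + 1) % len) := by
  rw [succ_mod_eq hlen]
  refine (Runs.cond (fun h => .natSet ?_) fun h => .natSet ?_).le ?_
  · have h : t % len + 1 < len := by simpa [hrow, hlength, hage] using h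
    simp [State.setNat, hrow, hage, h]
  · have h : ¬ t % len + 1 < len := by simpa [hrow, hlength, hage] using h
    simp [State.setNat, hrow, h]
  · simp

end Rounds

/-! ### Correctness of a round -/

/-- The part of the memory that does not change after the initialization is as intended. -/
structure Initialized (n k l : ℕ) (ω : Coins) (s : State) : Prop where
  pages : s.nat 0 0 = n
  size : s.nat 0 1 = k
  ready : s.nat readyV 0 = 1
  rows : s.nat rowsV 0 = l
  scale : ∀ m ≤ l, s.nat scaleA m = rowScale l m
  length : ∀ m ≤ l, s.nat lengthA m = blockLength l m
  noise : ∀ i < n, s.real noiseA i = ω i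
  threshold : ∀ m ≤ l, s.real thresholdA m = ω (n + m)
  least : s.real leastV 0 = minWeight l

/-- The number of rounds that row `a` has completed when in round `t + 1` exactly the rows
`0, …, m - 1` have been processed. -/
def progress (t m a : ℕ) : ℕ := if a < m then t + 1 else t

/-- The memory in round `t + 1` when exactly the rows `0, …, m - 1` have been processed. -/
structure Ready {n : ℕ} (k l : ℕ) (r : ℕ → Fin n) (ω : Coins) (t m : ℕ) (s : State) : Prop
    extends Initialized n k l ω s where
  counts : ∀ a ≤ l, s.table n a = rowCounts k l r a (progress t m a)
  age : ∀ a ≤ l, a ≠ 0 → s.nat ageA a = progress t m a % blockLength l a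
  weight : ∀ a ≤ l, a ≠ 0 →
    s.real weightA a = rowWeight k l r (Paging.noise n ω) a (progress t m a)
  numMarked : s.nat markedV 0 = #(marked (markClass k r (progress t m 0)))

/-- The memory in round `t + 1` when exactly the rows `0, …, m` have been processed, including the
variables that are only used within a round. -/
structure Processing {n : ℕ} (k l : ℕ) (r : ℕ → Fin n) (ω : Coins) (t m : ℕ) (s : State) : Prop
    extends Ready k l r ω t (m + 1) s where
  request : s.nat 0 3 = r (t + 1)
  cost : s.real costV 0 = levelCost k l r (Paging.noise n ω) m (t + 1)
  choice : s.nat choiceV 0 = selected k l r ω m (t + 1)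

section Round

variable {n k l t m a : ℕ} {r : ℕ → Fin n} {ω : Coins} {p : Program} {s s' : State}

theorem progress_self : progress t m m = t := if_neg (lt_irrefl m)

theorem progress_succ_self : progress t (m + 1) m = t + 1 := if_pos m.lt_succ_self

theorem progress_succ_of_ne (h : a ≠ m) : progress t (m + 1) a = progress t m a := by
  unfold progress
  congr 1
  lia

theorem Initialized.frame (h : Initialized n k l ω s) (hf : Frame p s s')
    (hnat : ∀ a ∈ [0, readyV, rowsV, scaleA, lengthA], a ∉ p.natWrites := by decide)
    (hreal : ∀ a ∈ [noiseA, thresholdA, leastV], a ∉ p.realWrites := by decide) :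
    Initialized n k l ω s' where
  pages := by rw [hf.nat 0 (hnat _ (by simp)), h.pages]
  size := by rw [hf.nat 0 (hnat _ (by simp)), h.size]
  ready := by rw [hf.nat readyV (hnat _ (by simp)), h.ready]
  rows := by rw [hf.nat rowsV (hnat _ (by simp)), h.rows]
  scale := by simpa only [hf.nat scaleA (hnat _ (by simp))] using h.scale
  length := by simpa only [hf.nat lengthA (hnat _ (by simp))] using h.length
  noise := by simpa only [hf.real noiseA (hreal _ (by simp))] using h.noise
  threshold := by simpa only [hf.real thresholdA (hreal _ (by simp))] using h.threshold
  least := by rw [hf.real leastV (hreal _ (by simp)), h.least]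

theorem Ready.frame (h : Ready k l r ω t m s) (hf : Frame p s s')
    (hnat : ∀ a ∈ [0, readyV, rowsV, scaleA, lengthA, countA, ageA, markedV],
      a ∉ p.natWrites := by decide)
    (hreal : ∀ a ∈ [noiseA, thresholdA, leastV, weightA], a ∉ p.realWrites := by decide) :
    Ready k l r ω t m s' where
  __ := h.toInitialized.frame hf (fun a ha => hnat a (by simp_all; lia))
    fun a ha => hreal a (by simp_all; lia)
  counts := by simpa only [hf.table (hnat _ (by simp))] using h.counts
  age := by simpa only [hf.nat ageA (hnat _ (by simp))] using h.age
  weight := by simpa only [hf.real weightA (hreal _ (by simp))] using h.weight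
  numMarked := by rw [hf.nat markedV (hnat _ (by simp)), h.numMarked]

theorem Processing.frame (h : Processing k l r ω t m s) (hf : Frame p s s')
    (hnat : ∀ a ∈ [0, readyV, rowsV, scaleA, lengthA, countA, ageA, markedV, choiceV],
      a ∉ p.natWrites := by decide)
    (hreal : ∀ a ∈ [noiseA, thresholdA, leastV, weightA, costV], a ∉ p.realWrites := by decide) :
    Processing k l r ω t m s' where
  __ := h.toReady.frame hf (fun a ha => hnat a (by simp_all; lia))
    fun a ha => hreal a (by simp_all; lia)
  request := by rw [hf.nat 0 (hnat _ (by simp)), h.request]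
  cost := by rw [hf.real costV (hreal _ (by simp)), h.cost]
  choice := by rw [hf.nat choiceV (hnat _ (by simp)), h.choice]

theorem Ready.scores (h : Ready k l r ω t m s) (ha : a ≤ l) (hrow : s.nat rowV 0 = a) :
    s.scores n = score (rowCounts k l r a (progress t m a)) (rowScale l a) (noise n ω) := by
  unfold State.scores
  rw [hrow, h.counts a ha, h.scale a ha]
  congr 1
  exact funext fun i => h.noise i i.2

theorem Ready.row_zero (h : Ready k l r ω t 0 s) (h' : Initialized n k l ω s')
    (htable : s'.table n = Function.update (s.table n) 0 (markClass k r (t + 1)))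
    (hmarked : s'.nat markedV 0 = #(marked (markClass k r (t + 1))))
    (hage : s'.nat ageA = s.nat ageA) (hweight : s'.real weightA = s.real weightA) :
    Ready k l r ω t 1 s' where
  __ := h'
  counts a ha := by
    rw [htable]
    rcases eq_or_ne a 0 with rfl | ha₀
    · rw [Function.update_self, progress_succ_self, rowCounts, if_pos rfl]
    · rw [Function.update_of_ne ha₀, progress_succ_of_ne ha₀, h.counts a ha]
  age a ha ha₀ := by rw [hage, progress_succ_of_ne ha₀, h.age a ha ha₀]
  weight a ha ha₀ := by rw [hweight, progress_succ_of_ne ha₀, h.weight a ha ha₀]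
  numMarked := by rw [hmarked, progress_succ_self]

theorem Ready.row (h : Ready k l r ω t m s) (hm : m ≠ 0) (h' : Initialized n k l ω s')
    (htable : s'.table n = Function.update (s.table n) m (rowCounts k l r m (t + 1)))
    (hage : s'.nat ageA = Function.update (s.nat ageA) m ((t + 1) % blockLength l m))
    (hweight : s'.real weightA =
      Function.update (s.real weightA) m (rowWeight k l r (noise n ω) m (t + 1)))
    (hmarked : s'.nat markedV 0 = s.nat markedV 0) : Ready k l r ω t (m + 1) s' where
  __ := h'
  counts a ha := by
    rw [htable]
    rcases eq_or_ne a m with rfl | ham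
    · rw [Function.update_self, progress_succ_self]
    · rw [Function.update_of_ne ham, progress_succ_of_ne ham, h.counts a ha]
  age a ha ha₀ := by
    rw [hage]
    rcases eq_or_ne a m with rfl | ham
    · rw [Function.update_self, progress_succ_self]
    · rw [Function.update_of_ne ham, progress_succ_of_ne ham, h.age a ha ha₀]
  weight a ha ha₀ := by
    rw [hweight]
    rcases eq_or_ne a m with rfl | ham
    · rw [Function.update_self, progress_succ_self]
    · rw [Function.update_of_ne ham, progress_succ_of_ne ham, h.weight a ha ha₀]
  numMarked := by rw [hmarked, progress_succ_of_ne hm.symm, h.numMarked]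

theorem Ready.next_round (h : Ready k l r ω t (l + 1) s) : Ready k l r ω (t + 1) 0 s := by
  have hprogress : ∀ a ≤ l, progress t (l + 1) a = progress (t + 1) 0 a := fun a ha => by
    unfold progress
    rw [if_pos (by lia), if_neg (by lia)]
  exact { h with
    counts := fun a ha => hprogress a ha ▸ h.counts a ha
    age := fun a ha => hprogress a ha ▸ h.age a ha
    weight := fun a ha => hprogress a ha ▸ h.weight a ha
    numMarked := hprogress 0 l.zero_le ▸ h.numMarked }

theorem runs_markP (h : Ready k l r ω t 0 s) (hr : s.nat 0 3 = r (t + 1)) :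
    Runs ω markP s (300 * (n + 1)) fun s' => Ready k l r ω t 1 s' ∧
      s'.real costV 0 = levelCost k l r (noise n ω) 0 (t + 1) := by
  refine ((Runs.nset (Q := fun s' => s'.nat rowV 0 = 0) (by simp)).seq fun s₁ hs₁ hrow =>
    have h₁ := h.frame hs₁
    have hr₁ : s₁.nat 0 3 = r (t + 1) := by rw [hs₁.nat 0, hr]
    (runs_rankRequestP h₁.pages hr₁).seq fun s₂ hs₂ hrank =>
    have h₂ := h₁.frame hs₂
    (runs_missP (i := r (t + 1)) h₂.size (by rw [hs₂.scores, hrank])).seq fun s₃ hs₃ hmiss =>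
    have h₃ := h₂.frame hs₃
    have htable : s₃.table n 0 = markClass k r t := h₃.counts 0 l.zero_le
    (runs_markStepP (i := r (t + 1)) h₃.pages h₃.size (by rw [hs₃.nat 0, hs₂.nat 0, hr₁])
      (by rw [hs₃.nat rowV, hs₂.nat rowV, hrow]) ?_ ?_).mono
      le_rfl fun s₄ hs₄ ⟨htable₄, hmarked⟩ => ⟨?_, ?_⟩).le ?_
  · rw [htable]
    exact h₃.numMarked
  · rw [htable]
    exact markClass_le_four k r t
  · simp
    lia
  · rw [htable] at htable₄ hmarked
    exact h₃.row_zero (h₃.toInitialized.frame hs₄) htable₄ hmarked (hs₄.nat ageA)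
      (hs₄.real weightA)
  · rw [hs₄.real costV, hmiss, h₂.scores l.zero_le (by rw [hs₂.nat rowV, hrow])]
    simp [levelCost, rowCost, rowCache, progress]

theorem runs_rankCountP (h : Processing k l r ω t m s) (hm : m + 1 ≤ l)
    (hrow : s.nat rowV 0 = m + 1) :
    Runs ω rankCountP s (400 * (n + 1)) fun s' =>
      s'.table n = Function.update (s.table n) (m + 1) (rowCounts k l r (m + 1) (t + 1)) ∧
      s'.real rowCostV 0 = rowCost k l r (noise n ω) (m + 1) (t + 1) ∧
      s'.real boundV 0 = costBound k l (m + 1) (t + 1) := by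
  refine ((runs_rankRequestP h.pages h.request).seq fun s₁ hs₁ hrank =>
    have h₁ := h.toReady.frame hs₁
    (runs_countP (r := r) (t := t) (len := blockLength l (m + 1)) (m := m + 1) h₁.pages h₁.size
      ?_ ?_ ?_ ?_ ?_).mono le_rfl fun s₂ _ ⟨htable, hcost, hbound⟩ => ⟨?_, ?_, ?_⟩).le ?_
  · rw [hs₁.nat 0, h.request]
  · rw [hs₁.nat rowV, hrow]
  · rw [hs₁.scores, hrank]
  · rw [h₁.age _ hm m.succ_ne_zero, progress_self]
  · rw [h₁.counts _ hm, progress_self, rowCounts, if_neg m.succ_ne_zero]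
  · lia
  · rw [htable, hs₁.table, rowCounts, if_neg m.succ_ne_zero]
  · rw [hcost, h₁.scores hm (by rw [hs₁.nat rowV, hrow])]
    simp [rowCost, rowCache, progress_self]
  · rw [hbound]
    simp [costBound]

theorem runs_rowP (h : Processing k l r ω t m s) (hm : m + 1 ≤ l) (hrow : s.nat rowV 0 = m + 1) :
    Runs ω rowP s (700 * (n + 1)) (Processing k l r ω t (m + 1)) := by
  refine ((runs_rankCountP h hm hrow).seq fun s₁ hs₁ ⟨htable, hrowCost, hbound⟩ =>
    have h₁ := h.toInitialized.frame hs₁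
    have hrow₁ : s₁.nat rowV 0 = m + 1 := by rw [hs₁.nat rowV, hrow]
    (runs_weightP (g := rowGain k l r (noise n ω) (m + 1) (t + 1))
      (w := rowWeight k l r (noise n ω) (m + 1) (t + 1)) h₁.size hrow₁ (h₁.scale _ hm) h₁.least
      (by rw [hs₁.real costV, h.cost, Nat.add_sub_cancel]) hrowCost hbound rfl ?_).seq
      fun s₂ hs₂ ⟨hweight, hcost⟩ =>
    have hrow₂ : s₂.nat rowV 0 = m + 1 := by rw [hs₂.nat rowV, hrow₁]
    (runs_chooseP hrow₂).seq fun s₃ hs₃ hchoice =>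
    have h₃ := (h₁.frame hs₂).frame hs₃
    (runs_ageP (t := t) (by rw [hs₃.nat rowV, hrow₂]) (h₃.length _ hm) ?_ ?_).mono
      le_rfl fun s₄ hs₄ hage => ⟨h.toReady.row m.succ_ne_zero (h₃.frame hs₄) ?_ ?_ ?_ ?_,
        ?_, ?_, ?_⟩).le ?_
  · rw [hs₁.real weightA, h.weight _ hm m.succ_ne_zero, progress_self]
    rfl
  · exact Nat.mul_pos (by lia) (by positivity)
  · rw [hs₃.nat ageA, hs₂.nat ageA, hs₁.nat ageA, h.age _ hm m.succ_ne_zero, progress_self]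
  · lia
  · rw [hs₄.table, hs₃.table, hs₂.table, htable]
  · rw [hage, hs₃.nat ageA, hs₂.nat ageA, hs₁.nat ageA]
  · rw [hs₄.real weightA, hs₃.real weightA, hweight, hs₁.real weightA]
  · rw [hs₄.nat markedV, hs₃.nat markedV, hs₂.nat markedV, hs₁.nat markedV]
  · rw [hs₄.nat 0, hs₃.nat 0, hs₂.nat 0, hs₁.nat 0, h.request]
  · rw [hs₄.real costV, hs₃.real costV, hcost, levelCost_succ, rowGain, Nat.add_sub_cancel]
    ring
  · rw [hs₄.nat choiceV, hchoice, hs₂.nat choiceV, hs₁.nat choiceV, h.choice, hweight,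
      Function.update_self, hs₂.real thresholdA, h₁.threshold _ hm, selected]

theorem runs_rowsP (h : Ready k l r ω t 1 s) (hr : s.nat 0 3 = r (t + 1))
    (hcost : s.real costV 0 = levelCost k l r (noise n ω) 0 (t + 1)) :
    Runs ω rowsP s (l * (720 * (n + 1)) + 20) (Processing k l r ω t l) := by
  refine ((Runs.nset (Q := fun s' => s'.nat choiceV 0 = 0) (by simp)).seq fun s₁ hs₁ hchoice =>
    have h₁ : Processing k l r ω t 0 s₁ :=
      ⟨h.frame hs₁, by rw [hs₁.nat 0, hr], by rw [hs₁.real costV, hcost], hchoice⟩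
    Runs.forP (N := l) (B := 700 * (n + 1) + 6) (fun m s' => Processing k l r ω t m s') (by decide)
      h₁ (fun m v s' h' => h'.frame (p := nset levelV (.lit 0)) (frame_setNat (by decide) 0 v))
      (fun s' hs' => by simpa [hs'.nat rowsV] using h₁.rows) fun m hm s' _ hlevel h' => ?_).le ?_
  · exact ((Runs.nset (Q := fun s'' => s''.nat rowV 0 = m + 1) (by simpa using hlevel)).seq
      fun s'' hs'' hrow => runs_rowP (h'.frame hs'') hm hrow).le (by simp; lia)
  · simp only [nvar, NExp.cost]
    nlinarith

theorem selected_le (m t : ℕ) : selected k l r ω m t ≤ m := by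
  induction m with
  | zero => exact le_rfl
  | succ m ih =>
    rw [selected]
    split_ifs <;> lia

theorem runs_outputP (h : Processing k l r ω t l s) :
    Runs ω outputP s (n * (200 * (n + 1)) + 20) fun s' => Ready k l r ω (t + 1) 0 s' ∧
      s'.cache n = levelCache k l r ω l (t + 1) := by
  let I (b : ℕ) (s' : State) : Prop := ∀ i : Fin n, i < b →
    (s'.nat outputA i ≠ 0 ↔ i ∈ levelCache k l r ω l (t + 1))
  refine ((Runs.nset (Q := fun s' => s'.nat rowV 0 = selected k l r ω l (t + 1))
    (by simp [h.choice])).seq fun s₁ hs₁ hrow =>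
    have h₁ := h.toReady.frame hs₁
    (Runs.forP (N := n) (B := 150 * (n + 1) + 20) I (by decide) (by simp [I])
      (fun b v s' hI' => by simpa [I] using hI')
      (fun s' hs' => by simpa using (h₁.frame hs').pages)
      fun b hb s' hs' hpage hI' => ?_).mono le_rfl
      fun s₂ hs₂ hI' => ⟨(h₁.frame hs₂).next_round, ?_⟩).le ?_
  · have h' := h₁.frame hs'
    have hrow' : s'.nat rowV 0 = selected k l r ω l (t + 1) := by rw [hs'.nat rowV, hrow]
    have hcache : top k (s'.scores n) = levelCache k l r ω l (t + 1) := by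
      rw [h'.scores (selected_le l (t + 1)) hrow', progress,
        if_pos (Nat.lt_succ_of_le (selected_le l (t + 1)))]
      rfl
    refine ((runs_rankP (i := ⟨b, hb⟩) h'.pages hpage).seq fun s'' hs'' hrank =>
      have hcached : cachedB.holds s'' ↔ ⟨b, hb⟩ ∈ levelCache k l r ω l (t + 1) := by
        simp [cachedB, hs''.nat 0, h'.size, hrank, mem_top, ← hcache]
      have hset (v : ℕ) (hv : v ≠ 0 ↔ ⟨b, hb⟩ ∈ levelCache k l r ω l (t + 1)) :
          I (b + 1) (s''.setNat outputA b v) := fun i hi => by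
        rcases eq_or_ne (i : ℕ) b with rfl | hib
        · simpa using hv
        · simpa [hib, hs''.nat outputA] using hI' i (by lia)
      Runs.cond (fun hc => .natSet ?_) fun hc => .natSet ?_).le ?_
    · simpa [hs''.nat pageV, hpage] using hset 1 (by simp [← hcached, hc])
    · simpa [hs''.nat pageV, hpage] using hset 0 (by simp [← hcached, hc])
    · simp [cachedB]
  · simp only [pagesE, nvar, NExp.cost]
    nlinarith
  · ext i
    simpa [State.cache] using hI' i i.2

end Round

/-! ### The initialization -/

section Initialization

variable {n k l t T : ℕ} {r : ℕ → Fin n} {ω : Coins} {s : State} {w : ℝ}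

theorem runs_initSizeP (hn : s.nat 0 0 = n) (hT : s.nat 0 2 = T) :
    Runs ω initSizeP s (40 * (Nat.clog 2 (n * T) + 1)) fun s' =>
      s'.nat rowsV 0 = Nat.clog 2 (n * T) ∧ s'.real leastV 0 = minWeight (Nat.clog 2 (n * T)) ∧
      s'.drawn = s.drawn := by
  let I (b : ℕ) (s' : State) : Prop := s'.nat 0 0 = n ∧ s'.nat 0 2 = T ∧
    s'.nat rowsV 0 = b ∧ s'.nat powerV 0 = 2 ^ b ∧ s'.drawn = s.drawn
  refine (((Runs.loop (N := Nat.clog 2 (n * T)) (B := 15) I ?_ ?_ ?_).seq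
    fun s' _ ⟨_, _, hrows, hpower, hdrawn⟩ => Runs.rset ?_).nset_seq.nset_seq).le ?_
  · simp [I, hn, hT]
  · intro b _ s' ⟨hn', hT', _, hpower, _⟩
    simp [hpower, hn', hT', ← Nat.lt_clog_iff_pow_lt one_lt_two]
  · intro b _ s' ⟨hn', hT', hrows, hpower, hdrawn⟩
    exact (Runs.nset_seq (Runs.nset (by simp [I, *, pow_succ, mul_two]))).le (by simp)
  · simp [*, minWeight]
  · simp
    lia

theorem runs_sampleP {a N d : ℕ} {e : NExp} (hdrawn : s.drawn = d)
    (he : ∀ s', Frame (sampleP a e) s s' → e.eval s' = N) :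
    Runs ω (sampleP a e) s (N * (e.cost + 15) + (e.cost + 7)) fun s' =>
      s'.drawn = d + N ∧ ∀ i < N, s'.real a i = ω (d + i) := by
  refine (Runs.forP (N := N) (B := 5) (fun b s' => s'.drawn = d + b ∧
    ∀ i < b, s'.real a i = ω (d + i)) (by simp [Program.natWrites]) (by simp [hdrawn]) ?_ he
    ?_).le (by lia)
  · exact fun b v s' hI => by simpa using hI
  · intro b hb s' _ hcell ⟨hdrawn', hI⟩
    refine (Runs.sample ⟨by simp [hdrawn', add_assoc], fun i hi => ?_⟩).le (by simp)
    rcases eq_or_ne i b with rfl | hib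
    · simp [hcell, hdrawn']
    · simpa [hcell, hib] using hI i (by lia)

theorem runs_initSampleP (hn : s.nat 0 0 = n) (hl : s.nat rowsV 0 = l)
    (hw : s.real leastV 0 = w) (hdrawn : s.drawn = 0) :
    Runs ω initSampleP s (60 * (n + l + 2)) fun s' => (∀ i < n, s'.real noiseA i = ω i) ∧
      (∀ a ≤ l, s'.real thresholdA a = ω (n + a)) ∧ ∀ a ≤ l, s'.real weightA a = w := by
  let I (b : ℕ) (s' : State) : Prop := ∀ a < b, s'.real weightA a = w
  refine ((runs_sampleP (N := n) (d := 0) hdrawn ?_).seq fun s₁ hs₁ ⟨hdrawn₁, hnoise⟩ =>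
    (runs_sampleP (N := l + 1) (d := n) (by simpa using hdrawn₁) ?_).seq
      fun s₂ hs₂ ⟨_, hthreshold⟩ =>
    (Runs.forP (N := l + 1) (B := 10) I (by decide) (by simp [I]) ?_ ?_ ?_).mono le_rfl
      fun s₃ hs₃ hweight => ⟨?_, ?_, ?_⟩).le ?_
  · exact fun s' hs' => by simpa [hs'.nat 0] using hn
  · simp
    lia
  · exact fun s' hs' => by simpa [hs'.nat rowsV, hs₁.nat rowsV] using hl
  · exact fun b v s' hI => by simpa [I] using hI
  · exact fun s' hs' => by simpa [hs'.nat rowsV, hs₂.nat rowsV, hs₁.nat rowsV] using hl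
  · intro b hb s' hs' hcell hI
    refine (Runs.realSet fun a ha => ?_).le (by simp)
    rcases eq_or_ne a b with rfl | hab
    · simp [hcell, hs'.real leastV, hs₂.real leastV, hs₁.real leastV, hw]
    · simpa [hcell, hab] using hI a (by lia)
  · simpa [hs₃.real noiseA, hs₂.real noiseA] using hnoise
  · exact fun a ha => by rw [hs₃.real thresholdA, hthreshold a (by lia)]
  · exact fun a ha => hweight a (by lia)

theorem runs_initScaleP (hl : s.nat rowsV 0 = l) :
    Runs ω initScaleP s (80 * (l + 1)) fun s' =>
      ∀ m ≤ l, s'.nat scaleA m = rowScale l m ∧ s'.nat lengthA m = blockLength l m := by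
  let I (b : ℕ) (s' : State) : Prop := s'.nat powerV 0 = 2 ^ b ∧ s'.nat lengthV 0 = l * 4 ^ b ∧
    ∀ m ≤ l, l < m + b → s'.nat scaleA m = 2 ^ (l - m) ∧ s'.nat lengthA m = blockLength l m
  refine (((Runs.forP (N := l + 1) (B := 32) I (by decide) ?_ ?_ ?_ ?_).seq
    fun s' _ ⟨_, _, hI⟩ => Runs.natSet fun m hm => ?_).nset_seq.nset_seq).le ?_
  · simpa [I, hl] using fun m _ hm => absurd hm (by lia)
  · exact fun b v s' hI => by simpa [I] using hI
  · exact fun s' hs' => by simpa [hs'.nat rowsV] using hl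
  · intro b hb s' hs' hcell ⟨hpower, hlength, hI⟩
    have hrows : s'.nat rowsV 0 = l := by simpa [hs'.nat rowsV] using hl
    refine (Runs.natSet_seq (Runs.natSet_seq (Runs.nset_seq (Runs.nset
      ⟨?_, ?_, fun m hm hmb => ?_⟩)))).le ?_
    · simp
    · simp [hpower, pow_succ, mul_two]
    · simp [hlength, pow_succ, mul_assoc]
    · rcases eq_or_ne m (l - b) with rfl | hm'
      · simp [hrows, hcell, hpower, hlength, blockLength, Nat.sub_sub_self (show b ≤ l by lia)]
      · simpa [hrows, hcell, hm'] using hI m hm (by lia)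
  · rcases eq_or_ne m 0 with rfl | hm₀
    · simp [rowScale, hI 0]
    · simp [rowScale, hm₀, hI m hm (by lia)]
  · simp
    lia

theorem runs_initP (hn : s.nat 0 0 = n) (hk : s.nat 0 1 = k) (hT : s.nat 0 2 = T)
    (hdrawn : s.drawn = 0) :
    Runs ω initP s (250 * (n + Nat.clog 2 (n * T) + 1)) fun s' =>
      Initialized n k (Nat.clog 2 (n * T)) ω s' ∧
      ∀ a ≤ Nat.clog 2 (n * T), s'.real weightA a = minWeight (Nat.clog 2 (n * T)) := by
  refine ((runs_initSizeP hn hT).seq fun s₁ hs₁ ⟨hrows, hleast, hdrawn₁⟩ =>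
    (runs_initSampleP (n := n) (by simpa [hs₁.nat 0] using hn) hrows hleast
      (hdrawn₁.trans hdrawn)).seq fun s₂ hs₂ ⟨hnoise, hthreshold, hweight⟩ =>
    (runs_initScaleP (by rw [hs₂.nat rowsV, hrows])).seq fun s₃ hs₃ hscale =>
    Runs.nset ⟨?_, by simpa [hs₃.real weightA] using hweight⟩).le ?_
  · simp
    lia
  · exact {
      pages := by simp [hs₃.nat 0, hs₂.nat 0, hs₁.nat 0, hn]
      size := by simp [hs₃.nat 0, hs₂.nat 0, hs₁.nat 0, hk]
      ready := by simp
      rows := by simp [hs₃.nat rowsV, hs₂.nat rowsV, hrows]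
      scale m hm := by simp [(hscale m hm).1]
      length m hm := by simp [(hscale m hm).2]
      noise := by simpa [hs₃.real noiseA] using hnoise
      threshold := by simpa [hs₃.real thresholdA] using hthreshold
      least := by simp [hs₃.real leastV, hs₂.real leastV, hleast] }

theorem Initialized.ready_zero (h : Initialized n k l ω s) (hcount : s.table n = 0)
    (hage : s.nat ageA = 0) (hweight : ∀ a ≤ l, s.real weightA a = minWeight l)
    (hmarked : s.nat markedV 0 = 0) : Ready k l r ω 0 0 s where
  __ := h
  counts a _ := by
    simp only [hcount, progress, Nat.not_lt_zero, if_false, rowCounts]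
    split_ifs <;> rfl
  age a _ _ := by simp [hage, progress]
  weight a ha _ := by rw [hweight a ha]; rfl
  numMarked := by simp [hmarked, progress, marked, markClass]

theorem runs_initP_initialState (i : Fin n) :
    Runs ω initP ((initialState n k T).withRequest i) (250 * (n + Nat.clog 2 (n * T) + 1))
      fun s' => Ready k (Nat.clog 2 (n * T)) r ω 0 0 s' ∧ s'.nat 0 3 = i := by
  have hzero (a : ℕ) (ha : a ≠ 0) : ((initialState n k T).withRequest i).nat a = 0 := by
    ext
    simp [State.withRequest, initialState, ha]
  refine (runs_initP (n := n) (k := k) (T := T) ?_ ?_ ?_ rfl).mono le_rfl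
    fun s' hs' ⟨hinit, hweight⟩ => ⟨hinit.ready_zero ?_ ?_ hweight ?_, ?_⟩
  · simp [State.withRequest, initialState]
  · simp [State.withRequest, initialState]
  · simp [State.withRequest, initialState]
  · ext
    simp [State.table, hs'.nat countA, hzero countA]
  · rw [hs'.nat ageA, hzero ageA (by decide)]
  · simp [hs'.nat markedV, hzero markedV]
  · simp [hs'.nat 0, State.withRequest]

theorem Ready.withRequest (h : Ready k l r ω t m s) (i : Fin n) :
    Ready k l r ω t m (s.withRequest i) where
  __ := h
  pages := by simp [State.withRequest, h.pages]
  size := by simp [State.withRequest, h.size]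

/-- The memory at the beginning of round `t + 1`, before the request is written. -/
def Between {n : ℕ} (k T : ℕ) (r : ℕ → Fin n) (ω : Coins) (t : ℕ) (s : State) : Prop :=
  if t = 0 then s = initialState n k T else Ready k (Nat.clog 2 (n * T)) r ω t 0 s

theorem runs_cond_initP (h : Between k T r ω t s) (i : Fin n) :
    Runs ω (.cond (.natLt (nvar readyV) (.lit 1)) initP .skip) (s.withRequest i)
      (250 * (n + Nat.clog 2 (n * T) + 1) + 6)
      fun s' => Ready k (Nat.clog 2 (n * T)) r ω t 0 s' ∧ s'.nat 0 3 = i := by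
  rcases eq_or_ne t 0 with rfl | ht
  · obtain rfl : s = initialState n k T := h
    refine (Runs.cond (B' := 0) (fun _ => runs_initP_initialState i) fun hb => ?_).le ?_
    · simp [State.withRequest, initialState] at hb
    · simp
      lia
  · simp only [Between, if_neg ht] at h
    refine (Runs.cond (B := 0) (fun hb => ?_) fun _ =>
      Runs.skip ⟨h.withRequest i, by simp [State.withRequest]⟩).le ?_
    · simp [(h.withRequest i).ready] at hb
    · simp

theorem runs_pagingP (h : Between k T r ω t s) :
    Runs ω pagingP (s.withRequest (r (t + 1)))
      (1000 * ((n + 1) * (n + Nat.clog 2 (n * T) + 1))) fun s' =>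
        Between k T r ω (t + 1) s' ∧
        s'.cache n = levelCache k (Nat.clog 2 (n * T)) r ω (Nat.clog 2 (n * T)) (t + 1) := by
  set l := Nat.clog 2 (n * T)
  refine ((runs_cond_initP h _).seq fun s₁ _ ⟨hready₁, hr₁⟩ =>
    (runs_markP hready₁ hr₁).seq fun s₂ hs₂ ⟨hready₂, hcost⟩ =>
    (runs_rowsP hready₂ (by rw [hs₂.nat 0, hr₁]) hcost).seq fun s₃ _ hproc =>
    runs_outputP hproc).le ?_
  nlinarith [Nat.zero_le (n * l), Nat.zero_le (n ^ 2)]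

end Initialization

/-! ### Runtime, competitiveness and regret -/

section Conclusion

variable {n k l T : ℕ} {r : ℕ → Fin n}

theorem le_two_pow_clog (hn : 1 ≤ n) : T ≤ 2 ^ Nat.clog 2 (n * T) :=
  (Nat.le_mul_of_pos_left T hn).trans (Nat.le_pow_clog one_lt_two _)

theorem clog_sub_one_mul_log_two_le {N : ℕ} (hN : 2 ≤ N) :
    ((Nat.clog 2 N : ℝ) - 1) * Real.log 2 ≤ Real.log N := by
  have hpow : (2 : ℝ) ^ (Nat.clog 2 N - 1) ≤ N :=
    mod_cast (Nat.pow_pred_clog_lt_self one_lt_two hN).le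
  have hlog := Real.log_le_log (by positivity) hpow
  rwa [Real.log_pow, Nat.cast_sub (Nat.clog_pos one_lt_two hN), Nat.cast_one] at hlog

theorem clog_le_four_mul_log {N : ℕ} (hN : 2 ≤ N) : (Nat.clog 2 N : ℝ) ≤ 4 * Real.log N := by
  have hclog := clog_sub_one_mul_log_two_le hN
  have hlog : Real.log 2 ≤ Real.log N := Real.log_le_log two_pos (mod_cast hN)
  nlinarith [Real.log_two_gt_d9]

theorem clog_mul_le (hn : 1 ≤ n) (hT : 1 ≤ T) :
    (Nat.clog 2 (n * T) : ℝ) ≤ 4 * (n + Real.log T) := by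
  have hn₀ : (0 : ℝ) < n := mod_cast hn
  have hT₀ : (0 : ℝ) < T := mod_cast hT
  rcases le_or_gt 2 (n * T) with h | h
  · have hlog := clog_le_four_mul_log h
    rw [Nat.cast_mul, Real.log_mul hn₀.ne' hT₀.ne'] at hlog
    linarith [Real.log_le_sub_one_of_pos hn₀]
  · rw [Nat.clog_of_right_le_one (by lia), Nat.cast_zero]
    positivity

theorem steps_le (hn : 1 ≤ n) (hT : 1 ≤ T) {d : ℕ} (hd : 12000 ≤ d) :
    ((1000 * ((n + 1) * (n + Nat.clog 2 (n * T) + 1)) : ℕ) : ℝ) ≤ d * (n + Real.log T) ^ d := by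
  set x := (n : ℝ) + Real.log T
  have hnx : (n : ℝ) ≤ x := le_add_of_nonneg_right (Real.log_natCast_nonneg T)
  have hx : 1 ≤ x := hnx.trans' (mod_cast hn)
  have hclog : (Nat.clog 2 (n * T) : ℝ) ≤ 4 * x := clog_mul_le hn hT
  calc ((1000 * ((n + 1) * (n + Nat.clog 2 (n * T) + 1)) : ℕ) : ℝ)
      = 1000 * ((n + 1) * (n + Nat.clog 2 (n * T) + 1)) := by push_cast; rfl
    _ ≤ 1000 * ((2 * x) * (6 * x)) := by gcongr <;> linarith
    _ = 12000 * x ^ 2 := by ring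
    _ ≤ d * x ^ d := mul_le_mul (mod_cast hd) (pow_le_pow_right₀ hx (by lia)) (by positivity)
      (by positivity)

theorem selects_levelCache (hk : 1 ≤ k) (hkn : k ≤ n) (hT : 1 ≤ T) {d : ℕ} (hd : 12000 ≤ d)
    (ω : Coins) :
    Selects pagingP n k T r ω (d * (n + Real.log T) ^ d)
      (levelCache k (Nat.clog 2 (n * T)) r ω (Nat.clog 2 (n * T))) := by
  choose! τ next hexec hτ hbetween hcache using
    fun t s (h : Between k T r ω t s) => runs_pagingP h
  let S (t : ℕ) : State := Nat.rec (initialState n k T) next t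
  have hS (t : ℕ) : Between k T r ω t (S t) := by
    induction t with
    | zero => rfl
    | succ t ih => exact hbetween t _ ih
  refine ⟨S, rfl, fun t ht => ?_⟩
  obtain ⟨t, rfl⟩ := Nat.exists_eq_add_of_le' (mem_Icc.1 ht).1
  exact ⟨⟨τ t (S t), (Nat.cast_le.2 (hτ t _ (hS t))).trans (steps_le (hk.trans hkn) hT hd),
    hexec t _ (hS t)⟩, (hcache t _ (hS t)).symm, card_levelCache hkn ..⟩

theorem intervalCost_congr {A B : ℕ → Finset (Fin n)} {a b : ℕ} (h : ∀ t ∈ Icc a b, A t = B t) :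
    intervalCost r A a b = intervalCost r B a b := by
  refine congr_arg₂ _ (sum_congr rfl fun t ht => by rw [h t ht]) (sum_congr rfl fun t ht => ?_)
  rw [mem_Icc] at ht
  rw [h t (mem_Icc.2 (by lia)), h (t - 1) (mem_Icc.2 (by lia))]

theorem intervalCost_eq_sum_roundCost (r : ℕ → Fin n) {C : ℕ → Finset (Fin n)} (h : C 0 = C 1)
    (T : ℕ) : intervalCost r C 1 T = ∑ t ∈ Ioc 0 T, roundCost (r t) (C t) (C (t - 1)) := by
  have hmove : ∑ t ∈ Icc 2 T, moveCost (C t) (C (t - 1)) =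
      ∑ t ∈ Icc 1 T, moveCost (C t) (C (t - 1)) := by
    refine sum_subset (Icc_subset_Icc_left one_le_two) fun t ht ht' => ?_
    obtain rfl : t = 1 := by simp only [mem_Icc] at ht ht'; lia
    simp [h, moveCost]
  simp only [intervalCost, roundCost, sum_add_distrib, hmove]
  rfl

theorem competitive_levelCache (hk : 1 ≤ k) (hkn : k ≤ n) (hT : 1 ≤ T) (hl : T ≤ 2 ^ l)
    {C : ℕ → Finset (Fin n)} (hC : ∀ t ∈ Icc 1 T, #(C t) = k) :
    ∫ ω, intervalCost r (levelCache k l r ω l) 1 T ∂coinMeasure ≤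
      2 * harmonic k * intervalCost r C 1 T + (harmonic k * k + 15 * k) := by
  let D : ℕ → Finset (Fin n) := Function.update C 0 (C 1)
  have hDC (t : ℕ) (ht : 1 ≤ t) : D t = C t := Function.update_of_ne (by lia) ..
  have hcost : intervalCost r C 1 T = ∑ t ∈ Ioc 0 T, roundCost (r t) (D t) (D (t - 1)) := by
    rw [← intervalCost_eq_sum_roundCost r (Function.update_self ..)]
    exact intervalCost_congr fun t ht => (hDC t (mem_Icc.1 ht).1).symm
  have hD (t : ℕ) (ht : t ≤ T) : #(D t) = k := by
    rcases t.eq_zero_or_pos with rfl | ht₀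
    · exact hC 1 (mem_Icc.2 ⟨le_rfl, hT⟩)
    · rw [hDC t ht₀, hC t (mem_Icc.2 ⟨ht₀, ht⟩)]
  have hint (t : ℕ) : Integrable (fun ω : Coins => rowCost k l r (noise n ω) 0 t) coinMeasure :=
    (memLp_rowCost 0 t).integrable le_top
  calc ∫ ω, intervalCost r (levelCache k l r ω l) 1 T ∂coinMeasure
      ≤ ∫ ω, ∑ t ∈ Ioc 0 T, levelCost k l r (noise n ω) l t ∂coinMeasure :=
        integral_intervalCost_le hk hkn le_rfl
    _ ≤ ∫ ω, (∑ t ∈ Ioc 0 T, rowCost k l r (noise n ω) 0 t + 15 * k) ∂coinMeasure :=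
        integral_mono (integrable_sum_levelCost hk ..)
          ((integrable_finsetSum _ fun t _ => hint t).add (integrable_const _))
          fun ω => sum_levelCost_le_sum_rowCost_zero hk hl
    _ = ∑ t ∈ Ioc 0 T, ∫ ω, rowCost k l r (noise n ω) 0 t ∂coinMeasure + 15 * k := by
        rw [integral_add (integrable_finsetSum _ fun t _ => hint t) (integrable_const _),
          integral_finsetSum _ fun t _ => hint t, integral_const, probReal_univ, one_smul]
    _ ≤ 2 * harmonic k * intervalCost r C 1 T + (harmonic k * k + 15 * k) := by
        rw [hcost]
        linarith [sum_integral_rowCost_zero_le (r := r) hk hkn l hD]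

theorem integral_intervalCost_levelCache_le (hk : 1 ≤ k) (hkn : k ≤ n) (hl : 1 ≤ l) {a b : ℕ}
    (ha : 1 ≤ a) (hab : a ≤ b) (hb : b ≤ 2 ^ l) {C : Finset (Fin n)} (hC : #C = k) :
    ∫ ω, intervalCost r (levelCache k l r ω l) a b ∂coinMeasure ≤
      ∑ t ∈ Icc a b, missLoss (r t) C + 640 * (k * √(l * #(Icc a b))) := by
  obtain ⟨a, rfl⟩ := Nat.exists_eq_add_of_le' ha
  refine (integral_intervalCost_le hk hkn ha).trans ?_
  rw [Icc_add_one_left_eq_Ioc, Nat.card_Ioc, Nat.cast_sub (a.le_succ.trans hab)]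
  exact integral_sum_levelCost_le hk hkn hl hC (a.le_succ.trans hab) hb

theorem regret_levelCache (hk : 1 ≤ k) (hkn : k ≤ n) {a b : ℕ} (ha : 1 ≤ a) (hab : a ≤ b)
    (hb : b ≤ T) {C : Finset (Fin n)} (hC : #C = k) :
    ∫ ω, intervalCost r (levelCache k (Nat.clog 2 (n * T)) r ω (Nat.clog 2 (n * T))) a b
        ∂coinMeasure ≤
      ∑ t ∈ Icc a b, missLoss (r t) C + 1280 * (k * √(#(Icc a b) * Real.log (n * T))) := by
  rcases hkn.eq_or_lt with rfl | hlt
  · have hzero (ω : Coins) : intervalCost r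
        (levelCache k (Nat.clog 2 (k * T)) r ω (Nat.clog 2 (k * T))) a b = 0 :=
      intervalCost_eq_zero_of_univ fun t _ => by
        rw [← card_eq_iff_eq_univ, card_levelCache le_rfl, Fintype.card_fin]
    simp only [hzero, integral_zero]
    exact add_nonneg (sum_nonneg fun _ _ => missLoss_nonneg ..) (by positivity)
  have hnT : 2 ≤ n * T := by nlinarith
  refine (integral_intervalCost_levelCache_le hk hkn (Nat.clog_pos one_lt_two hnT) ha hab
    (hb.trans (le_two_pow_clog (hk.trans hkn))) hC).trans ?_
  have hlog := clog_le_four_mul_log hnT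
  have hlog₀ := Real.log_natCast_nonneg (n * T)
  rw [Nat.cast_mul] at hlog hlog₀
  have hsqrt : √(Nat.clog 2 (n * T) * #(Icc a b)) ≤ 2 * √(#(Icc a b) * Real.log (n * T)) := by
    rw [Real.sqrt_le_left (by positivity), mul_pow, Real.sq_sqrt (by positivity)]
    nlinarith [Nat.cast_nonneg (α := ℝ) #(Icc a b)]
  linarith [mul_le_mul_of_nonneg_left hsqrt k.cast_nonneg]

end Conclusion

end Paging

theorem mainTheorem8 :
    ∃ (P : Paging.Program) (d : ℕ) (K : ℝ),
      ∀ n k : ℕ, 1 ≤ k → k ≤ n → ∃ β : ℝ, 0 < β ∧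
        ∀ T : ℕ, 1 ≤ T → ∀ r : ℕ → Fin n,
          ∃ A : Paging.Coins → ℕ → Finset (Fin n),
            (∀ ω : Paging.Coins,
              Paging.Selects P n k T r ω ((d : ℝ) * ((n : ℝ) + Real.log (T : ℝ)) ^ d) (A ω)) ∧
            (∀ t ∈ Finset.Icc 1 T, ∀ C : Finset (Fin n), MeasurableSet {ω | A ω t = C}) ∧
            (∀ C : ℕ → Finset (Fin n), (∀ t ∈ Finset.Icc 1 T, (C t).card = k) →
              ∫ ω, Paging.intervalCost r (A ω) 1 T ∂Paging.coinMeasure ≤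
                2 * (harmonic k : ℝ) * Paging.intervalCost r C 1 T + β) ∧
            (∀ a b : ℕ, 1 ≤ a → a ≤ b → b ≤ T →
              ∀ C : Finset (Fin n), C.card = k →
                ∫ ω, Paging.intervalCost r (A ω) a b ∂Paging.coinMeasure ≤
                  ∑ t ∈ Finset.Icc a b, Paging.missLoss (r t) C +
                    K * ((k : ℝ) * Real.sqrt
                      (((Finset.Icc a b).card : ℝ) * Real.log ((n : ℝ) * (T : ℝ))))) := by
  refine ⟨Paging.pagingP, 12000, 1280, fun n k hk hkn => ⟨harmonic k * k + 15 * k, ?_,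
    fun T hT r => ⟨fun ω => Paging.levelCache k (Nat.clog 2 (n * T)) r ω (Nat.clog 2 (n * T)),
      Paging.selects_levelCache hk hkn hT le_rfl,
      fun t _ C => Paging.measurable_levelCache _ t (MeasurableSet.singleton C),
      fun C hC => Paging.competitive_levelCache hk hkn hT
        (Paging.le_two_pow_clog (hk.trans hkn)) hC,
      fun a b ha hab hb C hC => Paging.regret_levelCache hk hkn ha hab hb hC⟩⟩⟩
  have hharmonic := Paging.one_le_harmonic hk
  positivity
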